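/- A *root system* in a finite-dimensional Euclidean space $V$ is a finite set $\Phi$ of non-zero vectors spanning $V$ such that, for all $\alpha\in\Phi$, $\Phi\cap\mathbb{R}\alpha=\{-\alpha,\alpha\}$ and $s_\alpha\Phi=\Phi$, where $s_\alpha(v)=v-2\frac{(v|\alpha)}{(\alpha|\alpha)}\alpha$ (it need not be crystallographic). It is *irreducible* if it is non-empty and not the union of two non-empty, disjoint, mutually orthogonal subsets. It has *type* $M$, for a Coxeter–Dynkin diagram $M=(m_{ij})$, if $V$ has a basis of roots $\alpha_i$ (simple roots) such that every root is a real linear combination of the $\alpha_i$ with coefficients of the same sign and $(\alpha_i|\alpha_j)=-|\alpha_i||\alpha_j|\cos(\pi/m_{ij})$; the lengths of the roots are irrelevant. Two root systems are *equivalent* if, after all roots are rescaled to unit length, an isometry maps one onto the other. For a root system $\Phi$ in $\mathbb{R}^3$, let $G\subset \mathrm{Cl}(3)$ (with $v^2=(v|v)$) be its spinor group, i.e. the group generated by the products $\hat\alpha\hat\beta$ of the unit vectors $\hat\alpha=\alpha/|\alpha|$, $\alpha\in\Phi$. Identifying the spinor $a_0+a_1e_2e_3+a_2e_3e_1+a_3e_1e_2$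 with $(a_0,a_1,a_2,a_3)\in\mathbb{R}^4$, which carries the inner product $(R_1,R_2)=\frac12(R_1\tilde R_2+R_2\tilde R_1)$ to the standard one, regard $G$ as a set of vectors in $\mathbb{R}^4$, called the set *induced* by $\Phi$. Call an irreducible root system in $\mathbb{R}^4$ *exceptional* if it is of none of the types $A_4$, $B_4$, $D_4$ (the members of the infinite families $A_n,B_n,D_n$), or if its diagram has a symmetry of order $3$ (triality). Then: 1. A subset of $\mathbb{R}^3$ is an irreducible root system if and only if it is a root system of type $A_3$, $B_3$ or $H_3$. Each of these three types occurs, no root system has two of them, and any two root systems in $\mathbb{R}^3$ of the same one of these types are equivalent. 2. If $\Phi$ is a root system in $\mathbb{R}^3$ of type $A_3$, $B_3$, $H_3$ or $A_1^3$, then the set induced by $\Phi$ is a root system of type $D_4$, $F_4$, $H_4$ or $A_1^4$, respectively. 3. A subset of $\mathbb{R}^4$ is an exceptional root system if and only if it is a root system of type $D_4$, $F_4$ or $H_4$. 4. A subset of $\mathbb{R}^4$ is an exceptional root system if and only if it is a root system equivalent to the set induced by some irreducible root system in $\mathbb{R}^3$. -/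

import Mathlib

open scoped RealInnerProductSpace

noncomputable section

namespace SpinorInduction

/-! ### Root systems in a Euclidean space -/

section RootSystems

variable {V W : Type*} [NormedAddCommGroup V] [InnerProductSpace ℝ V]
  [NormedAddCommGroup W] [InnerProductSpace ℝ W]

/-- The reflection `s_α : v ↦ v - 2 (v|α)/(α|α) α` in the hyperplane orthogonal to `α`. -/
def refl (α v : V) : V := v - (2 * (⟪v, α⟫ / ⟪α, α⟫)) • α

/-- A (finite, reduced, not necessarily crystallographic) root system: a finite set of non-zero
vectors that spans the space, meets the line through each of its elements `α` exactly in `{-α, α}`,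
and is mapped onto itself by the reflections in its elements. -/
structure IsRootSystem (Φ : Set V) : Prop where
  finite : Φ.Finite
  zero_notMem : (0 : V) ∉ Φ
  span_eq_top : Submodule.span ℝ Φ = ⊤
  inter_line : ∀ α ∈ Φ, Φ ∩ (Submodule.span ℝ {α} : Set V) = {-α, α}
  image_refl : ∀ α ∈ Φ, refl α '' Φ = Φ

/-- An irreducible root system: it is non-empty and is not the union of two non-empty disjoint
subsets that are orthogonal to each other. -/
def IsIrreducibleRootSystem (Φ : Set V) : Prop :=
  IsRootSystem Φ ∧ Φ.Nonempty ∧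
    ∀ Φ₁ ⊆ Φ, (∀ α ∈ Φ₁, ∀ β ∈ Φ \ Φ₁, ⟪α, β⟫ = 0) → Φ₁ = ∅ ∨ Φ₁ = Φ

/-- `Δ` is a system of simple roots of `Φ`, indexed by `ι`: a basis of the space consisting of roots
such that each root is a linear combination of `Δ` with coefficients of the same sign. -/
def IsSimpleSystem {ι : Type*} (Φ : Set V) (Δ : Module.Basis ι ℝ V) : Prop :=
  (∀ i, Δ i ∈ Φ) ∧ ∀ α ∈ Φ, (∀ i, 0 ≤ Δ.repr α i) ∨ (∀ i, Δ.repr α i ≤ 0)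

/-- `Φ` is a root system whose Coxeter-Dynkin diagram is given by the Coxeter matrix `M`: for some
system of simple roots, the simple roots `i` and `j` are the normals of two mirrors that meet at the
angle `π / M i j`. The lengths of the roots play no role. -/
def HasType {ι : Type*} (Φ : Set V) (M : CoxeterMatrix ι) : Prop :=
  IsRootSystem Φ ∧ ∃ Δ : Module.Basis ι ℝ V, IsSimpleSystem Φ Δ ∧
    ∀ i j, ⟪Δ i, Δ j⟫ = -Real.cos (Real.pi / M i j) * (‖Δ i‖ * ‖Δ j‖)

/-- The unit vectors in the directions of the elements of `Φ`. -/
def normalized (Φ : Set V) : Set V := (fun α => ‖α‖⁻¹ • α) '' Φ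

/-- `Φ` and `Ψ` are the same root system up to isometry and the choice of the lengths of the
roots. -/
def Equivalent (Φ : Set V) (Ψ : Set W) : Prop :=
  ∃ e : V ≃ₗᵢ[ℝ] W, e '' normalized Φ = normalized Ψ

end RootSystems

/-! ### Diagrams -/

/-- The diagram `A₁ⁿ`: `n` nodes and no links. -/
def A₁pow (n : ℕ) : CoxeterMatrix (Fin n) where
  M := Matrix.of fun i j => if i = j then 1 else 2
  isSymm := by
    ext i j
    simp [Matrix.transpose_apply, eq_comm]
  diagonal := by simp
  off_diagonal := by
    intro i j h
    simp [h]

/-- The diagram `D₄`: the node `1` is joined by simple links to the nodes `0`, `2` and `3`, and there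
is no other link. -/
def D₄ : CoxeterMatrix (Fin 4) where
  M := !![1, 3, 2, 2;
          3, 1, 3, 3;
          2, 3, 1, 2;
          2, 3, 2, 1]
  isSymm := by
    ext i j
    fin_cases i <;> fin_cases j <;> rfl
  diagonal := by
    intro i
    fin_cases i <;> rfl
  off_diagonal := by
    intro i j
    fin_cases i <;> fin_cases j <;> simp

/-- The Coxeter-Dynkin diagram of `Ψ` has a symmetry of order three. -/
def HasTriality {V : Type*} [NormedAddCommGroup V] [InnerProductSpace ℝ V] (Ψ : Set V) : Prop :=
  ∃ M : CoxeterMatrix (Fin 4), HasType Ψ M ∧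
    ∃ σ : Equiv.Perm (Fin 4), orderOf σ = 3 ∧ M.reindex σ = M

/-- An irreducible four-dimensional root system is exceptional if its diagram does not belong to one
of the families `Aₙ`, `Bₙ`, `Dₙ` that exist in all dimensions, or if its diagram has a symmetry of
order three (triality). -/
def IsExceptional (Ψ : Set (EuclideanSpace ℝ (Fin 4))) : Prop :=
  IsIrreducibleRootSystem Ψ ∧
    (¬ (HasType Ψ (CoxeterMatrix.A 4) ∨ HasType Ψ (CoxeterMatrix.B 4) ∨ HasType Ψ D₄) ∨
      HasTriality Ψ)

/-! ### The Clifford algebra `Cl(3)` and its spinors -/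

/-- The quadratic form `v ↦ (v|v)` of three-dimensional Euclidean space. -/
def Q₃ : QuadraticForm ℝ (EuclideanSpace ℝ (Fin 3)) :=
  LinearMap.BilinMap.toQuadraticMap (innerₗ (EuclideanSpace ℝ (Fin 3)))

/-- The Clifford algebra of three-dimensional Euclidean space, with `v * v = (v|v)`. -/
abbrev Cl₃ : Type := CliffordAlgebra Q₃

/-- The orthonormal basis vectors `e 0`, `e 1`, `e 2` as elements of the Clifford algebra. -/
def e (i : Fin 3) : Cl₃ := CliffordAlgebra.ι Q₃ (EuclideanSpace.single i 1)

theorem e_sq (i : Fin 3) : e i * e i = 1 := by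
  have h : Q₃ (EuclideanSpace.single i 1) = 1 := by simp [Q₃]
  rw [e, CliffordAlgebra.ι_sq_scalar, h, map_one]

theorem e_anticomm {i j : Fin 3} (h : i ≠ j) : e i * e j = -(e j * e i) := by
  unfold e
  apply CliffordAlgebra.ι_mul_ι_comm_of_isOrtho
  have h1 : ⟪(EuclideanSpace.single i 1 : EuclideanSpace ℝ (Fin 3)),
      EuclideanSpace.single j 1⟫ = 0 := by
    simp [EuclideanSpace.inner_single_left, h]
  have h2 := h1
  rw [real_inner_comm] at h2
  simp only [QuadraticMap.isOrtho_def, Q₃, LinearMap.BilinMap.toQuadraticMap_apply,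
    innerₗ_apply_apply, inner_add_left, inner_add_right, h1, h2]
  ring

/-- The spinor `a₀ + a₁ Ie₁ + a₂ Ie₂ + a₃ Ie₃` with the coordinate vector `a`, where
`Ie₁ = e₂e₃`, `Ie₂ = e₃e₁`, `Ie₃ = e₁e₂` for the pseudoscalar `I = e₁e₂e₃` (the vectors `e₁`, `e₂`,
`e₃` are `e 0`, `e 1`, `e 2` here). -/
def spinorOf : EuclideanSpace ℝ (Fin 4) →ₗ[ℝ] Cl₃ where
  toFun a := a 0 • (1 : Cl₃) + a 1 • (e 1 * e 2) + a 2 • (e 2 * e 0) + a 3 • (e 0 * e 1)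
  map_add' a b := by
    simp only [PiLp.add_apply]
    module
  map_smul' r a := by
    simp only [PiLp.smul_apply, smul_eq_mul, RingHom.id_apply]
    module

theorem spinorOf_apply (a : EuclideanSpace ℝ (Fin 4)) :
    spinorOf a = a 0 • (1 : Cl₃) + a 1 • (e 1 * e 2) + a 2 • (e 2 * e 0) + a 3 • (e 0 * e 1) :=
  rfl

theorem reverse_spinorOf (a : EuclideanSpace ℝ (Fin 4)) :
    CliffordAlgebra.reverse (spinorOf a) =
      a 0 • (1 : Cl₃) - a 1 • (e 1 * e 2) - a 2 • (e 2 * e 0) - a 3 • (e 0 * e 1) := by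
  have hr (i : Fin 3) : CliffordAlgebra.reverse (e i) = e i := CliffordAlgebra.reverse_ι _
  simp only [spinorOf_apply, map_add, map_smul, CliffordAlgebra.reverse.map_mul,
    CliffordAlgebra.reverse.map_one, hr]
  rw [e_anticomm (show (2 : Fin 3) ≠ 1 by decide), e_anticomm (show (0 : Fin 3) ≠ 2 by decide),
    e_anticomm (show (1 : Fin 3) ≠ 0 by decide)]
  module

theorem spinorOf_mul (a b : EuclideanSpace ℝ (Fin 4)) :
    spinorOf a * spinorOf b =
      (a 0 * b 0 - a 1 * b 1 - a 2 * b 2 - a 3 * b 3) • (1 : Cl₃) +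
      (a 0 * b 1 + a 1 * b 0 - a 2 * b 3 + a 3 * b 2) • (e 1 * e 2) +
      (a 0 * b 2 + a 2 * b 0 - a 3 * b 1 + a 1 * b 3) • (e 2 * e 0) +
      (a 0 * b 3 + a 3 * b 0 - a 1 * b 2 + a 2 * b 1) • (e 0 * e 1) := by
  have h (i j : Fin 3) (hij : i ≠ j) : e i * e j * (e i * e j) = -1 := by
    rw [mul_assoc, ← mul_assoc (e j), e_anticomm hij.symm, neg_mul, mul_assoc, e_sq, mul_one,
      mul_neg, e_sq]
  have h1 (i j k : Fin 3) (hik : i ≠ k) : e i * e j * (e j * e k) = -(e k * e i) := by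
    rw [mul_assoc, ← mul_assoc (e j), e_sq, one_mul, e_anticomm hik]
  have h2 (i j k : Fin 3) (hij : i ≠ j) (hjk : j ≠ k) (hik : i ≠ k) :
      e i * e j * (e k * e i) = e j * e k := by
    rw [e_anticomm hij, e_anticomm hik.symm, neg_mul_neg, mul_assoc, ← mul_assoc (e i), e_sq,
      one_mul]
  simp only [spinorOf_apply, add_mul, mul_add, smul_mul_smul_comm, one_mul, mul_one,
    h 1 2 (by decide), h 2 0 (by decide), h 0 1 (by decide),
    h1 1 2 0 (by decide), h1 2 0 1 (by decide), h1 0 1 2 (by decide),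
    h2 1 2 0 (by decide) (by decide) (by decide), h2 2 0 1 (by decide) (by decide) (by decide),
    h2 0 1 2 (by decide) (by decide) (by decide)]
  module

/-- Under `spinorOf`, the standard inner product of four-dimensional Euclidean space is the inner
product `(R₁, R₂) = (R₁ R̃₂ + R₂ R̃₁) / 2` of spinors. -/
theorem algebraMap_inner (a b : EuclideanSpace ℝ (Fin 4)) :
    algebraMap ℝ Cl₃ ⟪a, b⟫ =
      (1 / 2 : ℝ) • (spinorOf a * CliffordAlgebra.reverse (spinorOf b) +
        spinorOf b * CliffordAlgebra.reverse (spinorOf a)) := by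
  have hr (c : EuclideanSpace ℝ (Fin 4)) : CliffordAlgebra.reverse (spinorOf c) =
      spinorOf !₂[c 0, -c 1, -c 2, -c 3] := by
    rw [reverse_spinorOf, spinorOf_apply]
    simp only [Matrix.cons_val]
    module
  rw [hr, hr, spinorOf_mul, spinorOf_mul, Algebra.algebraMap_eq_smul_one]
  simp only [PiLp.inner_apply, Fin.sum_univ_four, Matrix.cons_val, RCLike.inner_apply,
    conj_trivial]
  module

/-- The elements `spinorOf a` are exactly the even elements of the Clifford algebra. -/
theorem range_spinorOf :
    LinearMap.range spinorOf = Subalgebra.toSubmodule (CliffordAlgebra.even Q₃) := by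
  have hmem (i j : Fin 3) : e i * e j ∈ CliffordAlgebra.evenOdd Q₃ 0 :=
    CliffordAlgebra.ι_mul_ι_mem_evenOdd_zero Q₃ _ _
  have hmul (x y : Cl₃) (hx : x ∈ LinearMap.range spinorOf) (hy : y ∈ LinearMap.range spinorOf) :
      x * y ∈ LinearMap.range spinorOf := by
    obtain ⟨a, rfl⟩ := hx
    obtain ⟨b, rfl⟩ := hy
    rw [spinorOf_mul]
    exact ⟨!₂[_, _, _, _], rfl⟩
  have hone (r : ℝ) : algebraMap ℝ Cl₃ r ∈ LinearMap.range spinorOf := by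
    refine ⟨!₂[r, 0, 0, 0], ?_⟩
    simp [spinorOf_apply, Algebra.algebraMap_eq_smul_one]
  have hvec (m : EuclideanSpace ℝ (Fin 3)) :
      CliffordAlgebra.ι Q₃ m = m 0 • e 0 + m 1 • e 1 + m 2 • e 2 := by
    have hm : m = m 0 • EuclideanSpace.single 0 1 + m 1 • EuclideanSpace.single 1 1 +
        m 2 • EuclideanSpace.single 2 1 := by
      ext i
      fin_cases i <;> simp
    conv_lhs => rw [hm]
    simp only [map_add, map_smul, e]
  have hvv (m n : EuclideanSpace ℝ (Fin 3)) :
      CliffordAlgebra.ι Q₃ m * CliffordAlgebra.ι Q₃ n ∈ LinearMap.range spinorOf := by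
    refine ⟨!₂[m 0 * n 0 + m 1 * n 1 + m 2 * n 2, m 1 * n 2 - m 2 * n 1,
      m 2 * n 0 - m 0 * n 2, m 0 * n 1 - m 1 * n 0], ?_⟩
    rw [hvec, hvec, spinorOf_apply]
    simp only [Matrix.cons_val, add_mul, mul_add, smul_mul_smul_comm, e_sq]
    rw [e_anticomm (show (2 : Fin 3) ≠ 1 by decide), e_anticomm (show (0 : Fin 3) ≠ 2 by decide),
      e_anticomm (show (1 : Fin 3) ≠ 0 by decide)]
    module
  rw [CliffordAlgebra.even_toSubmodule]
  apply le_antisymm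
  · rintro _ ⟨a, rfl⟩
    rw [spinorOf_apply]
    refine add_mem (add_mem (add_mem ?_ ?_) ?_) ?_
    · exact Submodule.smul_mem _ _ (Submodule.one_le.mp (CliffordAlgebra.one_le_evenOdd_zero Q₃))
    all_goals exact Submodule.smul_mem _ _ (hmem _ _)
  · intro x hx
    induction x, hx using CliffordAlgebra.even_induction with
    | algebraMap r => exact hone r
    | add x y hx hy ihx ihy => exact add_mem ihx ihy
    | ι_mul_ι_mul m n x hx ih => exact hmul _ _ (hvv m n) ih

/-- The spinor group of a set `Φ` of vectors: the subgroup of the units of the Clifford algebra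
generated by the products of two of the unit vectors in the directions of the elements of `Φ`, that
is, the group of even products of these unit vectors. -/
def spinorGroup (Φ : Set (EuclideanSpace ℝ (Fin 3))) : Subgroup Cl₃ˣ :=
  Subgroup.closure {R | ∃ α ∈ normalized Φ, ∃ β ∈ normalized Φ,
    (R : Cl₃) = CliffordAlgebra.ι Q₃ α * CliffordAlgebra.ι Q₃ β}

/-- The set of four-dimensional vectors induced by `Φ`: the elements of its spinor group, read as
vectors in the four-dimensional Euclidean space of spinors. -/
def induced (Φ : Set (EuclideanSpace ℝ (Fin 3))) : Set (EuclideanSpace ℝ (Fin 4)) :=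
  {a | ∃ R ∈ spinorGroup Φ, (R : Cl₃) = spinorOf a}

end SpinorInduction

end

/-! A finite root system is the orbit of its simple roots under the simple reflections
(`orbit_induction`), so a property of roots may be checked on simple roots and propagated by simple
reflections. Hence two systems with the same diagram are equivalent (`HasType.equivalent`).

A diagram always exists. A linear form that vanishes on no root singles out positive roots; a
minimal set generating their cone has pairwise non-acute angles and is therefore independent.
Alternating the two reflections of a pair of simple roots yields roots with coefficients sin((k+1)φ)
and sin(kφ), and sign coherence forces φ = π/m (`exists_inner_eq_neg_cos`). Simple systems are
conjugate, so the diagram is unique, and it is connected exactly for irreducible systems. Its Gram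
matrix is positive definite; test vectors exclude every connected diagram except A₃, B₃, H₃ in rank
three and A₄, B₄, D₄, F₄, H₄ in rank four. Of the latter, A₄ and B₄ lack triality while D₄ has it,
and F₄, H₄ lie outside the families.

For unit spinors the reflection of x in a is -a x̃ a, and x̃ is the inverse of x. As -1 lies in the
spinor group of a non-empty root system, the unit spinors in this group are stable under each
other's reflections (`refl_mem_induced`). It remains to identify the group. For each type, a finite
list of coordinates over ℤ, ℤ[√2] or ℤ[φ] is checked to be a root system that contains 1, is stable
under left multiplication by a₀a₁ and a₁a₂, and has simple roots that are words in these two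
spinors. `hasType_induced` turns this into equality of the group with the root system. The groups
are the quaternion group and the binary tetrahedral, octahedral and icosahedral groups, of orders 8,
24, 48 and 120. -/

noncomputable section

namespace SpinorInduction

open Module

/-! ### Reflections as linear isometries. -/

section Reflections

variable {V W : Type*} [NormedAddCommGroup V] [InnerProductSpace ℝ V]
  [NormedAddCommGroup W] [InnerProductSpace ℝ W]

theorem refl_eq_reflection (α v : V) : refl α v = (ℝ ∙ α)ᗮ.reflection v := by
  rw [Submodule.reflection_orthogonal_apply, Submodule.reflection_singleton_apply, refl,
    real_inner_comm, real_inner_self_eq_norm_sq]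
  simp only [RCLike.ofReal_real_eq_id, id_eq]
  module

theorem refl_smul (α : V) (c : ℝ) (v : V) : refl α (c • v) = c • refl α v := by
  simp [refl_eq_reflection]

theorem refl_neg (α v : V) : refl α (-v) = -refl α v := by
  simp [refl_eq_reflection]

theorem refl_refl (α v : V) : refl α (refl α v) = v := by
  simp [refl_eq_reflection]

theorem refl_self (α : V) : refl α α = -α := by
  simp [refl_eq_reflection, Submodule.reflection_orthogonalComplement_singleton_eq_neg]

theorem norm_refl (α v : V) : ‖refl α v‖ = ‖v‖ := by
  simp [refl_eq_reflection]

theorem refl_smul_left {c : ℝ} (hc : c ≠ 0) (α v : V) : refl (c • α) v = refl α v := by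
  rcases eq_or_ne α 0 with rfl | hα
  · simp
  have : ⟪α, α⟫ ≠ 0 := inner_self_ne_zero.mpr hα
  rw [refl, refl, smul_smul]
  congr 2
  simp only [inner_smul_left, inner_smul_right, conj_trivial]
  field_simp

theorem map_refl (e : V ≃ₗᵢ[ℝ] W) (α v : V) : e (refl α v) = refl (e α) (e v) := by
  simp [refl]

theorem refl_injective (α : V) : Function.Injective (refl α) :=
  Function.LeftInverse.injective (refl_refl α)

/-- The reflection `refl α` as a linear isometry. -/
def reflEquiv (α : V) : V ≃ₗᵢ[ℝ] V := (ℝ ∙ α)ᗮ.reflection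

theorem reflEquiv_apply (α v : V) : reflEquiv α v = refl α v := (refl_eq_reflection α v).symm

/-- Conjugation by an isometry moves the mirror. This is what extends stability from simple
reflections to all reflections. -/
theorem refl_refl_left (β α v : V) : refl (refl β α) v = refl β (refl α (refl β v)) := by
  have := map_refl (reflEquiv β) α (refl β v)
  simp only [reflEquiv_apply, refl_refl] at this
  exact this.symm

theorem refl_of_inner_eq_zero {α v : V} (h : ⟪v, α⟫ = 0) : refl α v = v := by
  simp [refl, h]

end Reflections

/-! ### Roots as the orbit of the simple roots. -/

section General

variable {V W : Type*} [NormedAddCommGroup V] [InnerProductSpace ℝ V]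
  [NormedAddCommGroup W] [InnerProductSpace ℝ W] {ι ι' : Type*} {Φ : Set V} {Ψ : Set W}

namespace IsRootSystem

theorem ne_zero (hΦ : IsRootSystem Φ) {α : V} (hα : α ∈ Φ) : α ≠ 0 := by
  rintro rfl
  exact hΦ.zero_notMem hα

theorem refl_mem (hΦ : IsRootSystem Φ) {α β : V} (hα : α ∈ Φ) (hβ : β ∈ Φ) : refl α β ∈ Φ := by
  rw [← hΦ.image_refl α hα]
  exact ⟨β, hβ, rfl⟩

theorem neg_mem (hΦ : IsRootSystem Φ) {α : V} (hα : α ∈ Φ) : -α ∈ Φ :=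
  refl_self α ▸ hΦ.refl_mem hα hα

theorem eq_one_or_neg_one (hΦ : IsRootSystem Φ) {α : V} (hα : α ∈ Φ) {c : ℝ} (hc : c • α ∈ Φ) :
    c = 1 ∨ c = -1 := by
  have h : c • α ∈ Φ ∩ (Submodule.span ℝ {α} : Set V) :=
    ⟨hc, Submodule.smul_mem _ _ (Submodule.mem_span_singleton_self α)⟩
  rw [hΦ.inter_line α hα] at h
  have h0 := hΦ.ne_zero hα
  rcases h with h | h
  · right
    exact smul_left_injective ℝ h0 (by simpa using h)
  · left
    exact smul_left_injective ℝ h0 (by simpa using h)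

end IsRootSystem

theorem repr_refl_of_ne (Δ : Basis ι ℝ V) {i j : ι} (h : j ≠ i) (x : V) :
    Δ.repr (refl (Δ i) x) j = Δ.repr x j := by
  simp [refl, h.symm]

theorem eq_smul_of_repr_eq_zero [Fintype ι] (Δ : Basis ι ℝ V) (i : ι) {x : V}
    (h : ∀ j ≠ i, Δ.repr x j = 0) : x = Δ.repr x i • Δ i := by
  conv_lhs => rw [← Δ.sum_repr x]
  exact Finset.sum_eq_single i (fun j _ hj => by rw [h j hj, zero_smul]) (by simp)

/-- A non-negative root that is not a multiple of the simple root `Δ i` remains non-negative under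
the reflection in `Δ i`. -/
theorem repr_refl_nonneg [Fintype ι] {Δ : Basis ι ℝ V}
    (hsign : ∀ α ∈ Φ, (∀ i, 0 ≤ Δ.repr α i) ∨ (∀ i, Δ.repr α i ≤ 0)) {i : ι} {x : V}
    (hx : ∀ j, 0 ≤ Δ.repr x j) (hi : ∀ c : ℝ, x ≠ c • Δ i) (hmem : refl (Δ i) x ∈ Φ) (j : ι) :
    0 ≤ Δ.repr (refl (Δ i) x) j := by
  rcases hsign _ hmem with h | h
  · exact h j
  · refine absurd (eq_smul_of_repr_eq_zero Δ i fun k hk => le_antisymm ?_ (hx k)) (hi _)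
    rw [← repr_refl_of_ne Δ hk]
    exact h k

/-- To prove a property of all roots, it suffices to prove it for the simple roots and to show that
it is preserved by the simple reflections. -/
theorem orbit_induction [Fintype ι] {Δ : Basis ι ℝ V} (hfin : Φ.Finite) (h0 : (0 : V) ∉ Φ)
    (hline : ∀ i, ∀ c : ℝ, c • Δ i ∈ Φ → c = 1 ∨ c = -1)
    (hrefl : ∀ i, ∀ x ∈ Φ, refl (Δ i) x ∈ Φ)
    (hsign : ∀ α ∈ Φ, (∀ i, 0 ≤ Δ.repr α i) ∨ (∀ i, Δ.repr α i ≤ 0))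
    {P : V → Prop} (hP : ∀ i, P (Δ i)) (hs : ∀ i x, P x → P (refl (Δ i) x)) :
    ∀ x ∈ Φ, P x := by
  have hneg_simple (i : ι) : P (-Δ i) := refl_self (Δ i) ▸ hs i _ (hP i)
  have hs' (i : ι) (x : V) (h : P (refl (Δ i) x) ∧ P (-refl (Δ i) x)) : P x ∧ P (-x) := by
    refine ⟨refl_refl (Δ i) x ▸ hs i _ h.1, ?_⟩
    have := hs i _ h.2
    rwa [refl_neg, refl_refl] at this
  -- Closure of `Φ` under negation is not assumed, so the argument runs over the roots and their
  -- negatives and treats both signs of `P` at once. A counterexample of least height (sum of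
  -- coordinates) is then reflected to a lower one.
  have hpos : ∀ x, (x ∈ Φ ∨ -x ∈ Φ) → (∀ i, 0 ≤ Δ.repr x i) → P x ∧ P (-x) := by
    by_contra! hcon
    obtain ⟨x₀, hx₀⟩ := hcon
    have hB : {x | (x ∈ Φ ∨ -x ∈ Φ) ∧ (∀ i, 0 ≤ Δ.repr x i) ∧ ¬ (P x ∧ P (-x))}.Finite := by
      refine (hfin.union (hfin.image Neg.neg)).subset fun x hx => ?_
      rcases hx.1 with h | h
      · exact Or.inl h
      · exact Or.inr ⟨-x, h, neg_neg x⟩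
    obtain ⟨x, ⟨hx, hx0, hxP⟩, hmin⟩ := hB.exists_minimalFor (fun x => ∑ i, Δ.repr x i) _
      ⟨x₀, hx₀.1, hx₀.2.1, fun h => hx₀.2.2 h.1 h.2⟩
    have hne : x ≠ 0 := by
      rintro rfl
      simp [h0] at hx
    -- Since ⟪x, x⟫ > 0 is a combination of the ⟪x, Δ i⟫ with non-negative coefficients, some ⟪x, Δ
    -- i⟫ is positive.
    obtain ⟨i, hi⟩ : ∃ i, 0 < ⟪x, Δ i⟫ := by
      by_contra! hcon
      have h1 : ⟪x, x⟫ = ∑ i, Δ.repr x i * ⟪x, Δ i⟫ := by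
        conv_lhs => rw [← Δ.sum_repr x, inner_sum, Δ.sum_repr x]
        simp [inner_smul_right]
      have h2 : ⟪x, x⟫ ≤ 0 := by
        rw [h1]
        exact Finset.sum_nonpos fun i _ => mul_nonpos_of_nonneg_of_nonpos (hx0 i) (hcon i)
      exact absurd h2 (not_le.mpr (real_inner_self_pos.mpr hne))
    by_cases hsimp : ∃ c : ℝ, x = c • Δ i
    · obtain ⟨c, rfl⟩ := hsimp
      have hc : c = 1 ∨ c = -1 := by
        rcases hx with h | h
        · exact hline i c h
        · rw [← neg_smul] at h
          rcases hline i _ h with h | h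
          · right; linarith
          · left; linarith
      rcases hc with rfl | rfl
      · simp [hP, hneg_simple] at hxP
      · simp [hP, hneg_simple] at hxP
    push Not at hsimp
    have hmem : refl (Δ i) x ∈ Φ ∨ -refl (Δ i) x ∈ Φ := by
      rcases hx with h | h
      · exact Or.inl (hrefl i x h)
      · exact Or.inr (refl_neg (Δ i) x ▸ hrefl i _ h)
    -- Possibly only the negative of the reflected vector lies in `Φ`; sign coherence is therefore
    -- extended to both signs before `repr_refl_nonneg` is applied.
    have hsign' : ∀ α ∈ Φ ∪ {-refl (Δ i) x, refl (Δ i) x},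
        (∀ i, 0 ≤ Δ.repr α i) ∨ (∀ i, Δ.repr α i ≤ 0) := by
      have hneg (y : V) (h : (∀ i, 0 ≤ Δ.repr y i) ∨ (∀ i, Δ.repr y i ≤ 0)) :
          (∀ i, 0 ≤ Δ.repr (-y) i) ∨ (∀ i, Δ.repr (-y) i ≤ 0) := by
        simpa [or_comm] using h
      rintro α (h | rfl | rfl)
      · exact hsign α h
      · rcases hmem with h | h
        · exact hneg _ (hsign _ h)
        · exact hsign _ h
      · rcases hmem with h | h
        · exact hsign _ h
        · simpa using hneg _ (hsign _ h)
    have hnn := repr_refl_nonneg hsign' hx0 hsimp (by simp)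
    -- The reflection changes only coordinate `i`, which drops by 2⟪x, Δ i⟫/⟪Δ i, Δ i⟫ > 0.
    have hlt : ∑ j, Δ.repr (refl (Δ i) x) j < ∑ j, Δ.repr x j := by
      refine Finset.sum_lt_sum (fun j _ => ?_) ⟨i, Finset.mem_univ i, ?_⟩
      · rcases eq_or_ne j i with rfl | hj
        · simp only [refl, map_sub, map_smul, Basis.repr_self, Finsupp.coe_sub, Finsupp.coe_smul,
            Pi.sub_apply, Pi.smul_apply, Finsupp.single_eq_same, smul_eq_mul, mul_one]
          have : 0 ≤ ⟪x, Δ j⟫ / ⟪Δ j, Δ j⟫ := div_nonneg hi.le real_inner_self_nonneg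
          linarith
        · exact (repr_refl_of_ne Δ hj x).le
      · simp only [refl, map_sub, map_smul, Basis.repr_self, Finsupp.coe_sub, Finsupp.coe_smul,
          Pi.sub_apply, Pi.smul_apply, Finsupp.single_eq_same, smul_eq_mul, mul_one]
        have : 0 < ⟪x, Δ i⟫ / ⟪Δ i, Δ i⟫ :=
          div_pos hi (real_inner_self_pos.mpr (Δ.ne_zero i))
        linarith
    by_cases hr : P (refl (Δ i) x) ∧ P (-refl (Δ i) x)
    · exact hxP (hs' i x hr)
    · exact absurd (hmin ⟨hmem, hnn, hr⟩ hlt.le) (not_le.mpr hlt)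
  intro x hx
  rcases hsign x hx with h | h
  · exact (hpos x (Or.inl hx) h).1
  · have := (hpos (-x) (Or.inr (by simpa)) (by simpa using h)).2
    rwa [neg_neg] at this

theorem IsRootSystem.orbit_induction [Fintype ι] (hΦ : IsRootSystem Φ) {Δ : Basis ι ℝ V}
    (hΔ : IsSimpleSystem Φ Δ) {P : V → Prop} (hP : ∀ i, P (Δ i))
    (hs : ∀ i x, P x → P (refl (Δ i) x)) : ∀ x ∈ Φ, P x :=
  SpinorInduction.orbit_induction hΦ.finite hΦ.zero_notMem
    (fun i _ hc => hΦ.eq_one_or_neg_one (hΔ.1 i) hc)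
    (fun i _ hx => hΦ.refl_mem (hΔ.1 i) hx) hΔ.2 hP hs

/-- A finite sign-coherent set of unit vectors that is stable under the reflections in the elements
of the basis `Δ` is a root system. -/
theorem isRootSystem_of_simple [Fintype ι] {Δ : Basis ι ℝ V} (hfin : Φ.Finite)
    (hunit : ∀ x ∈ Φ, ‖x‖ = 1) (hΔ : IsSimpleSystem Φ Δ)
    (hrefl : ∀ i, ∀ x ∈ Φ, refl (Δ i) x ∈ Φ) : IsRootSystem Φ := by
  have h0 : (0 : V) ∉ Φ := fun h => by simpa using hunit 0 h
  have hline (x : V) (hx : x ∈ Φ) (c : ℝ) (hc : c • x ∈ Φ) : c = 1 ∨ c = -1 := by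
    have := hunit _ hc
    rw [norm_smul, hunit x hx, mul_one, Real.norm_eq_abs] at this
    exact eq_or_eq_neg_of_abs_eq this
  -- The property "the reflection in x preserves `Φ`" passes from x to its image under a simple
  -- reflection s, because the new reflection is the conjugate by s.
  have hall : ∀ x ∈ Φ, ∀ y ∈ Φ, refl x y ∈ Φ :=
    orbit_induction (P := fun x => ∀ y ∈ Φ, refl x y ∈ Φ) hfin h0 (fun i => hline _ (hΔ.1 i)) hrefl
      hΔ.2 hrefl fun i x hx y hy => by
        rw [refl_refl_left]
        exact hrefl _ _ (hx _ (hrefl _ _ hy))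
  refine ⟨hfin, h0, ?_, fun α hα => ?_, fun α hα => ?_⟩
  · rw [eq_top_iff, ← Δ.span_eq]
    exact Submodule.span_mono (by rintro _ ⟨i, rfl⟩; exact hΔ.1 i)
  · ext x
    simp only [Set.mem_inter_iff, SetLike.mem_coe, Submodule.mem_span_singleton,
      Set.mem_insert_iff, Set.mem_singleton_iff]
    constructor
    · rintro ⟨hx, c, rfl⟩
      rcases hline α hα c hx with rfl | rfl <;> simp
    · rintro (rfl | rfl)
      · exact ⟨refl_self α ▸ hall α hα α hα, -1, by simp⟩
      · exact ⟨hα, 1, by simp⟩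
  · apply Set.Subset.antisymm
    · rintro _ ⟨x, hx, rfl⟩
      exact hall α hα x hx
    · intro x hx
      exact ⟨refl α x, hall α hα x hx, refl_refl α x⟩

end General

/-! ### Equivalence, conjugacy of simple systems and uniqueness of the diagram. -/

section Types

variable {V W : Type*} [NormedAddCommGroup V] [InnerProductSpace ℝ V]
  [NormedAddCommGroup W] [InnerProductSpace ℝ W] {ι ι' : Type*} {Φ : Set V} {Ψ : Set W}

theorem normalize_smul {c : ℝ} (hc : 0 < c) (x : V) : ‖c • x‖⁻¹ • c • x = ‖x‖⁻¹ • x := by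
  rw [norm_smul, Real.norm_eq_abs, abs_of_pos hc, smul_smul, mul_inv]
  congr 1
  field_simp

/-- Since lengths are irrelevant, an isometry need only match the rays spanned by the roots. In this
form the condition propagates under reflections without normalizing. -/
theorem equivalent_of_rays (f : V ≃ₗᵢ[ℝ] W) (h₁ : ∀ α ∈ Φ, ∃ c : ℝ, 0 < c ∧ c • f α ∈ Ψ)
    (h₂ : ∀ β ∈ Ψ, ∃ c : ℝ, 0 < c ∧ c • f.symm β ∈ Φ) : Equivalent Φ Ψ := by
  refine ⟨f, Set.Subset.antisymm ?_ ?_⟩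
  · rintro _ ⟨_, ⟨α, hα, rfl⟩, rfl⟩
    obtain ⟨c, hc, h⟩ := h₁ α hα
    refine ⟨_, h, ?_⟩
    simp only [normalize_smul hc, map_smul, f.norm_map]
  · rintro _ ⟨β, hβ, rfl⟩
    obtain ⟨c, hc, h⟩ := h₂ β hβ
    refine ⟨_, ⟨_, h, rfl⟩, ?_⟩
    simp only [normalize_smul hc, map_smul, f.symm.norm_map, f.apply_symm_apply]

theorem Equivalent.exists_rays (h : Equivalent Φ Ψ) (hΦ : (0 : V) ∉ Φ) (hΨ : (0 : W) ∉ Ψ) :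
    ∃ f : V ≃ₗᵢ[ℝ] W, (∀ α ∈ Φ, ∃ c : ℝ, 0 < c ∧ c • f α ∈ Ψ) ∧
      ∀ β ∈ Ψ, ∃ c : ℝ, 0 < c ∧ c • f.symm β ∈ Φ := by
  obtain ⟨f, hf⟩ := h
  have hpos₁ {α : V} (h : α ∈ Φ) : 0 < ‖α‖ := norm_pos_iff.mpr fun h0 => hΦ (h0 ▸ h)
  have hpos₂ {α : W} (h : α ∈ Ψ) : 0 < ‖α‖ := norm_pos_iff.mpr fun h0 => hΨ (h0 ▸ h)
  refine ⟨f, fun α hα => ?_, fun β hβ => ?_⟩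
  · have : f (‖α‖⁻¹ • α) ∈ normalized Ψ := hf ▸ ⟨_, ⟨α, hα, rfl⟩, rfl⟩
    obtain ⟨β, hβ, h⟩ := this
    have := hpos₁ hα
    have h2 := hpos₂ hβ
    refine ⟨‖β‖ * ‖α‖⁻¹, by positivity, ?_⟩
    simp only [map_smul] at h
    rw [mul_smul, ← h, smul_inv_smul₀ h2.ne']
    exact hβ
  · have : ‖β‖⁻¹ • β ∈ f '' normalized Φ := hf ▸ ⟨β, hβ, rfl⟩
    obtain ⟨_, ⟨α, hα, rfl⟩, h⟩ := this
    have := hpos₁ hα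
    have h2 := hpos₂ hβ
    refine ⟨‖α‖ * ‖β‖⁻¹, by positivity, ?_⟩
    have h' := congrArg f.symm h
    simp only [map_smul, f.symm_apply_apply] at h'
    rw [mul_smul, ← h', smul_inv_smul₀ this.ne']
    exact hα

/-- A root system has every type that an equivalent root system has. -/
theorem HasType.of_equivalent {M : CoxeterMatrix ι} (hΦ : HasType Φ M) (h : Equivalent Φ Ψ)
    (hΨ : IsRootSystem Ψ) : HasType Ψ M := by
  obtain ⟨hR, Δ, hΔ, hM⟩ := hΦ
  obtain ⟨f, h₁, h₂⟩ := h.exists_rays hR.zero_notMem hΨ.zero_notMem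
  choose! c hc hmem using h₁
  have hu (i : ι) : IsUnit (c (Δ i)) := (hc _ (hΔ.1 i)).ne'.isUnit
  have happ (i : ι) : (Δ.map f.toLinearEquiv).isUnitSMul hu i = c (Δ i) • f (Δ i) := by
    simp [Basis.isUnitSMul_apply]
  refine ⟨hΨ, (Δ.map f.toLinearEquiv).isUnitSMul hu, ⟨fun i => ?_, fun β hβ => ?_⟩, fun i j => ?_⟩
  · rw [happ]
    exact hmem _ (hΔ.1 i)
  · obtain ⟨r, hr, hrm⟩ := h₂ β hβ
    have hrep (i : ι) : ((Δ.map f.toLinearEquiv).isUnitSMul hu).repr β i =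
        (c (Δ i))⁻¹ * Δ.repr (f.symm β) i := by
      simp [Basis.repr_isUnitSMul, Units.smul_def]
    simp only [hrep]
    have hci (i : ι) : 0 < (c (Δ i))⁻¹ := inv_pos.mpr (hc _ (hΔ.1 i))
    refine (hΔ.2 _ hrm).imp (fun h i => ?_) (fun h i => ?_)
    · have := h i
      simp only [map_smul, Finsupp.smul_apply, smul_eq_mul] at this
      exact mul_nonneg (hci i).le (nonneg_of_mul_nonneg_right this hr)
    · have := h i
      simp only [map_smul, Finsupp.smul_apply, smul_eq_mul] at this
      exact mul_nonpos_of_nonneg_of_nonpos (hci i).le (nonpos_of_mul_nonpos_right this hr)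
  · have hi := hc _ (hΔ.1 i)
    have hj := hc _ (hΔ.1 j)
    rw [happ, happ, inner_smul_left, inner_smul_right, f.inner_map_map, hM, norm_smul, norm_smul,
      Real.norm_eq_abs, Real.norm_eq_abs, abs_of_pos hi, abs_of_pos hj, f.norm_map, f.norm_map]
    simp only [conj_trivial]
    ring

theorem exists_pos_smul_mem_of_simple [Fintype ι] (hΦ : IsRootSystem Φ) (hΨ : IsRootSystem Ψ)
    {Δ : Basis ι ℝ V} {Δ' : Basis ι ℝ W} (hΔ : IsSimpleSystem Φ Δ) (hΔ' : IsSimpleSystem Ψ Δ')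
    (f : V ≃ₗᵢ[ℝ] W) (hf : ∀ i, ∃ c : ℝ, 0 < c ∧ c • f (Δ i) = Δ' i) :
    ∀ α ∈ Φ, ∃ c : ℝ, 0 < c ∧ c • f α ∈ Ψ := by
  refine hΦ.orbit_induction hΔ (fun i => ?_) ?_
  · obtain ⟨c, hc, h⟩ := hf i
    exact ⟨c, hc, h ▸ hΔ'.1 i⟩
  · rintro i x ⟨c, hc, h⟩
    obtain ⟨d, hd, h'⟩ := hf i
    refine ⟨c, hc, ?_⟩
    rw [map_refl, ← refl_smul, ← refl_smul_left hd.ne', h']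
    exact hΨ.refl_mem (hΔ'.1 i) h

/-- Root systems of the same type are equivalent. -/
theorem HasType.equivalent [Fintype ι] {M : CoxeterMatrix ι} (hΦ : HasType Φ M)
    (hΨ : HasType Ψ M) : Equivalent Φ Ψ := by
  obtain ⟨hR, Δ, hΔ, hM⟩ := hΦ
  obtain ⟨hR', Δ', hΔ', hM'⟩ := hΨ
  have hn (i : ι) : 0 < ‖Δ i‖ := norm_pos_iff.mpr (Δ.ne_zero i)
  have hn' (i : ι) : 0 < ‖Δ' i‖ := norm_pos_iff.mpr (Δ'.ne_zero i)
  have hu (i : ι) : IsUnit (‖Δ' i‖ * ‖Δ i‖⁻¹) := by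
    have := hn i
    have := hn' i
    exact (by positivity : ‖Δ' i‖ * ‖Δ i‖⁻¹ ≠ 0).isUnit
  -- `Δ` is rescaled to the lengths of `Δ'`. The two bases then have the same Gram matrix, so
  -- matching them is an isometry.
  let b := Δ.isUnitSMul hu
  let g : V ≃ₗ[ℝ] W := b.equiv Δ' (Equiv.refl ι)
  have hg (i : ι) : (‖Δ' i‖ * ‖Δ i‖⁻¹) • g (Δ i) = Δ' i := by
    have : g (b i) = Δ' i := by simp [g]
    rw [← map_smul]
    simpa only [b, Basis.isUnitSMul_apply] using this
  have hinner : (innerₗ W).compl₁₂ g.toLinearMap g.toLinearMap = innerₗ V := by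
    refine b.ext fun i => b.ext fun j => ?_
    have h1 : g (b i) = Δ' i := by simp [g]
    have h2 : g (b j) = Δ' j := by simp [g]
    have := (hn i).ne'
    have := (hn j).ne'
    simp only [LinearMap.compl₁₂_apply, LinearEquiv.coe_coe, h1, h2, innerₗ_apply_apply, hM']
    simp only [b, Basis.isUnitSMul_apply, inner_smul_left, inner_smul_right, hM, conj_trivial]
    field_simp
  let f : V ≃ₗᵢ[ℝ] W := g.isometryOfInner fun x y => by
    simpa using LinearMap.congr_fun₂ hinner x y
  have hf (i : ι) : (‖Δ' i‖ * ‖Δ i‖⁻¹) • f (Δ i) = Δ' i := hg i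
  refine equivalent_of_rays f (exists_pos_smul_mem_of_simple hR hR' hΔ hΔ' f fun i => ?_)
    (exists_pos_smul_mem_of_simple hR' hR hΔ' hΔ f.symm fun i => ?_)
  · have := hn i
    have := hn' i
    exact ⟨_, by positivity, hf i⟩
  · have h1 := hn i
    have h2 := hn' i
    refine ⟨(‖Δ' i‖ * ‖Δ i‖⁻¹)⁻¹, by positivity, ?_⟩
    rw [inv_smul_eq_iff₀ (by positivity), LinearIsometryEquiv.symm_apply_eq, map_smul, hf i]

theorem HasType.reindex {M : CoxeterMatrix ι} (hΦ : HasType Φ M) (σ : ι ≃ ι') :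
    HasType Φ (M.reindex σ) := by
  obtain ⟨hR, Δ, hΔ, hM⟩ := hΦ
  refine ⟨hR, Δ.reindex σ, ⟨fun i => ?_, fun α hα => ?_⟩, fun i j => ?_⟩
  · simpa using hΔ.1 _
  · simp only [Basis.repr_reindex_apply]
    exact (hΔ.2 α hα).imp (fun h i => h _) (fun h i => h _)
  · simpa [CoxeterMatrix.reindex_apply] using hM _ _

/-- The non-negative roots with respect to a basis. -/
def nonnegRoots (Φ : Set V) (Δ : Basis ι ℝ V) : Set V := {α ∈ Φ | ∀ i, 0 ≤ Δ.repr α i}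

theorem neg_mem_nonnegRoots (hΦ : IsRootSystem Φ) {Δ : Basis ι ℝ V} (hΔ : IsSimpleSystem Φ Δ)
    {α : V} (hα : α ∈ Φ) (h : α ∉ nonnegRoots Φ Δ) : -α ∈ nonnegRoots Φ Δ := by
  refine ⟨hΦ.neg_mem hα, ?_⟩
  rcases hΔ.2 α hα with h' | h'
  · exact absurd ⟨hα, h'⟩ h
  · simpa using h'

theorem notMem_nonnegRoots_neg (hΦ : IsRootSystem Φ) {Δ : Basis ι ℝ V} {α : V}
    (h : α ∈ nonnegRoots Φ Δ) : -α ∉ nonnegRoots Φ Δ := by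
  intro h'
  refine hΦ.ne_zero h.1 (Δ.repr.map_eq_zero_iff.mp (Finsupp.ext fun i => le_antisymm ?_ (h.2 i)))
  simpa using h'.2 i

theorem simple_mem_nonnegRoots {Δ : Basis ι ℝ V} (hΔ : IsSimpleSystem Φ Δ) (i : ι) :
    Δ i ∈ nonnegRoots Φ Δ := by
  classical
  refine ⟨hΔ.1 i, fun j => ?_⟩
  rw [Basis.repr_self, Finsupp.single_apply]
  split_ifs <;> norm_num

/-- A simple reflection permutes the positive roots other than its own simple root: any other
positive root keeps a positive coordinate elsewhere. -/
theorem refl_mem_nonnegRoots [Fintype ι] (hΦ : IsRootSystem Φ) {Δ : Basis ι ℝ V}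
    (hΔ : IsSimpleSystem Φ Δ) {α : V} (hα : α ∈ nonnegRoots Φ Δ) {i : ι} (hi : α ≠ Δ i) :
    refl (Δ i) α ∈ nonnegRoots Φ Δ := by
  have hmem := hΦ.refl_mem (hΔ.1 i) hα.1
  refine ⟨hmem, repr_refl_nonneg hΔ.2 hα.2 ?_ hmem⟩
  rintro c rfl
  rcases hΦ.eq_one_or_neg_one (hΔ.1 i) hα.1 with rfl | rfl
  · simp at hi
  · rw [neg_one_smul] at hα
    exact notMem_nonnegRoots_neg hΦ (simple_mem_nonnegRoots hΔ i) hα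

theorem nonnegRoots_subset_of_simple [Fintype ι] {Δ : Basis ι ℝ V} {Δ' : Basis ι' ℝ V}
    (h : ∀ i, Δ i ∈ nonnegRoots Φ Δ') : nonnegRoots Φ Δ ⊆ nonnegRoots Φ Δ' := by
  intro α hα
  refine ⟨hα.1, fun j => ?_⟩
  rw [← Δ.sum_repr α]
  simp only [map_sum, map_smul, Finsupp.coe_finsetSum, Finset.sum_apply, Finsupp.coe_smul,
    Pi.smul_apply, smul_eq_mul]
  exact Finset.sum_nonneg fun i _ => mul_nonneg (hα.2 i) ((h i).2 j)

/-- Simple roots span the extremal rays of the cone of positive roots, so the positive roots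
determine them up to order and length. -/
theorem exists_equiv_of_nonnegRoots_subset [Fintype ι] [Fintype ι'] (hΦ : IsRootSystem Φ)
    {Δ : Basis ι ℝ V} {Δ' : Basis ι' ℝ V} (hΔ : IsSimpleSystem Φ Δ) (hΔ' : IsSimpleSystem Φ Δ')
    (h : nonnegRoots Φ Δ ⊆ nonnegRoots Φ Δ') :
    ∃ σ : ι ≃ ι', ∀ i, ∃ c : ℝ, 0 < c ∧ c • Δ i = Δ' (σ i) := by
  -- Exactly one of each pair of opposite roots is positive for either basis, so the inclusion is an
  -- equality.
  have h' : nonnegRoots Φ Δ' ⊆ nonnegRoots Φ Δ := by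
    intro α hα
    by_contra hcon
    exact notMem_nonnegRoots_neg hΦ hα (h (neg_mem_nonnegRoots hΦ hΔ hα.1 hcon))
  have key (j : ι') : ∃ i : ι, ∃ c : ℝ, 0 < c ∧ c • Δ' j = Δ i := by
    have hj := h' (simple_mem_nonnegRoots hΔ' j)
    obtain ⟨i, hi⟩ : ∃ i, Δ.repr (Δ' j) i ≠ 0 := by
      by_contra! hcon
      exact Δ'.ne_zero j (Δ.repr.map_eq_zero_iff.mp (Finsupp.ext hcon))
    have hipos := lt_of_le_of_ne (hj.2 i) hi.symm
    have hd (k : ι) := h (simple_mem_nonnegRoots hΔ k)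
    -- The coordinate of `Δ' j` at `k ≠ j` is zero and is a sum of non-negative terms, one for each
    -- `Δ l`. The term of `i` has a positive coefficient, so `Δ i` itself has zero coordinate at
    -- `k`.
    have hzero (k : ι') (hk : k ≠ j) : Δ'.repr (Δ i) k = 0 := by
      have hsum : ∑ l, Δ.repr (Δ' j) l * Δ'.repr (Δ l) k = 0 := by
        have h1 : Δ'.repr (∑ l, Δ.repr (Δ' j) l • Δ l) k = 0 := by
          rw [Δ.sum_repr, Basis.repr_self, Finsupp.single_eq_of_ne hk]
        simpa only [map_sum, map_smul, Finsupp.coe_finsetSum, Finset.sum_apply, Finsupp.coe_smul,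
          Pi.smul_apply, smul_eq_mul] using h1
      have := (Finset.sum_eq_zero_iff_of_nonneg fun l _ =>
        mul_nonneg (hj.2 l) ((hd l).2 k)).mp hsum i (Finset.mem_univ i)
      exact (mul_eq_zero.mp this).resolve_left hi
    have heq := eq_smul_of_repr_eq_zero Δ' j hzero
    refine ⟨i, _, lt_of_le_of_ne ((hd i).2 j) fun h0 => ?_, heq.symm⟩
    rw [← h0, zero_smul] at heq
    exact Δ.ne_zero i heq
  choose τ c hc hτ using key
  have hinj : Function.Injective τ := by
    intro j k hjk
    by_contra hne
    have h1 : c j • Δ' j = c k • Δ' k := by rw [hτ, hτ, hjk]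
    have h2 := congrArg (fun v => Δ'.repr v j) h1
    simp [Finsupp.single_eq_of_ne hne] at h2
    exact (hc j).ne' h2
  have hcard : Fintype.card ι' = Fintype.card ι := by
    rw [← finrank_eq_card_basis Δ', ← finrank_eq_card_basis Δ]
  have hbij := (Fintype.bijective_iff_injective_and_card τ).mpr ⟨hinj, hcard⟩
  refine ⟨(Equiv.ofBijective τ hbij).symm, fun i => ?_⟩
  obtain ⟨j, rfl⟩ := hbij.surjective i
  refine ⟨(c j)⁻¹, inv_pos.mpr (hc j), ?_⟩
  rw [Equiv.ofBijective_symm_apply_apply, ← hτ j, inv_smul_smul₀ (hc j).ne']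

theorem IsSimpleSystem.map_refl (hΦ : IsRootSystem Φ) {Δ : Basis ι ℝ V} (hΔ : IsSimpleSystem Φ Δ)
    {α : V} (hα : α ∈ Φ) : IsSimpleSystem Φ (Δ.map (reflEquiv α).toLinearEquiv) := by
  have hsymm (x : V) : (reflEquiv α).symm x = refl α x := by
    rw [LinearIsometryEquiv.symm_apply_eq, reflEquiv_apply, refl_refl]
  refine ⟨fun i => ?_, fun x hx => ?_⟩
  · simpa [reflEquiv_apply] using hΦ.refl_mem hα (hΔ.1 i)
  · simpa [hsymm] using hΔ.2 _ (hΦ.refl_mem hα hx)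

/-- Any two simple systems of a root system are conjugate, up to order and lengths. -/
theorem exists_isometry_of_isSimpleSystem [Fintype ι] [Fintype ι'] (hΦ : IsRootSystem Φ)
    {Δ : Basis ι ℝ V} (hΔ : IsSimpleSystem Φ Δ) (Δ' : Basis ι' ℝ V)
    (hΔ' : IsSimpleSystem Φ Δ') :
    ∃ (σ : ι ≃ ι') (f : V ≃ₗᵢ[ℝ] V), ∀ i, ∃ c : ℝ, 0 < c ∧ c • Δ i = f (Δ' (σ i)) := by
  induction hn : (nonnegRoots Φ Δ \ nonnegRoots Φ Δ').ncard using Nat.strong_induction_on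
    generalizing Δ' with
  | _ n ih =>
    by_cases hsub : ∀ i, Δ i ∈ nonnegRoots Φ Δ'
    · obtain ⟨σ, hσ⟩ := exists_equiv_of_nonnegRoots_subset hΦ hΔ hΔ'
        (nonnegRoots_subset_of_simple hsub)
      exact ⟨σ, LinearIsometryEquiv.refl ℝ V, by simpa using hσ⟩
    · push Not at hsub
      obtain ⟨i, hi⟩ := hsub
      -- `Δ i` is negative for `Δ'`. Reflecting `Δ'` in it makes it positive and decreases the
      -- number of roots on which the two systems disagree.
      let Δ'' := Δ'.map (reflEquiv (Δ i)).toLinearEquiv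
      have hsymm (x : V) : (reflEquiv (Δ i)).symm x = refl (Δ i) x := by
        rw [LinearIsometryEquiv.symm_apply_eq, reflEquiv_apply, refl_refl]
      have hmem (x : V) (hx : x ∈ Φ) (hx' : x ∉ nonnegRoots Φ Δ'') :
          refl (Δ i) x ∉ nonnegRoots Φ Δ' := by
        intro hcon
        refine hx' ⟨hx, fun j => ?_⟩
        simpa [Δ'', hsymm] using hcon.2 j
      -- The reflection injects the new disagreement set into the old one and misses `Δ i`, which
      -- could only come from the negative root `-Δ i`.
      have hlt : (nonnegRoots Φ Δ \ nonnegRoots Φ Δ'').ncard < n := by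
        rw [← hn, ← Set.ncard_image_of_injective _ (refl_injective (Δ i))]
        have hfin : (nonnegRoots Φ Δ \ nonnegRoots Φ Δ').Finite :=
          hΦ.finite.subset fun x hx => hx.1.1
        refine Set.ncard_lt_ncard ⟨?_, ?_⟩ hfin
        · rintro _ ⟨x, ⟨hx, hx'⟩, rfl⟩
          refine ⟨refl_mem_nonnegRoots hΦ hΔ hx ?_, hmem x hx.1 hx'⟩
          rintro rfl
          refine hmem _ hx.1 hx' ?_
          rw [refl_self]
          exact neg_mem_nonnegRoots hΦ hΔ' (hΔ.1 i) hi
        · intro hcon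
          obtain ⟨x, ⟨hx, -⟩, hxi⟩ := hcon ⟨simple_mem_nonnegRoots hΔ i, hi⟩
          have hx2 : x = -Δ i := by rw [← refl_refl (Δ i) x, hxi, refl_self]
          exact notMem_nonnegRoots_neg hΦ (simple_mem_nonnegRoots hΔ i) (hx2 ▸ hx)
      obtain ⟨σ, f, hf⟩ := ih _ hlt Δ'' (hΔ'.map_refl hΦ (hΔ.1 i)) rfl
      refine ⟨σ, (reflEquiv (Δ i)).trans f, fun k => ?_⟩
      obtain ⟨c, hc, h⟩ := hf k
      exact ⟨c, hc, by simpa [Δ''] using h⟩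

/-- With division by zero equal to zero, a label 0 would give cos(π/0) = 1, hence opposite unit
directions, contradicting independence of the simple roots. -/
theorem HasType.ne_zero {M : CoxeterMatrix ι} (hΦ : HasType Φ M) (i j : ι) : M i j ≠ 0 := by
  obtain ⟨-, Δ, -, hM⟩ := hΦ
  intro h
  have hij : i ≠ j := by
    rintro rfl
    simp at h
  have h1 : ‖Δ j‖ • Δ i + ‖Δ i‖ • Δ j = 0 := by
    rw [← inner_self_eq_zero (𝕜 := ℝ)]
    have h2 := hM i j
    have h3 := hM j i
    rw [M.symmetric j i] at h3
    simp only [h, Nat.cast_zero, div_zero, Real.cos_zero] at h2 h3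
    simp only [inner_add_left, inner_add_right, inner_smul_left, inner_smul_right, h2, h3,
      real_inner_self_eq_norm_sq, conj_trivial]
    ring
  have h2 := congrArg (fun v => Δ.repr v i) h1
  simp [Finsupp.single_eq_of_ne hij] at h2
  exact Δ.ne_zero j h2

theorem cos_pi_div_injective {m n : ℕ} (hm : m ≠ 0) (hn : n ≠ 0)
    (h : Real.cos (Real.pi / m) = Real.cos (Real.pi / n)) : m = n := by
  have hmem {k : ℕ} (hk : k ≠ 0) : Real.pi / k ∈ Set.Icc 0 Real.pi := by
    have := Real.pi_pos
    have : (1 : ℝ) ≤ k := by exact_mod_cast Nat.one_le_iff_ne_zero.mpr hk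
    exact ⟨by positivity, div_le_self Real.pi_pos.le this⟩
  have h1 := Real.injOn_cos (hmem hm) (hmem hn) h
  have h2 : (m : ℝ) ≠ 0 := by exact_mod_cast hm
  have h3 : (n : ℝ) ≠ 0 := by exact_mod_cast hn
  have := Real.pi_ne_zero
  field_simp at h1
  exact_mod_cast h1.symm

/-- The diagram of a root system is unique up to the names of the nodes. -/
theorem HasType.exists_equiv [Fintype ι] [Fintype ι'] {M : CoxeterMatrix ι} {N : CoxeterMatrix ι'}
    (hM : HasType Φ M) (hN : HasType Φ N) : ∃ σ : ι ≃ ι', ∀ i j, M i j = N (σ i) (σ j) := by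
  have hM0 := hM.ne_zero
  have hN0 := hN.ne_zero
  obtain ⟨hΦ, Δ, hΔ, hM⟩ := hM
  obtain ⟨-, Δ', hΔ', hN⟩ := hN
  obtain ⟨σ, f, hf⟩ := exists_isometry_of_isSimpleSystem hΦ hΔ Δ' hΔ'
  choose c hc hf using hf
  refine ⟨σ, fun i j => cos_pi_div_injective (hM0 _ _) (hN0 _ _) ?_⟩
  have h1 (k : ι) : ‖Δ' (σ k)‖ = c k * ‖Δ k‖ := by
    rw [← f.norm_map, ← hf, norm_smul, Real.norm_eq_abs, abs_of_pos (hc k)]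
  have h2 : ⟪Δ' (σ i), Δ' (σ j)⟫ = c i * (c j * ⟪Δ i, Δ j⟫) := by
    rw [← f.inner_map_map, ← hf, ← hf, inner_smul_left, inner_smul_right, conj_trivial]
  rw [hM, hN, h1, h1] at h2
  have hi := hc i
  have hj := hc j
  have hi' : 0 < ‖Δ i‖ := norm_pos_iff.mpr (Δ.ne_zero i)
  have hj' : 0 < ‖Δ j‖ := norm_pos_iff.mpr (Δ.ne_zero j)
  have : c i * ‖Δ i‖ * (c j * ‖Δ j‖) ≠ 0 := by positivity
  apply mul_right_cancel₀ this
  linear_combination h2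

theorem cos_pi_div_eq_zero {m : ℕ} (hm : m ≠ 0) : Real.cos (Real.pi / m) = 0 ↔ m = 2 := by
  constructor
  · intro h
    refine cos_pi_div_injective hm two_ne_zero ?_
    rw [h]
    simp
  · rintro rfl
    simp

/-- A root system is irreducible if and only if its diagram is connected. -/
theorem HasType.isIrreducible_iff [Fintype ι] [Nonempty ι] {M : CoxeterMatrix ι}
    (hM : HasType Φ M) : IsIrreducibleRootSystem Φ ↔
      ∀ S : Set ι, (∀ i ∈ S, ∀ j ∉ S, M i j = 2) → S = ∅ ∨ S = Set.univ := by
  have hM0 := hM.ne_zero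
  obtain ⟨hΦ, Δ, hΔ, hM⟩ := hM
  have hinner (i j : ι) : ⟪Δ i, Δ j⟫ = 0 ↔ M i j = 2 := by
    have hi' : ‖Δ i‖ ≠ 0 := norm_ne_zero_iff.mpr (Δ.ne_zero i)
    have hj' : ‖Δ j‖ ≠ 0 := norm_ne_zero_iff.mpr (Δ.ne_zero j)
    rw [hM, ← cos_pi_div_eq_zero (hM0 i j)]
    simp [hi', hj']
  have hzero {v : V} (h : ∀ i, ⟪v, Δ i⟫ = 0) : v = 0 := by
    rw [← inner_self_eq_zero (𝕜 := ℝ)]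
    conv_lhs => rw [← Δ.sum_repr v, inner_sum, Δ.sum_repr v]
    exact Finset.sum_eq_zero fun i _ => by rw [inner_smul_right, h, mul_zero]
  constructor
  · rintro ⟨-, -, hirr⟩ S hS
    let A := Submodule.span ℝ (Δ '' S)
    let B := Submodule.span ℝ (Δ '' Sᶜ)
    have hAB : ∀ x ∈ A, ∀ y ∈ B, ⟪x, y⟫ = 0 := by
      have : A ⟂ B := by
        rw [Submodule.isOrtho_span]
        rintro _ ⟨i, hi, rfl⟩ _ ⟨j, hj, rfl⟩
        exact (hinner i j).mpr (hS i hi j hj)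
      exact fun x hx y hy => this.inner_eq hx hy
    -- A simple reflection with index in `S` preserves `A` and fixes `B` pointwise, and vice versa,
    -- so every root stays in one of the two spans.
    have hunion : ∀ x ∈ Φ, x ∈ A ∨ x ∈ B := by
      refine hΦ.orbit_induction hΔ (fun i => ?_) fun i x hx => ?_
      · by_cases hi : i ∈ S
        · exact Or.inl (Submodule.subset_span ⟨i, hi, rfl⟩)
        · exact Or.inr (Submodule.subset_span ⟨i, hi, rfl⟩)
      · by_cases hi : i ∈ S
        · have hiA : Δ i ∈ A := Submodule.subset_span ⟨i, hi, rfl⟩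
          refine hx.imp (fun hx => sub_mem hx (Submodule.smul_mem _ _ hiA)) fun hx => ?_
          rw [refl_of_inner_eq_zero (by rw [real_inner_comm]; exact hAB _ hiA _ hx)]
          exact hx
        · have hiB : Δ i ∈ B := Submodule.subset_span ⟨i, hi, rfl⟩
          refine hx.imp (fun hx => ?_) fun hx => sub_mem hx (Submodule.smul_mem _ _ hiB)
          rw [refl_of_inner_eq_zero (hAB _ hx _ hiB)]
          exact hx
    rcases hirr {x ∈ Φ | x ∈ A} (fun x hx => hx.1) (fun x hx y hy => hAB x hx.2 y
      ((hunion y hy.1).resolve_left fun h => hy.2 ⟨hy.1, h⟩)) with h | h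
    · left
      refine Set.eq_empty_of_forall_notMem fun i hi => ?_
      have : Δ i ∈ {x ∈ Φ | x ∈ A} := ⟨hΔ.1 i, Submodule.subset_span ⟨i, hi, rfl⟩⟩
      simp [h] at this
    · right
      refine Set.eq_univ_of_forall fun i => ?_
      by_contra hi
      have hiA : Δ i ∈ {x ∈ Φ | x ∈ A} := (Set.ext_iff.mp h _).mpr (hΔ.1 i)
      have hiB : Δ i ∈ B := Submodule.subset_span ⟨i, hi, rfl⟩
      exact Δ.ne_zero i (inner_self_eq_zero (𝕜 := ℝ).mp (hAB _ hiA.2 _ hiB))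
  · intro hconn
    refine ⟨hΦ, ⟨_, hΔ.1 (Classical.arbitrary ι)⟩, fun Φ₁ hsub horth => ?_⟩
    -- The simple roots in `Φ₁` form a union of components: none or all. In either case a root on
    -- the wrong side is orthogonal to all simple roots, hence zero.
    rcases hconn {i | Δ i ∈ Φ₁} fun i hi j hj =>
      (hinner i j).mp (horth _ hi _ ⟨hΔ.1 j, hj⟩) with h | h
    · left
      refine Set.eq_empty_of_forall_notMem fun α hα => hΦ.ne_zero (hsub hα) (hzero fun i => ?_)
      refine horth _ hα _ ⟨hΔ.1 i, fun hi => ?_⟩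
      have : i ∈ {i | Δ i ∈ Φ₁} := hi
      simp [h] at this
    · right
      refine hsub.antisymm fun α hα => ?_
      by_contra hcon
      refine hΦ.ne_zero hα (hzero fun i => ?_)
      rw [real_inner_comm]
      refine horth _ ?_ _ ⟨hα, hcon⟩
      have : i ∈ {i | Δ i ∈ Φ₁} := h ▸ Set.mem_univ i
      exact this

end Types

/-! ### Existence of simple roots and of the diagram. -/

section Existence

variable {V : Type*} [NormedAddCommGroup V] [InnerProductSpace ℝ V] {ι : Type*} {Φ : Set V}

/-- The roots that are positive for `f` are non-negative combinations of `S`. -/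
def IsConeGenerator (Φ : Set V) (f : Dual ℝ V) (S : Finset V) : Prop :=
  (∀ α ∈ S, α ∈ Φ ∧ 0 < f α) ∧
    ∀ α ∈ Φ, 0 < f α → ∃ c : V → ℝ, (∀ v, 0 ≤ c v) ∧ α = ∑ v ∈ S, c v • v

/-- No element of a minimal generating set is a combination of itself and the other ones in which
one of the others has a positive coefficient. -/
theorem false_of_smul_eq_add [DecidableEq V] {f : Dual ℝ V} {S : Finset V}
    (hS : Minimal (IsConeGenerator Φ f) S) {α β : V} (hα : α ∈ S) (hβ : β ∈ S) (hne : α ≠ β)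
    {t k : ℝ} (hk : 0 < k) {c : V → ℝ} (hc : ∀ v, 0 ≤ c v)
    (h : t • β = k • α + ∑ v ∈ S, c v • v) : False := by
  have hαe : α ∈ S.erase β := Finset.mem_erase.mpr ⟨hne, hα⟩
  have h1 : (t - c β) • β = k • α + ∑ v ∈ S.erase β, c v • v := by
    rw [← Finset.add_sum_erase S _ hβ] at h
    rw [sub_smul, h]
    abel
  have hpos : 0 < f (k • α + ∑ v ∈ S.erase β, c v • v) := by
    simp only [map_add, map_smul, map_sum, smul_eq_mul]
    have h2 : 0 < k * f α := mul_pos hk (hS.1.1 α hα).2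
    have h3 : 0 ≤ ∑ v ∈ S.erase β, c v * f v := Finset.sum_nonneg fun v hv =>
      mul_nonneg (hc v) (hS.1.1 v (Finset.mem_of_mem_erase hv)).2.le
    linarith
  -- Evaluating the positive form `f` on both sides shows that the remaining coefficient of `β` is
  -- positive, so `β` can be solved for.
  have ht : 0 < t - c β := by
    rw [← h1, map_smul, smul_eq_mul] at hpos
    exact pos_of_mul_pos_left hpos (hS.1.1 β hβ).2.le
  set d : V → ℝ := fun v => (t - c β)⁻¹ * (c v + if v = α then k else 0) with hd
  have hd0 (v : V) : 0 ≤ d v := by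
    have := hc v
    simp only [hd]
    split_ifs <;> positivity
  have hβd : β = ∑ v ∈ S.erase β, d v • v := by
    have h2 : ∑ v ∈ S.erase β, (if v = α then k else 0) • v = k • α := by
      simp [ite_smul, hαe]
    conv_lhs => rw [← inv_smul_smul₀ ht.ne' β, h1, ← h2, ← Finset.sum_add_distrib, Finset.smul_sum]
    refine Finset.sum_congr rfl fun v _ => ?_
    rw [← add_smul, smul_smul, add_comm]
  -- `β` is now a non-negative combination of the other generators; substituting it makes `β`
  -- redundant, against minimality.
  have hgen : IsConeGenerator Φ f (S.erase β) := by
    refine ⟨fun γ hγ => hS.1.1 γ (Finset.mem_of_mem_erase hγ), fun γ hγ hfγ => ?_⟩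
    obtain ⟨a, ha, h⟩ := hS.1.2 γ hγ hfγ
    refine ⟨fun v => a v + a β * d v, fun v => add_nonneg (ha v) (mul_nonneg (ha β) (hd0 v)), ?_⟩
    rw [h, ← Finset.add_sum_erase S _ hβ]
    simp only [add_smul, Finset.sum_add_distrib, mul_smul, ← Finset.smul_sum]
    rw [← hβd, add_comm]
  exact absurd (hS.2 hgen (Finset.erase_subset β S) hβ) (Finset.notMem_erase β S)

/-- If ⟪α, β⟫ > 0, the root β - kα with k > 0, or its negative, is positive for `f` and hence in the
cone. Either expansion gives a relation excluded by `false_of_smul_eq_add`. -/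
theorem inner_nonpos_of_minimal (hΦ : IsRootSystem Φ) {f : Dual ℝ V}
    (hf : ∀ α ∈ Φ, f α ≠ 0) {S : Finset V} (hS : Minimal (IsConeGenerator Φ f) S) {α β : V}
    (hα : α ∈ S) (hβ : β ∈ S) (hne : α ≠ β) : ⟪α, β⟫ ≤ 0 := by
  classical
  by_contra! hpos
  have hαΦ := (hS.1.1 α hα).1
  have hk : 0 < 2 * (⟪β, α⟫ / ⟪α, α⟫) := by
    have := real_inner_self_pos.mpr (hΦ.ne_zero hαΦ)
    rw [real_inner_comm] at hpos
    positivity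
  have hr := hΦ.refl_mem hαΦ (hS.1.1 β hβ).1
  rcases lt_or_gt_of_ne (hf _ hr) with h | h
  · obtain ⟨c, hc, hsum⟩ := hS.1.2 (-refl α β) (hΦ.neg_mem hr) (by simpa using h)
    refine false_of_smul_eq_add hS hβ hα hne.symm (t := 2 * (⟪β, α⟫ / ⟪α, α⟫)) one_pos hc ?_
    rw [← hsum, refl]
    module
  · obtain ⟨c, hc, hsum⟩ := hS.1.2 _ hr h
    refine false_of_smul_eq_add hS hα hβ hne (t := 1) hk hc ?_
    rw [← hsum, refl]
    module

/-- Every root system has a system of simple roots, with pairwise non-acute angles. -/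
theorem IsRootSystem.exists_isSimpleSystem (hΦ : IsRootSystem Φ) :
    ∃ (S : Finset V) (Δ : Basis S ℝ V), IsSimpleSystem Φ Δ ∧
      ∀ i j, i ≠ j → ⟪Δ i, Δ j⟫ ≤ 0 := by
  classical
  have : Finite Φ := hΦ.finite
  obtain ⟨f, hf⟩ := exists_dual_forall_apply_ne_zero (K := ℝ) (fun α : Φ => (α : V))
    fun α => hΦ.ne_zero α.2
  replace hf (α : V) (hα : α ∈ Φ) : f α ≠ 0 := hf ⟨α, hα⟩
  obtain ⟨S, hS⟩ : ∃ S, Minimal (IsConeGenerator Φ f) S := by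
    refine exists_minimal_of_wellFoundedLT _ ⟨hΦ.finite.toFinset.filter (0 < f ·), ?_, ?_⟩
    · intro α hα
      simpa using hα
    · intro α hα hfα
      refine ⟨fun v => if v = α then 1 else 0, fun v => by dsimp only; split_ifs <;> norm_num, ?_⟩
      simp [ite_smul, hα, hfα]
  have hobt (i j : S) (hij : i ≠ j) : ⟪(i : V), (j : V)⟫ ≤ 0 :=
    inner_nonpos_of_minimal hΦ hf hS i.2 j.2 fun h => hij (Subtype.ext h)
  -- Vectors on one side of a hyperplane with pairwise non-positive inner products are linearly
  -- independent.
  have hli : LinearIndependent ℝ (fun i : S => (i : V)) := by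
    refine LinearMap.BilinForm.linearIndependent_of_pairwise_le_zero (innerₗ V) ?_ f _
      (fun i => (hS.1.1 i i.2).2) fun i j hij => hobt i j hij
    intro x hx
    simpa using real_inner_self_pos.mpr hx
  have hcone : ∀ α ∈ Φ, 0 < f α → ∃ c : V → ℝ, (∀ v, 0 ≤ c v) ∧ α = ∑ v : S, c v • (v : V) := by
    intro α hα hfα
    obtain ⟨c, hc, h⟩ := hS.1.2 α hα hfα
    exact ⟨c, hc, by rw [h, Finset.sum_coe_sort S (fun v => c v • v)]⟩
  have hspan : ⊤ ≤ Submodule.span ℝ (Set.range fun i : S => (i : V)) := by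
    have hpos : ∀ α ∈ Φ, 0 < f α → α ∈ Submodule.span ℝ (Set.range fun i : S => (i : V)) := by
      intro α hα hfα
      obtain ⟨c, -, h⟩ := hcone α hα hfα
      rw [h]
      exact Submodule.sum_mem _ fun i _ => Submodule.smul_mem _ _ (Submodule.subset_span ⟨i, rfl⟩)
    rw [← hΦ.span_eq_top, Submodule.span_le]
    intro α hα
    rcases lt_or_gt_of_ne (hf α hα) with h | h
    · rw [SetLike.mem_coe, ← neg_neg α]
      exact Submodule.neg_mem _ (hpos _ (hΦ.neg_mem hα) (by simpa using h))
    · exact hpos α hα h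
  have hΔ (i : S) : Basis.mk hli hspan i = i := Basis.mk_apply _ _ _
  have hrepr : ∀ α ∈ Φ, 0 < f α → ∀ i, 0 ≤ (Basis.mk hli hspan).repr α i := by
    intro α hα hfα i
    obtain ⟨c, hc, h⟩ := hcone α hα hfα
    have h2 : α = ∑ v : S, c v • Basis.mk hli hspan v := by simpa only [hΔ] using h
    rw [h2, Basis.repr_sum_self]
    exact hc i
  refine ⟨S, Basis.mk hli hspan, ⟨fun i => ?_, fun α hα => ?_⟩, fun i j hij => ?_⟩
  · rw [hΔ]
    exact (hS.1.1 i i.2).1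
  · rcases lt_or_gt_of_ne (hf α hα) with h | h
    · right
      intro i
      have := hrepr _ (hΦ.neg_mem hα) (by simpa using h) i
      rwa [map_neg, Finsupp.neg_apply, neg_nonneg] at this
    · exact Or.inl (hrepr α hα h)
  · rw [hΔ, hΔ]
    exact hobt i j hij

/-- Two simple roots at a non-acute angle are the normals of mirrors that meet at the angle `π / m`
for some `m`. -/
theorem exists_inner_eq_neg_cos (hΦ : IsRootSystem Φ) {Δ : Basis ι ℝ V}
    (hΔ : IsSimpleSystem Φ Δ) {i j : ι} (hij : i ≠ j) (hle : ⟪Δ i, Δ j⟫ ≤ 0) :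
    ∃ m : ℕ, 2 ≤ m ∧ ⟪Δ i, Δ j⟫ = -Real.cos (Real.pi / m) * (‖Δ i‖ * ‖Δ j‖) := by
  have hi : 0 < ‖Δ i‖ := norm_pos_iff.mpr (Δ.ne_zero i)
  have hj : 0 < ‖Δ j‖ := norm_pos_iff.mpr (Δ.ne_zero j)
  obtain ⟨a, ha⟩ : ∃ a, a = ‖Δ i‖⁻¹ • Δ i := ⟨_, rfl⟩
  obtain ⟨b, hb⟩ : ∃ b, b = ‖Δ j‖⁻¹ • Δ j := ⟨_, rfl⟩
  have ha1 : ⟪a, a⟫ = 1 := by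
    rw [ha, inner_smul_left, inner_smul_right, real_inner_self_eq_norm_sq, conj_trivial]
    field_simp
  have hb1 : ⟪b, b⟫ = 1 := by
    rw [hb, inner_smul_left, inner_smul_right, real_inner_self_eq_norm_sq, conj_trivial]
    field_simp
  have hab : ⟪Δ i, Δ j⟫ = ⟪a, b⟫ * (‖Δ i‖ * ‖Δ j‖) := by
    rw [ha, hb, inner_smul_left, inner_smul_right, conj_trivial]
    field_simp
  have hrepr (x y : ℝ) : Δ.repr (x • a + y • b) i = x * ‖Δ i‖⁻¹ ∧
      Δ.repr (x • a + y • b) j = y * ‖Δ j‖⁻¹ := by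
    simp [ha, hb, Finsupp.single_eq_of_ne hij, Finsupp.single_eq_of_ne hij.symm]
  -- φ is the angle between the two mirrors; the goal becomes φ = π/m.
  set φ := Real.arccos (-⟪a, b⟫) with hφ
  have hab0 : ⟪a, b⟫ ≤ 0 := by
    rw [hab] at hle
    exact nonpos_of_mul_nonpos_left hle (by positivity)
  have hab1 : -1 < ⟪a, b⟫ := by
    by_contra! hcon
    have h0 : (1 : ℝ) • a + (1 : ℝ) • b = 0 := by
      rw [← inner_self_eq_zero (𝕜 := ℝ)]
      refine le_antisymm ?_ real_inner_self_nonneg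
      simp only [one_smul, inner_add_left, inner_add_right, ha1, hb1, real_inner_comm a b]
      linarith
    have := (hrepr 1 1).1
    rw [h0] at this
    simp at this
    exact hi.ne this
  have hcos : Real.cos φ = -⟪a, b⟫ := Real.cos_arccos (by linarith) (by linarith)
  have hφ0 : 0 < φ := Real.arccos_pos.mpr (by linarith)
  have hφ2 : φ ≤ Real.pi / 2 := Real.arccos_le_pi_div_two.mpr (by linarith)
  have hsin : 0 < Real.sin φ := Real.sin_pos_of_pos_of_lt_pi hφ0 (by linarith [Real.pi_pos])
  let R : V → Prop := fun x => ∃ c : ℝ, 0 < c ∧ c • x ∈ Φ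
  have hRa (x : V) (h : R x) : R (refl a x) := by
    obtain ⟨c, hc, h⟩ := h
    refine ⟨c, hc, ?_⟩
    rw [← refl_smul, ha, refl_smul_left (by positivity)]
    exact hΦ.refl_mem (hΔ.1 i) h
  have hRb (x : V) (h : R x) : R (refl b x) := by
    obtain ⟨c, hc, h⟩ := h
    refine ⟨c, hc, ?_⟩
    rw [← refl_smul, hb, refl_smul_left (by positivity)]
    exact hΦ.refl_mem (hΔ.1 j) h
  have hreflA (x y : ℝ) : refl a (x • a + y • b) = (2 * Real.cos φ * y - x) • a + y • b := by
    simp only [refl, inner_add_left, inner_smul_left, ha1, real_inner_comm a b, hcos, conj_trivial]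
    module
  have hreflB (x y : ℝ) : refl b (x • a + y • b) = x • a + (2 * Real.cos φ * x - y) • b := by
    simp only [refl, inner_add_left, inner_smul_left, hb1, hcos, conj_trivial]
    module
  have hrec (k : ℕ) : 2 * Real.cos φ * Real.sin ((k + 1 : ℕ) * φ) - Real.sin (k * φ) =
      Real.sin ((k + 2 : ℕ) * φ) := by
    have h1 : ((k + 2 : ℕ) : ℝ) * φ = (k + 1 : ℕ) * φ + φ := by push_cast; ring
    have h2 : (k : ℝ) * φ = (k + 1 : ℕ) * φ - φ := by push_cast; ring
    rw [h1, h2, Real.sin_add, Real.sin_sub]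
    ring
  -- Alternating the two reflections, starting from `a`, the coefficients follow the recurrence of
  -- sin(kφ).
  have hroot (k : ℕ) : R (Real.sin ((k + 1 : ℕ) * φ) • a + Real.sin (k * φ) • b) ∨
      R (Real.sin (k * φ) • a + Real.sin ((k + 1 : ℕ) * φ) • b) := by
    induction k with
    | zero =>
      left
      refine ⟨‖Δ i‖ * (Real.sin φ)⁻¹, by positivity, ?_⟩
      have : (‖Δ i‖ * (Real.sin φ)⁻¹ * (Real.sin φ * ‖Δ i‖⁻¹)) = 1 := by field_simp
      simpa [ha, smul_smul, this] using hΔ.1 i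
    | succ k ih =>
      rcases ih with ih | ih
      · right
        have := hRb _ ih
        rwa [hreflB, hrec] at this
      · left
        have := hRa _ ih
        rwa [hreflA, hrec] at this
  have hsign (x y : ℝ) (h : R (x • a + y • b)) : (0 ≤ x ∧ 0 ≤ y) ∨ (x ≤ 0 ∧ y ≤ 0) := by
    obtain ⟨c, hc, h⟩ := h
    have hci : 0 < c * ‖Δ i‖⁻¹ := by positivity
    have hcj : 0 < c * ‖Δ j‖⁻¹ := by positivity
    have h1 : Δ.repr (c • (x • a + y • b)) i = x * (c * ‖Δ i‖⁻¹) := by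
      rw [map_smul, Finsupp.smul_apply, (hrepr x y).1, smul_eq_mul]
      ring
    have h2 : Δ.repr (c • (x • a + y • b)) j = y * (c * ‖Δ j‖⁻¹) := by
      rw [map_smul, Finsupp.smul_apply, (hrepr x y).2, smul_eq_mul]
      ring
    refine (hΔ.2 _ h).imp (fun h => ⟨?_, ?_⟩) (fun h => ⟨?_, ?_⟩)
    · exact nonneg_of_mul_nonneg_left (h1 ▸ h i) hci
    · exact nonneg_of_mul_nonneg_left (h2 ▸ h j) hcj
    · exact nonpos_of_mul_nonpos_left (h1 ▸ h i) hci
    · exact nonpos_of_mul_nonpos_left (h2 ▸ h j) hcj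
  -- `k + 1` is the first multiplier for which (k+1)φ reaches π. Then sin(kφ) > 0, and sign
  -- coherence forces sin((k+1)φ) ≥ 0.
  obtain ⟨k, hk⟩ : ∃ k, ⌈Real.pi / φ⌉₊ = k + 1 :=
    Nat.exists_eq_succ_of_ne_zero (Nat.ceil_pos.mpr (by have := Real.pi_pos; positivity)).ne'
  have hge : Real.pi ≤ (k + 1 : ℕ) * φ := by
    rw [← div_le_iff₀ hφ0, ← hk]
    exact Nat.le_ceil _
  have hlt : k * φ < Real.pi := by
    rw [← lt_div_iff₀ hφ0]
    exact Nat.lt_ceil.mp (by omega)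
  have hk1 : 1 ≤ k := by
    by_contra! hcon
    have : k = 0 := by omega
    subst this
    have : Real.pi ≤ φ := by simpa using hge
    linarith [Real.pi_pos]
  have hk1' : (1 : ℝ) ≤ k := by exact_mod_cast hk1
  have hsk : 0 < Real.sin (k * φ) := Real.sin_pos_of_pos_of_lt_pi (by positivity) hlt
  have hsk1 : 0 ≤ Real.sin ((k + 1 : ℕ) * φ) := by
    rcases hroot k with h | h <;> rcases hsign _ _ h with h | h
    · exact h.1
    · linarith
    · exact h.2
    · linarith
  have hpush : ((k + 1 : ℕ) : ℝ) * φ = k * φ + φ := by push_cast; ring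
  -- An overshoot would put (k+1)φ strictly between π and π + φ < 2π, where the sine is negative.
  have heq : (k + 1 : ℕ) * φ = Real.pi := by
    by_contra hne
    have h1 : 0 < (k + 1 : ℕ) * φ - Real.pi := sub_pos.mpr (lt_of_le_of_ne hge (Ne.symm hne))
    have h2 := Real.sin_pos_of_pos_of_lt_pi h1 (by linarith)
    rw [Real.sin_sub_pi] at h2
    linarith
  refine ⟨k + 1, by omega, ?_⟩
  have hφ' : Real.pi / (k + 1 : ℕ) = φ := by
    rw [← heq]
    field_simp
  rw [hφ', hcos, neg_neg, hab]

/-- Every root system has a diagram. -/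
theorem IsRootSystem.exists_hasType [FiniteDimensional ℝ V] (hΦ : IsRootSystem Φ) {n : ℕ}
    (hn : finrank ℝ V = n) : ∃ M : CoxeterMatrix (Fin n), HasType Φ M := by
  classical
  obtain ⟨S, Δ, hΔ, hle⟩ := hΦ.exists_isSimpleSystem
  have hM (i j : S) : ∃ m : ℕ, (i = j → m = 1) ∧ (i ≠ j → m ≠ 1) ∧
      ⟪Δ i, Δ j⟫ = -Real.cos (Real.pi / m) * (‖Δ i‖ * ‖Δ j‖) := by
    rcases eq_or_ne i j with rfl | hij
    · exact ⟨1, fun _ => rfl, fun h => absurd rfl h, by simp [sq]⟩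
    · obtain ⟨m, hm, h⟩ := exists_inner_eq_neg_cos hΦ hΔ hij (hle i j hij)
      exact ⟨m, fun h => absurd h hij, fun _ => by omega, h⟩
  -- Labels are chosen on unordered pairs so that the resulting matrix is symmetric.
  choose m hd ho hm using fun p : Sym2 S => Sym2.ind (f := fun p => ∃ m : ℕ,
    (p.IsDiag → m = 1) ∧ (¬ p.IsDiag → m ≠ 1) ∧ ∀ i j, p = s(i, j) →
      ⟪Δ i, Δ j⟫ = -Real.cos (Real.pi / m) * (‖Δ i‖ * ‖Δ j‖)) (fun i j => by
        obtain ⟨m, h1, h2, h3⟩ := hM i j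
        refine ⟨m, by simpa using h1, by simpa using h2, fun i' j' h => ?_⟩
        rcases Sym2.eq_iff.mp h with ⟨rfl, rfl⟩ | ⟨rfl, rfl⟩
        · exact h3
        · rw [real_inner_comm, h3, mul_comm ‖Δ _‖]) p
  let M : CoxeterMatrix S :=
    { M := Matrix.of fun i j => m s(i, j)
      isSymm := by
        ext i j
        simp [Matrix.transpose_apply, Sym2.eq_swap]
      diagonal := fun i => hd _ (by simp)
      off_diagonal := fun i j hij => ho _ (by simpa using hij) }
  have hcard : Fintype.card S = n := by rw [← hn, finrank_eq_card_basis Δ]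
  have : HasType Φ M := ⟨hΦ, Δ, hΔ, fun i j => hm _ i j rfl⟩
  exact ⟨_, this.reindex (Fintype.equivFinOfCardEq hcard)⟩

end Existence

/-! ### Classification in ranks three and four by positive definiteness. -/

section Classification

variable {V : Type*} [NormedAddCommGroup V] [InnerProductSpace ℝ V] {ι : Type*} {Φ : Set V}

/-- The form is the squared norm of a combination of distinct normalized simple roots, which are
independent. A test vector with non-positive value therefore rules out a subdiagram. -/
theorem HasType.quadratic_form_pos {M : CoxeterMatrix ι} (hM : HasType Φ M) {n : ℕ}
    {v : Fin n → ι} (hv : Function.Injective v) {x : Fin n → ℝ} {a : Fin n} (hx : x a ≠ 0) :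
    0 < ∑ i, ∑ j, x i * (x j * -Real.cos (Real.pi / M (v i) (v j))) := by
  obtain ⟨-, Δ, -, hM⟩ := hM
  have hn (i : ι) : ‖Δ i‖ ≠ 0 := norm_ne_zero_iff.mpr (Δ.ne_zero i)
  have hcos (i j : ι) :
      -Real.cos (Real.pi / M i j) = ⟪‖Δ i‖⁻¹ • Δ i, ‖Δ j‖⁻¹ • Δ j⟫ := by
    have := hn i
    have := hn j
    rw [inner_smul_left, inner_smul_right, hM, conj_trivial]
    field_simp
  have hsum : ∑ i, ∑ j, x i * (x j * -Real.cos (Real.pi / M (v i) (v j))) =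
      ⟪∑ i, x i • (‖Δ (v i)‖⁻¹ • Δ (v i)), ∑ j, x j • (‖Δ (v j)‖⁻¹ • Δ (v j))⟫ := by
    simp only [hcos, sum_inner, inner_sum]
    refine Finset.sum_congr rfl fun i _ => Finset.sum_congr rfl fun j _ => ?_
    rw [real_inner_comm]
    simp only [inner_smul_left, inner_smul_right, conj_trivial]
    ring
  rw [hsum]
  refine real_inner_self_pos.mpr fun h0 => hx ?_
  have h1 : ∑ i, (x i * ‖Δ (v i)‖⁻¹) • Δ (v i) = 0 := by simpa only [smul_smul] using h0
  have h2 := Fintype.linearIndependent_iff.mp (Δ.linearIndependent.comp v hv) _ h1 a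
  exact (mul_eq_zero.mp h2).resolve_right (inv_ne_zero (hn _))

/-- The quadratic form of a diagram on three of its nodes. -/
theorem HasType.quadratic_form_three_pos {M : CoxeterMatrix ι} (hM : HasType Φ M) {i j k : ι}
    (hij : i ≠ j) (hik : i ≠ k) (hjk : j ≠ k) (x y z : ℝ) (hx : x ≠ 0) :
    0 < x ^ 2 + y ^ 2 + z ^ 2 - 2 * x * y * Real.cos (Real.pi / M i j)
      - 2 * x * z * Real.cos (Real.pi / M i k) - 2 * y * z * Real.cos (Real.pi / M j k) := by
  have hv : Function.Injective ![i, j, k] := by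
    intro a b
    fin_cases a <;> fin_cases b <;> simp [hij, hik, hjk, hij.symm, hik.symm, hjk.symm]
  have := hM.quadratic_form_pos hv (x := ![x, y, z]) (a := 0) hx
  simp only [Fin.sum_univ_three, Matrix.cons_val, M.diagonal, M.symmetric j i, M.symmetric k i,
    M.symmetric k j, Nat.cast_one, div_one, Real.cos_pi] at this
  linarith

/-- The quadratic form of a diagram on four of its nodes. -/
theorem HasType.quadratic_form_four_pos {M : CoxeterMatrix ι} (hM : HasType Φ M) {i j k l : ι}
    (hij : i ≠ j) (hik : i ≠ k) (hil : i ≠ l) (hjk : j ≠ k) (hjl : j ≠ l) (hkl : k ≠ l)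
    (x y z w : ℝ) (hx : x ≠ 0) :
    0 < x ^ 2 + y ^ 2 + z ^ 2 + w ^ 2 - 2 * x * y * Real.cos (Real.pi / M i j)
      - 2 * x * z * Real.cos (Real.pi / M i k) - 2 * x * w * Real.cos (Real.pi / M i l)
      - 2 * y * z * Real.cos (Real.pi / M j k) - 2 * y * w * Real.cos (Real.pi / M j l)
      - 2 * z * w * Real.cos (Real.pi / M k l) := by
  have hv : Function.Injective ![i, j, k, l] := by
    intro a b
    fin_cases a <;> fin_cases b <;> simp [hij, hik, hil, hjk, hjl, hkl, hij.symm, hik.symm,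
      hil.symm, hjk.symm, hjl.symm, hkl.symm]
  have := hM.quadratic_form_pos hv (x := ![x, y, z, w]) (a := 0) hx
  simp only [Fin.sum_univ_four, Matrix.cons_val, M.diagonal, M.symmetric j i, M.symmetric k i,
    M.symmetric l i, M.symmetric k j, M.symmetric l j, M.symmetric l k, Nat.cast_one, div_one,
    Real.cos_pi] at this
  linarith

theorem cos_pi_div_mono {m n : ℕ} (hm : 1 ≤ m) (hmn : m ≤ n) :
    Real.cos (Real.pi / m) ≤ Real.cos (Real.pi / n) := by
  have h1 : (1 : ℝ) ≤ m := by exact_mod_cast hm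
  have h2 : (m : ℝ) ≤ n := by exact_mod_cast hmn
  have := Real.pi_pos
  exact Real.cos_le_cos_of_nonneg_of_le_pi (by positivity) (div_le_self Real.pi_pos.le h1)
    (by gcongr)

theorem half_le_cos_pi_div {m : ℕ} (hm : 3 ≤ m) : 1 / 2 ≤ Real.cos (Real.pi / m) := by
  simpa using cos_pi_div_mono (by norm_num) hm

theorem half_le_cos_pi_div_sq {m : ℕ} (hm : 4 ≤ m) : 1 / 2 ≤ Real.cos (Real.pi / m) ^ 2 := by
  have h := cos_pi_div_mono (by norm_num) hm
  have h2 : (√2) ^ 2 = 2 := Real.sq_sqrt (by norm_num)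
  simp only [Nat.cast_ofNat, Real.cos_pi_div_four] at h
  have h3 := Real.sqrt_nonneg 2
  nlinarith

theorem three_quarters_le_cos_pi_div_sq {m : ℕ} (hm : 6 ≤ m) :
    3 / 4 ≤ Real.cos (Real.pi / m) ^ 2 := by
  have h := cos_pi_div_mono (by norm_num) hm
  have h2 : (√3) ^ 2 = 3 := Real.sq_sqrt (by norm_num)
  simp only [Nat.cast_ofNat, Real.cos_pi_div_six] at h
  have h3 := Real.sqrt_nonneg 3
  nlinarith

theorem three_quarters_le_cos_pi_div {m : ℕ} (hm : 5 ≤ m) :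
    3 / 4 ≤ Real.cos (Real.pi / m) := by
  have h := cos_pi_div_mono (by norm_num) hm
  simp only [Nat.cast_ofNat, Real.cos_pi_div_five] at h
  have h3 : 2 ≤ √5 := Real.le_sqrt_of_sq_le (by norm_num)
  linarith

theorem HasType.two_le {M : CoxeterMatrix ι} (hM : HasType Φ M) {i j : ι} (hij : i ≠ j) :
    2 ≤ M i j := by
  have h1 := hM.ne_zero i j
  have h2 := M.off_diagonal i j hij
  omega

/-- A path of length two in a diagram: there is no triangle, one of the links is simple, and the
other one is at most fivefold. -/
theorem HasType.path_three {M : CoxeterMatrix ι} (hM : HasType Φ M) {i j k : ι}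
    (hij : i ≠ j) (hik : i ≠ k) (hjk : j ≠ k) (h1 : M i j ≠ 2) (h2 : M j k ≠ 2) :
    M i k = 2 ∧ (M i j = 3 ∧ M j k ≤ 5 ∨ M j k = 3 ∧ M i j ≤ 5) := by
  have h1' : 3 ≤ M i j := by have := hM.two_le hij; omega
  have h2' : 3 ≤ M j k := by have := hM.two_le hjk; omega
  have c1 := half_le_cos_pi_div h1'
  have c2 := half_le_cos_pi_div h2'
  have hik2 : M i k = 2 := by
    by_contra hne
    have h3' : 3 ≤ M i k := by have := hM.two_le hik; omega
    have c3 := half_le_cos_pi_div h3'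
    -- A triangle is excluded by (1, 1, 1): each cosine is at least 1/2, so the value is at most 0.
    have := hM.quadratic_form_three_pos hij hik hjk 1 1 1 one_ne_zero
    linarith
  refine ⟨hik2, ?_⟩
  -- For middle coordinate 1, these outer coordinates minimize the form; the value is 1 minus the
  -- squares of the two cosines.
  have hq := hM.quadratic_form_three_pos hij hik hjk (Real.cos (Real.pi / M i j)) 1
    (Real.cos (Real.pi / M j k)) (by linarith)
  rw [hik2] at hq
  simp only [Nat.cast_ofNat, Real.cos_pi_div_two] at hq
  by_contra hcon
  have hcases : (4 ≤ M i j ∧ 4 ≤ M j k) ∨ 6 ≤ M i j ∨ 6 ≤ M j k := by omega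
  rcases hcases with ⟨ha, hb⟩ | ha | hb
  · have := half_le_cos_pi_div_sq ha
    have := half_le_cos_pi_div_sq hb
    nlinarith
  · have := three_quarters_le_cos_pi_div_sq ha
    nlinarith
  · have := three_quarters_le_cos_pi_div_sq hb
    nlinarith

/-- A node with three neighbours has three simple links. -/
theorem HasType.star_four {M : CoxeterMatrix ι} (hM : HasType Φ M) {i j k l : ι}
    (hij : i ≠ j) (hik : i ≠ k) (hil : i ≠ l) (hjk : j ≠ k) (hjl : j ≠ l) (hkl : k ≠ l)
    (h1 : M i j ≠ 2) (h2 : M i k ≠ 2) (h3 : M i l ≠ 2) :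
    M i j = 3 ∧ M i k = 3 ∧ M i l = 3 ∧ M j k = 2 ∧ M j l = 2 ∧ M k l = 2 := by
  have hjk2 := (hM.path_three hij.symm hjk hik (M.symmetric i j ▸ h1) h2).1
  have hjl2 := (hM.path_three hij.symm hjl hil (M.symmetric i j ▸ h1) h3).1
  have hkl2 := (hM.path_three hik.symm hkl hil (M.symmetric i k ▸ h2) h3).1
  have h1' : 3 ≤ M i j := by have := hM.two_le hij; omega
  have h2' : 3 ≤ M i k := by have := hM.two_le hik; omega
  have h3' : 3 ≤ M i l := by have := hM.two_le hil; omega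
  have c1 := half_le_cos_pi_div h1'
  have c2 := half_le_cos_pi_div h2'
  have c3 := half_le_cos_pi_div h3'
  -- The minimizing leaf coordinates give 1 minus the sum of the three squared cosines. Three simple
  -- links leave 1/4; any stronger link leaves nothing.
  have hq := hM.quadratic_form_four_pos hij hik hil hjk hjl hkl 1 (Real.cos (Real.pi / M i j))
    (Real.cos (Real.pi / M i k)) (Real.cos (Real.pi / M i l)) one_ne_zero
  rw [hjk2, hjl2, hkl2] at hq
  simp only [Nat.cast_ofNat, Real.cos_pi_div_two] at hq
  by_contra hcon
  have hcases : 4 ≤ M i j ∨ 4 ≤ M i k ∨ 4 ≤ M i l := by omega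
  rcases hcases with h | h | h
  all_goals
    have := half_le_cos_pi_div_sq h
    nlinarith

/-- The possible paths of length three in a diagram. -/
theorem HasType.path_four {M : CoxeterMatrix ι} (hM : HasType Φ M) {i j k l : ι}
    (hij : i ≠ j) (hik : i ≠ k) (hil : i ≠ l) (hjk : j ≠ k) (hjl : j ≠ l) (hkl : k ≠ l)
    (h1 : M i j ≠ 2) (h2 : M j k ≠ 2) (h3 : M k l ≠ 2) :
    M i k = 2 ∧ M j l = 2 ∧ M i l = 2 ∧
      (M j k = 4 ∧ M i j = 3 ∧ M k l = 3 ∨ M j k = 3 ∧ M i j = 3 ∧ M k l ≤ 5 ∨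
        M j k = 3 ∧ M k l = 3 ∧ M i j ≤ 5) := by
  obtain ⟨hik2, ha⟩ := hM.path_three hij hik hjk h1 h2
  obtain ⟨hjl2, hb⟩ := hM.path_three hjk hjl hkl h2 h3
  have h1' : 3 ≤ M i j := by have := hM.two_le hij; omega
  have h2' : 3 ≤ M j k := by have := hM.two_le hjk; omega
  have h3' : 3 ≤ M k l := by have := hM.two_le hkl; omega
  have c1 := half_le_cos_pi_div h1'
  have c2 := half_le_cos_pi_div h2'
  have c3 := half_le_cos_pi_div h3'
  have hil2 : M i l = 2 := by
    by_contra hne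
    have h4' : 3 ≤ M i l := by have := hM.two_le hil; omega
    have c4 := half_le_cos_pi_div h4'
    -- The all-ones vector excludes a four-cycle.
    have hq := hM.quadratic_form_four_pos hij hik hil hjk hjl hkl 1 1 1 1 one_ne_zero
    rw [hik2, hjl2] at hq
    simp only [Nat.cast_ofNat, Real.cos_pi_div_two] at hq
    linarith
  -- With both inner coordinates 1 and the ends minimizing, the value is 2 - p² - r² - 2q for the
  -- cosines p, q, r along the path. This bounds the middle label by 4 and forbids two multiple end
  -- links.
  have hq := hM.quadratic_form_four_pos hij hik hil hjk hjl hkl (Real.cos (Real.pi / M i j)) 1 1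
    (Real.cos (Real.pi / M k l)) (by linarith)
  rw [hik2, hjl2, hil2] at hq
  simp only [Nat.cast_ofNat, Real.cos_pi_div_two] at hq
  have hjk4 : M j k ≤ 4 := by
    by_contra! h
    have := three_quarters_le_cos_pi_div h
    nlinarith
  have hends : ¬ (4 ≤ M i j ∧ 4 ≤ M k l) := by
    rintro ⟨h, h'⟩
    have := half_le_cos_pi_div_sq h
    have := half_le_cos_pi_div_sq h'
    nlinarith
  refine ⟨hik2, hjl2, hil2, ?_⟩
  omega

theorem HasType.of_injective {n : ℕ} {M N : CoxeterMatrix (Fin n)} (hM : HasType Φ M)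
    {v : Fin n → Fin n} (hv : Function.Injective v) (h : ∀ a b, a < b → M (v a) (v b) = N a b) :
    HasType Φ N := by
  replace h (a b : Fin n) : M (v a) (v b) = N a b := by
    rcases lt_trichotomy a b with hab | rfl | hab
    · exact h a b hab
    · rw [M.diagonal, N.diagonal]
    · rw [M.symmetric, N.symmetric, h b a hab]
  have := hM.reindex (Equiv.ofBijective v (Finite.injective_iff_bijective.mp hv)).symm
  convert this
  ext a b
  simp [CoxeterMatrix.reindex_apply, h]

theorem HasType.of_three {M N : CoxeterMatrix (Fin 3)} (hM : HasType Φ M) {i j k : Fin 3}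
    (hij : i ≠ j) (hik : i ≠ k) (hjk : j ≠ k) (h₀₁ : M i j = N 0 1) (h₀₂ : M i k = N 0 2)
    (h₁₂ : M j k = N 1 2) : HasType Φ N := by
  refine hM.of_injective (v := ![i, j, k]) (fun a b => ?_) fun a b => ?_
  · fin_cases a <;> fin_cases b <;> simp [hij, hik, hjk, hij.symm, hik.symm, hjk.symm]
  · fin_cases a <;> fin_cases b <;> simp [h₀₁, h₀₂, h₁₂]

theorem HasType.of_four {M N : CoxeterMatrix (Fin 4)} (hM : HasType Φ M) {i j k l : Fin 4}
    (hij : i ≠ j) (hik : i ≠ k) (hil : i ≠ l) (hjk : j ≠ k) (hjl : j ≠ l) (hkl : k ≠ l)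
    (h₀₁ : M i j = N 0 1) (h₀₂ : M i k = N 0 2) (h₀₃ : M i l = N 0 3) (h₁₂ : M j k = N 1 2)
    (h₁₃ : M j l = N 1 3) (h₂₃ : M k l = N 2 3) : HasType Φ N := by
  refine hM.of_injective (v := ![i, j, k, l]) (fun a b => ?_) fun a b => ?_
  · fin_cases a <;> fin_cases b <;> simp [hij, hik, hil, hjk, hjl, hkl, hij.symm, hik.symm,
      hil.symm, hjk.symm, hjl.symm, hkl.symm]
  · fin_cases a <;> fin_cases b <;> simp [h₀₁, h₀₂, h₀₃, h₁₂, h₁₃, h₂₃]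

/-- The classification of the irreducible root systems of rank three. -/
theorem HasType.classification_three {M : CoxeterMatrix (Fin 3)} (hM : HasType Φ M)
    (hirr : IsIrreducibleRootSystem Φ) :
    HasType Φ (CoxeterMatrix.A 3) ∨ HasType Φ (CoxeterMatrix.B 3) ∨
      HasType Φ CoxeterMatrix.H₃ := by
  have hconn := hM.isIrreducible_iff.mp hirr
  have hstep (S : Set (Fin 3)) (hS : S.Nonempty) (hS' : S ≠ Set.univ) :
      ∃ i ∈ S, ∃ j ∉ S, M i j ≠ 2 := by
    by_contra! hcon
    rcases hconn S hcon with h | h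
    · exact hS.ne_empty h
    · exact hS' h
  have hcard (S : Finset (Fin 3)) (h : S.card < 3) : (S : Set (Fin 3)) ≠ Set.univ := by
    intro hS
    rw [← Finset.coe_univ, Finset.coe_inj] at hS
    simp [hS] at h
  -- Connectedness, applied to a node and then to a linked pair, yields a path; relabelling puts the
  -- shared node `j` in the middle.
  obtain ⟨i, j, k, hij, hik, hjk, h1, h2⟩ : ∃ i j k : Fin 3, i ≠ j ∧ i ≠ k ∧ j ≠ k ∧
      M i j ≠ 2 ∧ M j k ≠ 2 := by
    obtain ⟨i, hi, j, hj, h1⟩ := hstep ({0} : Finset (Fin 3)) (by simp) (hcard _ (by decide))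
    have hij : i ≠ j := fun h => hj (h ▸ hi)
    obtain ⟨a, ha, k, hk, h2⟩ := hstep ({i, j} : Finset (Fin 3)) (by simp)
      (hcard _ (Finset.card_le_two.trans_lt (by norm_num)))
    simp only [Finset.coe_insert, Finset.coe_singleton, Set.mem_insert_iff,
      Set.mem_singleton_iff, not_or] at ha hk
    rcases ha with rfl | rfl
    · exact ⟨j, a, k, hij.symm, Ne.symm hk.2, Ne.symm hk.1, M.symmetric a j ▸ h1, h2⟩
    · exact ⟨i, a, k, hij, Ne.symm hk.1, Ne.symm hk.2, h1, h2⟩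
  obtain ⟨hik2, h⟩ := hM.path_three hij hik hjk h1 h2
  have h1' := hM.two_le hij
  have h2' := hM.two_le hjk
  have hji := M.symmetric j i
  have hkj := M.symmetric k j
  have hki := M.symmetric k i
  have hcases : (M i j = 3 ∧ M j k = 3) ∨ (M i j = 3 ∧ M j k = 4) ∨ (M i j = 3 ∧ M j k = 5) ∨
    (M i j = 4 ∧ M j k = 3) ∨ (M i j = 5 ∧ M j k = 3) := by omega
  rcases hcases with ⟨ha, hb⟩ | ⟨ha, hb⟩ | ⟨ha, hb⟩ | ⟨ha, hb⟩ | ⟨ha, hb⟩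
  · exact Or.inl (hM.of_three hij hik hjk ha hik2 hb)
  · exact Or.inr (Or.inl (hM.of_three hij hik hjk ha hik2 hb))
  · exact Or.inr (Or.inr (hM.of_three hij hik hjk ha hik2 hb))
  -- The path is reversed so that the multiple link comes last, as in the standard matrices.
  · exact Or.inr (Or.inl (hM.of_three hjk.symm hik.symm hij.symm (hkj.trans hb)
      (hki.trans hik2) (hji.trans ha)))
  · exact Or.inr (Or.inr (hM.of_three hjk.symm hik.symm hij.symm (hkj.trans hb)
      (hki.trans hik2) (hji.trans ha)))

theorem path_four_cases {p q r : ℕ} (hp : 2 ≤ p) (hp' : p ≠ 2) (hr : 2 ≤ r) (hr' : r ≠ 2)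
    (h : q = 4 ∧ p = 3 ∧ r = 3 ∨ q = 3 ∧ p = 3 ∧ r ≤ 5 ∨ q = 3 ∧ r = 3 ∧ p ≤ 5) :
    (p = 3 ∧ q = 3 ∧ r = 3) ∨ (p = 3 ∧ q = 3 ∧ r = 4) ∨ (p = 3 ∧ q = 3 ∧ r = 5) ∨
    (p = 4 ∧ q = 3 ∧ r = 3) ∨ (p = 5 ∧ q = 3 ∧ r = 3) ∨ (p = 3 ∧ q = 4 ∧ r = 3) := by
  rcases h with ⟨rfl, rfl, rfl⟩ | ⟨rfl, rfl, hr₅⟩ | ⟨rfl, rfl, hp₅⟩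
  · simp
  · interval_cases r <;> simp_all
  · interval_cases p <;> simp_all

theorem HasType.of_path_four {M : CoxeterMatrix (Fin 4)} (hM : HasType Φ M) {i j k l : Fin 4}
    (hij : i ≠ j) (hik : i ≠ k) (hil : i ≠ l) (hjk : j ≠ k)
    (hjl : j ≠ l) (hkl : k ≠ l) (h1 : M i j ≠ 2) (h2 : M j k ≠ 2) (h3 : M k l ≠ 2) :
    HasType Φ (CoxeterMatrix.A 4) ∨ HasType Φ (CoxeterMatrix.B 4) ∨ HasType Φ D₄ ∨
      HasType Φ CoxeterMatrix.F₄ ∨ HasType Φ CoxeterMatrix.H₄ := by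
  obtain ⟨hik2, hjl2, hil2, h⟩ := hM.path_four hij hik hil hjk hjl hkl h1 h2 h3
  have h1' := hM.two_le hij
  have h3' := hM.two_le hkl
  have hji := M.symmetric j i
  have hkj := M.symmetric k j
  have hki := M.symmetric k i
  have hli := M.symmetric l i
  have hlj := M.symmetric l j
  have hlk := M.symmetric l k
  rcases path_four_cases h1' h1 h3' h3 h with ⟨ha, hb, hc⟩ | ⟨ha, hb, hc⟩ | ⟨ha, hb, hc⟩ |
    ⟨ha, hb, hc⟩ | ⟨ha, hb, hc⟩ | ⟨ha, hb, hc⟩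
  · exact Or.inl (hM.of_four hij hik hil hjk hjl hkl ha hik2 hil2 hb hjl2 hc)
  · exact Or.inr (Or.inl (hM.of_four hij hik hil hjk hjl hkl ha hik2 hil2 hb hjl2 hc))
  · exact Or.inr (Or.inr (Or.inr (Or.inr (
      hM.of_four hij hik hil hjk hjl hkl ha hik2 hil2 hb hjl2 hc))))
  · exact Or.inr (Or.inl (
      hM.of_four hkl.symm hjl.symm hil.symm hjk.symm hik.symm hij.symm (hlk.trans hc)
      (hlj.trans hjl2) (hli.trans hil2) (hkj.trans hb) (hki.trans hik2) (hji.trans ha)))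
  · exact Or.inr (Or.inr (Or.inr (Or.inr (
      hM.of_four hkl.symm hjl.symm hil.symm hjk.symm hik.symm hij.symm (hlk.trans hc)
      (hlj.trans hjl2) (hli.trans hil2) (hkj.trans hb) (hki.trans hik2) (hji.trans ha)))))
  · exact Or.inr (Or.inr (Or.inr (Or.inl (
      hM.of_four hij hik hil hjk hjl hkl ha hik2 hil2 hb hjl2 hc))))

/-- The classification of the irreducible root systems of rank four. -/
theorem HasType.classification_four {M : CoxeterMatrix (Fin 4)} (hM : HasType Φ M)
    (hirr : IsIrreducibleRootSystem Φ) :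
    HasType Φ (CoxeterMatrix.A 4) ∨ HasType Φ (CoxeterMatrix.B 4) ∨ HasType Φ D₄ ∨
      HasType Φ CoxeterMatrix.F₄ ∨ HasType Φ CoxeterMatrix.H₄ := by
  have hconn := hM.isIrreducible_iff.mp hirr
  have hstep (S : Set (Fin 4)) (hS : S.Nonempty) (hS' : S ≠ Set.univ) :
      ∃ i ∈ S, ∃ j ∉ S, M i j ≠ 2 := by
    by_contra! hcon
    rcases hconn S hcon with h | h
    · exact hS.ne_empty h
    · exact hS' h
  have hcard (S : Finset (Fin 4)) (h : S.card < 4) : (S : Set (Fin 4)) ≠ Set.univ := by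
    intro hS
    rw [← Finset.coe_univ, Finset.coe_inj] at hS
    simp [hS] at h
  obtain ⟨i, j, k, hij, hik, hjk, h1, h2⟩ : ∃ i j k : Fin 4, i ≠ j ∧ i ≠ k ∧ j ≠ k ∧
      M i j ≠ 2 ∧ M j k ≠ 2 := by
    obtain ⟨i, hi, j, hj, h1⟩ := hstep ({0} : Finset (Fin 4)) (by simp) (hcard _ (by decide))
    have hij : i ≠ j := fun h => hj (h ▸ hi)
    obtain ⟨a, ha, k, hk, h2⟩ := hstep ({i, j} : Finset (Fin 4)) (by simp)
      (hcard _ (Finset.card_le_two.trans_lt (by norm_num)))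
    simp only [Finset.coe_insert, Finset.coe_singleton, Set.mem_insert_iff,
      Set.mem_singleton_iff, not_or] at ha hk
    rcases ha with rfl | rfl
    · exact ⟨j, a, k, hij.symm, Ne.symm hk.2, Ne.symm hk.1, M.symmetric a j ▸ h1, h2⟩
    · exact ⟨i, a, k, hij, Ne.symm hk.1, Ne.symm hk.2, h1, h2⟩
  have hpath {i j k l : Fin 4} := hM.of_path_four (i := i) (j := j) (k := k) (l := l)
  obtain ⟨a, ha, l, hl, h3⟩ := hstep ({i, j, k} : Finset (Fin 4)) (by simp)
    (hcard _ (Finset.card_le_three.trans_lt (by norm_num)))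
  simp only [Finset.coe_insert, Finset.coe_singleton, Set.mem_insert_iff,
    Set.mem_singleton_iff, not_or] at ha hl
  obtain ⟨hil, hjl, hkl⟩ := hl
  replace hil := Ne.symm hil
  replace hjl := Ne.symm hjl
  replace hkl := Ne.symm hkl
  have hji := M.symmetric j i
  have hkj := M.symmetric k j
  -- The fourth node attaches to an end, which extends the path, or to the middle node, which
  -- produces D₄.
  rcases ha with rfl | rfl | rfl
  · exact hpath hjk.symm hik.symm hkl hij.symm hjl hil (hkj ▸ h2) (hji ▸ h1) h3
  · obtain ⟨h1, h2, h3, h4, h5, h6⟩ :=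
      hM.star_four hij.symm hjk hjl hik hil hkl (hji ▸ h1) h2 h3
    exact Or.inr (Or.inr (Or.inl (hM.of_four hij hik hil hjk hjl hkl (hji.symm.trans h1) h4 h5 h2 h3
      h6)))
  · exact hpath hij hik hil hjk hjl hkl h1 h2 h3

end Classification

/-! ### Root systems from lists of exact coordinates. -/

section Coordinates

open Matrix

variable {V : Type*} [NormedAddCommGroup V] [InnerProductSpace ℝ V] {K : Type*} [CommRing K]
  {n : ℕ} (ev : K →+* ℝ)

/-- The linear combination of the vectors `b i` whose coefficients are the real numbers `ev (c i)`. -/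
def comb (b : Fin n → V) (c : Fin n → K) : V := ∑ i, ev (c i) • b i

/-- The vectors with coordinates in `L` with respect to `b`, and their opposites. -/
def rootsOf (b : Fin n → V) (L : List (Fin n → K)) : Set V :=
  {x | ∃ c ∈ L, x = comb ev b c ∨ x = -comb ev b c}

/-- `L` is a list of non-negative coordinate vectors of roots with respect to simple roots that have
the Gram matrix `G / 2`; it contains those of the simple roots and is stable under the simple
reflections, up to sign. -/
structure IsPositiveRootList (G : Matrix (Fin n) (Fin n) K) (L : List (Fin n → K)) : Prop where
  simple : ∀ i, Pi.single i 1 ∈ L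
  nonneg : ∀ c ∈ L, ∀ i, 0 ≤ ev (c i)
  norm : ∀ c ∈ L, c ⬝ᵥ G *ᵥ c = 2
  reflection : ∀ c ∈ L, ∀ i, c - Pi.single i ((G *ᵥ c) i) ∈ L ∨ Pi.single i ((G *ᵥ c) i) - c ∈ L

variable {ev}

theorem comb_sub (b : Fin n → V) (c d : Fin n → K) :
    comb ev b (c - d) = comb ev b c - comb ev b d := by
  simp [comb, sub_smul]

theorem comb_neg (b : Fin n → V) (c : Fin n → K) : comb ev b (-c) = -comb ev b c := by
  simp [comb]

theorem comb_single (b : Fin n → V) (i : Fin n) (k : K) :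
    comb ev b (Pi.single i k) = ev k • b i := by
  simp [comb, Pi.single_apply, apply_ite ev, ite_smul]

theorem comb_comp (b : Fin n → V) (D : Matrix (Fin n) (Fin n) K) (c : Fin n → K) :
    comb ev (fun i => comb ev b (fun k => D k i)) c = comb ev b (D *ᵥ c) := by
  simp only [comb, mulVec, dotProduct, map_sum, map_mul, Finset.smul_sum, Finset.sum_smul,
    smul_smul]
  rw [Finset.sum_comm]
  simp only [mul_comm]

theorem two_mul_inner_comb {b : Fin n → V} {G : Matrix (Fin n) (Fin n) K}
    (hG : ∀ i j, ev (G i j) = 2 * ⟪b i, b j⟫) (c d : Fin n → K) :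
    2 * ⟪comb ev b c, comb ev b d⟫ = ev (c ⬝ᵥ G *ᵥ d) := by
  simp only [comb, dotProduct, mulVec, map_sum, map_mul, hG, sum_inner, inner_sum,
    inner_smul_left, inner_smul_right, conj_trivial, Finset.mul_sum]
  rw [Finset.sum_comm]
  refine Finset.sum_congr rfl fun i _ => Finset.sum_congr rfl fun j _ => ?_
  ring

/-- `B` is a scaled inverse of the Gram matrix with entries in `K`, so nondegeneracy is certified by
one product without division. -/
theorem linearIndependent_of_gram {b : Fin n → V} {G : Matrix (Fin n) (Fin n) K}
    (hG : ∀ i j, ev (G i j) = 2 * ⟪b i, b j⟫) {B : Matrix (Fin n) (Fin n) K} {d : K}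
    (hB : B * G = diagonal fun _ => d) (hd : ev d ≠ 0) : LinearIndependent ℝ b := by
  rw [Fintype.linearIndependent_iff]
  intro c hc i
  have h1 : (G.map ev) *ᵥ c = 0 := by
    funext j
    have h2 : ⟪b j, ∑ i, c i • b i⟫ = 0 := by rw [hc, inner_zero_right]
    simp only [inner_sum, inner_smul_right] at h2
    simp only [mulVec, dotProduct, map_apply, hG, Pi.zero_apply]
    calc ∑ k, 2 * ⟪b j, b k⟫ * c k = 2 * ∑ k, c k * ⟪b j, b k⟫ := by
          rw [Finset.mul_sum]
          exact Finset.sum_congr rfl fun k _ => by ring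
      _ = 0 := by rw [h2, mul_zero]
  have h2 : (B.map ev) *ᵥ ((G.map ev) *ᵥ c) = 0 := by rw [h1, mulVec_zero]
  rw [mulVec_mulVec, ← Matrix.map_mul, hB, diagonal_map (map_zero ev)] at h2
  have h3 := congrFun h2 i
  rw [mulVec_diagonal] at h3
  exact (mul_eq_zero.mp h3).resolve_left hd

theorem rootsOf_finite (b : Fin n → V) (L : List (Fin n → K)) : (rootsOf ev b L).Finite := by
  have h : {c | c ∈ L}.Finite := L.finite_toSet
  refine ((h.image (comb ev b)).union (h.image fun c => -comb ev b c)).subset ?_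
  rintro x ⟨c, hc, rfl | rfl⟩
  · exact Or.inl ⟨c, hc, rfl⟩
  · exact Or.inr ⟨c, hc, rfl⟩

theorem neg_mem_rootsOf {b : Fin n → V} {L : List (Fin n → K)} {x : V}
    (hx : x ∈ rootsOf ev b L) : -x ∈ rootsOf ev b L := by
  obtain ⟨c, hc, rfl | rfl⟩ := hx
  · exact ⟨c, hc, Or.inr rfl⟩
  · exact ⟨c, hc, Or.inl (neg_neg _)⟩

/-- A list of coordinate vectors that satisfies the combinatorial conditions is a root system. -/
theorem IsPositiveRootList.isRootSystem {Δ : Basis (Fin n) ℝ V} {G : Matrix (Fin n) (Fin n) K}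
    (hG : ∀ i j, ev (G i j) = 2 * ⟪Δ i, Δ j⟫) (hnorm : ∀ i, ‖Δ i‖ = 1)
    {L : List (Fin n → K)} (h : IsPositiveRootList ev G L) :
    IsRootSystem (rootsOf ev Δ L) ∧ IsSimpleSystem (rootsOf ev Δ L) Δ := by
  -- For unit simple roots and a doubled Gram matrix, a simple reflection subtracts `(G *ᵥ c) i`
  -- from coordinate `i`.
  have hrefl (i : Fin n) (c : Fin n → K) :
      refl (Δ i) (comb ev Δ c) = comb ev Δ (c - Pi.single i ((G *ᵥ c) i)) := by
    have h1 := two_mul_inner_comb hG (Pi.single i 1) c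
    rw [comb_single, map_one, one_smul, single_one_dotProduct] at h1
    rw [comb_sub, comb_single, ← h1, refl, real_inner_self_eq_norm_sq, hnorm,
      real_inner_comm (Δ i)]
    norm_num
  have hsimple : IsSimpleSystem (rootsOf ev Δ L) Δ := by
    refine ⟨fun i => ⟨_, h.simple i, Or.inl ?_⟩, ?_⟩
    · rw [comb_single, map_one, one_smul]
    · rintro _ ⟨c, hc, rfl | rfl⟩
      · left
        intro i
        rw [comb, Basis.repr_sum_self]
        exact h.nonneg c hc i
      · right
        intro i
        rw [map_neg, Finsupp.neg_apply, comb, Basis.repr_sum_self, neg_nonpos]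
        exact h.nonneg c hc i
  refine ⟨isRootSystem_of_simple (rootsOf_finite _ L) ?_ hsimple fun i => ?_, hsimple⟩
  · have hc1 (c : Fin n → K) (hc : c ∈ L) : ‖comb ev Δ c‖ = 1 := by
      have h1 := two_mul_inner_comb hG c c
      rw [h.norm c hc, real_inner_self_eq_norm_sq, map_ofNat] at h1
      have h2 := norm_nonneg (comb ev Δ c)
      nlinarith
    rintro _ ⟨c, hc, rfl | rfl⟩
    · exact hc1 c hc
    · rw [norm_neg, hc1 c hc]
  · have hmem (c : Fin n → K) (hc : c ∈ L) : refl (Δ i) (comb ev Δ c) ∈ rootsOf ev Δ L := by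
      rw [hrefl]
      rcases h.reflection c hc i with h1 | h1
      · exact ⟨_, h1, Or.inl rfl⟩
      · exact ⟨_, h1, Or.inr (by rw [← comb_neg, neg_sub])⟩
    rintro _ ⟨c, hc, rfl | rfl⟩
    · exact hmem c hc
    · rw [refl_neg]
      exact neg_mem_rootsOf (hmem c hc)

/-- Unit vectors `b i` with the Gram matrix of the diagram `M`, together with a list of positive
roots, determine a root system of type `M`. -/
theorem hasType_rootsOf [FiniteDimensional ℝ V] (hn : finrank ℝ V = n) {M : CoxeterMatrix (Fin n)}
    {b : Fin n → V} (hb : ∀ i j, ⟪b i, b j⟫ = -Real.cos (Real.pi / M i j))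
    {G : Matrix (Fin n) (Fin n) K} (hG : ∀ i j, ev (G i j) = -2 * Real.cos (Real.pi / M i j))
    {B : Matrix (Fin n) (Fin n) K} {d : K} (hB : B * G = diagonal fun _ => d) (hd : ev d ≠ 0)
    {L : List (Fin n → K)} (h : IsPositiveRootList ev G L) :
    ∃ Δ : Basis (Fin n) ℝ V, ⇑Δ = b ∧ IsSimpleSystem (rootsOf ev b L) Δ ∧
      HasType (rootsOf ev b L) M := by
  have hG' (i j : Fin n) : ev (G i j) = 2 * ⟪b i, b j⟫ := by
    rw [hG, hb]
    ring
  have hli := linearIndependent_of_gram hG' hB hd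
  obtain ⟨Δ, hΔ⟩ : ∃ Δ : Basis (Fin n) ℝ V, ⇑Δ = b := by
    rcases n.eq_zero_or_pos with rfl | hpos
    · have := finrank_zero_iff.mp hn
      exact ⟨Basis.empty V, Subsingleton.elim _ _⟩
    · have : Nonempty (Fin n) := ⟨⟨0, hpos⟩⟩
      exact ⟨basisOfLinearIndependentOfCardEqFinrank hli (by simp [hn]), by simp⟩
  subst hΔ
  have hnorm (i : Fin n) : ‖Δ i‖ = 1 := by
    have := hb i i
    rw [M.diagonal, real_inner_self_eq_norm_sq, Nat.cast_one, div_one, Real.cos_pi, neg_neg] at this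
    have h2 := norm_nonneg (Δ i)
    nlinarith
  obtain ⟨h1, h2⟩ := h.isRootSystem hG' hnorm
  refine ⟨Δ, rfl, h2, h1, Δ, h2, fun i j => ?_⟩
  rw [hb, hnorm, hnorm, mul_one, mul_one]

end Coordinates

/-! ### The coefficient rings ℤ[√2] and ℤ[φ] inside ℝ. -/

section Evaluation

/-- The embedding of `ℤ[√2]` into the real numbers. -/
def evSqrtTwo : QuadraticAlgebra ℤ 2 0 →+* ℝ :=
  (QuadraticAlgebra.lift (R := ℤ) (a := 2) (b := 0) ⟨√2, by simp⟩).toRingHom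

theorem evSqrtTwo_apply (x : QuadraticAlgebra ℤ 2 0) : evSqrtTwo x = x.re + x.im * √2 := by
  simp [evSqrtTwo]

/-- The embedding of `ℤ[φ]` into the real numbers, for the golden ratio `φ`. -/
def evGolden : QuadraticAlgebra ℤ 1 1 →+* ℝ :=
  (QuadraticAlgebra.lift (R := ℤ) (a := 1) (b := 1)
    ⟨Real.goldenRatio, by rw [← sq, Real.goldenRatio_sq]; simp [add_comm]⟩).toRingHom

theorem evGolden_apply (x : QuadraticAlgebra ℤ 1 1) :
    evGolden x = x.re + x.im * Real.goldenRatio := by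
  simp [evGolden]

/-- The numbers `-2 cos (π / m)` for `m ≤ 3`. -/
def gramInt (m : ℕ) : ℤ := if m = 1 then 2 else if m = 2 then 0 else -1

/-- The numbers `-2 cos (π / m)` for `m ≤ 4`. -/
def gramSqrtTwo (m : ℕ) : QuadraticAlgebra ℤ 2 0 :=
  if m = 1 then ⟨2, 0⟩ else if m = 2 then 0 else if m = 3 then ⟨-1, 0⟩ else ⟨0, -1⟩

/-- The numbers `-2 cos (π / m)` for `m ≤ 5`, `m ≠ 4`. -/
def gramGolden (m : ℕ) : QuadraticAlgebra ℤ 1 1 :=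
  if m = 1 then ⟨2, 0⟩ else if m = 2 then 0 else if m = 3 then ⟨-1, 0⟩ else ⟨0, -1⟩

theorem gramInt_eq {m : ℕ} (h : m ∈ [1, 2, 3]) :
    Int.castRingHom ℝ (gramInt m) = -2 * Real.cos (Real.pi / m) := by
  simp only [List.mem_cons, List.not_mem_nil, or_false] at h
  rcases h with rfl | rfl | rfl <;> simp [gramInt]

theorem gramSqrtTwo_eq {m : ℕ} (h : m ∈ [1, 2, 3, 4]) :
    evSqrtTwo (gramSqrtTwo m) = -2 * Real.cos (Real.pi / m) := by
  simp only [List.mem_cons, List.not_mem_nil, or_false] at h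
  rcases h with rfl | rfl | rfl | rfl <;> simp [gramSqrtTwo, evSqrtTwo_apply]
  all_goals ring

theorem gramGolden_eq {m : ℕ} (h : m ∈ [1, 2, 3, 5]) :
    evGolden (gramGolden m) = -2 * Real.cos (Real.pi / m) := by
  simp only [List.mem_cons, List.not_mem_nil, or_false] at h
  rcases h with rfl | rfl | rfl | rfl <;> simp [gramGolden, evGolden_apply, Real.goldenRatio]
  all_goals ring

/-- A sufficient condition only, but a decidable one that the tabulated coordinates satisfy. -/
theorem evSqrtTwo_nonneg {x : QuadraticAlgebra ℤ 2 0} (h : 0 ≤ x.re ∧ 0 ≤ x.im) :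
    0 ≤ evSqrtTwo x := by
  have h1 : (0 : ℝ) ≤ x.re := by exact_mod_cast h.1
  have h2 : (0 : ℝ) ≤ x.im := by exact_mod_cast h.2
  rw [evSqrtTwo_apply]
  positivity

theorem evGolden_nonneg {x : QuadraticAlgebra ℤ 1 1} (h : 0 ≤ x.re ∧ 0 ≤ x.im) :
    0 ≤ evGolden x := by
  have h1 : (0 : ℝ) ≤ x.re := by exact_mod_cast h.1
  have h2 : (0 : ℝ) ≤ x.im := by exact_mod_cast h.2
  have := Real.goldenRatio_pos
  rw [evGolden_apply]
  positivity

end Evaluation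

/-! ### Clifford products and spinors in coordinates. -/

section Spinors

open CliffordAlgebra (ι)

theorem ι_mul_self (v : EuclideanSpace ℝ (Fin 3)) : ι Q₃ v * ι Q₃ v = ⟪v, v⟫ • (1 : Cl₃) := by
  rw [CliffordAlgebra.ι_sq_scalar, Algebra.algebraMap_eq_smul_one]
  rfl

theorem ι_mul_swap (v w : EuclideanSpace ℝ (Fin 3)) :
    ι Q₃ w * ι Q₃ v = (2 * ⟪v, w⟫) • (1 : Cl₃) - ι Q₃ v * ι Q₃ w := by
  have h := CliffordAlgebra.ι_mul_ι_add_swap (Q := Q₃) w v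
  have hp : QuadraticMap.polar Q₃ w v = 2 * ⟪v, w⟫ := by
    simp only [QuadraticMap.polar, Q₃, LinearMap.BilinMap.toQuadraticMap_apply, innerₗ_apply_apply,
      inner_add_left, inner_add_right, real_inner_comm v w]
    ring
  rw [hp, Algebra.algebraMap_eq_smul_one] at h
  exact eq_sub_of_add_eq h

theorem algebraMap_Cl₃_injective : Function.Injective (algebraMap ℝ Cl₃) :=
  (algebraMap ℝ Cl₃).injective

/-- The norm of a spinor can be read off in the Clifford algebra, so a vector mapped to zero has
norm zero. -/
theorem spinorOf_injective : Function.Injective spinorOf := by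
  rw [injective_iff_map_eq_zero]
  intro a ha
  have h := algebraMap_inner a a
  rw [ha, map_zero, mul_zero, add_zero, smul_zero] at h
  have h2 : ⟪a, a⟫ = 0 := algebraMap_Cl₃_injective (by simpa using h)
  exact inner_self_eq_zero.mp h2

/-- The product of two vectors as a spinor. -/
def vectorProduct (v w : EuclideanSpace ℝ (Fin 3)) : EuclideanSpace ℝ (Fin 4) :=
  !₂[v 0 * w 0 + v 1 * w 1 + v 2 * w 2, v 1 * w 2 - v 2 * w 1, v 2 * w 0 - v 0 * w 2,
    v 0 * w 1 - v 1 * w 0]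

theorem spinorOf_vectorProduct (v w : EuclideanSpace ℝ (Fin 3)) :
    spinorOf (vectorProduct v w) = ι Q₃ v * ι Q₃ w := by
  have hvec (m : EuclideanSpace ℝ (Fin 3)) : ι Q₃ m = m 0 • e 0 + m 1 • e 1 + m 2 • e 2 := by
    have hm : m = m 0 • EuclideanSpace.single 0 1 + m 1 • EuclideanSpace.single 1 1 +
        m 2 • EuclideanSpace.single 2 1 := by
      ext i
      fin_cases i <;> simp
    conv_lhs => rw [hm]
    simp only [map_add, map_smul, e]
  rw [hvec, hvec, spinorOf_apply, vectorProduct]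
  simp only [Matrix.cons_val, add_mul, mul_add, smul_mul_smul_comm, e_sq]
  rw [e_anticomm (show (2 : Fin 3) ≠ 1 by decide), e_anticomm (show (0 : Fin 3) ≠ 2 by decide),
    e_anticomm (show (1 : Fin 3) ≠ 0 by decide)]
  module

theorem spinorOf_one : spinorOf !₂[1, 0, 0, 0] = 1 := by
  simp [spinorOf_apply]

theorem spinorOf_mul_reverse {a : EuclideanSpace ℝ (Fin 4)} (ha : ‖a‖ = 1) :
    spinorOf a * CliffordAlgebra.reverse (spinorOf a) = 1 := by
  have h := algebraMap_inner a a
  rw [real_inner_self_eq_norm_sq, ha, one_pow, map_one, ← two_smul ℝ, smul_smul] at h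
  norm_num at h
  exact h.symm

theorem reverse_mul_spinorOf {a : EuclideanSpace ℝ (Fin 4)} (ha : ‖a‖ = 1) :
    CliffordAlgebra.reverse (spinorOf a) * spinorOf a = 1 := by
  have hr : CliffordAlgebra.reverse (spinorOf a) = spinorOf !₂[a 0, -a 1, -a 2, -a 3] := by
    rw [reverse_spinorOf, spinorOf_apply]
    simp only [Matrix.cons_val]
    module
  have ha' : ‖(!₂[a 0, -a 1, -a 2, -a 3] : EuclideanSpace ℝ (Fin 4))‖ = 1 := by
    rw [← ha, EuclideanSpace.norm_eq, EuclideanSpace.norm_eq]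
    simp [Fin.sum_univ_four]
  have := spinorOf_mul_reverse ha'
  rwa [← hr, CliffordAlgebra.reverse_reverse] at this

/-- Reflections of unit spinors in terms of the Clifford product. -/
theorem spinorOf_refl {a : EuclideanSpace ℝ (Fin 4)} (ha : ‖a‖ = 1)
    (x : EuclideanSpace ℝ (Fin 4)) :
    spinorOf (refl a x) = -(spinorOf a * CliffordAlgebra.reverse (spinorOf x) * spinorOf a) := by
  have h := algebraMap_inner x a
  rw [Algebra.algebraMap_eq_smul_one] at h
  -- This is the formula for the inner product solved for a x̃; multiplying by a on the right and
  -- using ã a = 1 yields the reflection.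
  have h1 : spinorOf a * CliffordAlgebra.reverse (spinorOf x) =
      (2 * ⟪x, a⟫) • (1 : Cl₃) - spinorOf x * CliffordAlgebra.reverse (spinorOf a) := by
    rw [mul_smul, h]
    module
  rw [h1, sub_mul, smul_mul_assoc, one_mul, mul_assoc, reverse_mul_spinorOf ha, mul_one, refl,
    real_inner_self_eq_norm_sq, ha, map_sub, map_smul]
  norm_num

theorem ι_refl {a : EuclideanSpace ℝ (Fin 3)} (ha : ⟪a, a⟫ = 1) (x : EuclideanSpace ℝ (Fin 3)) :
    ι Q₃ (refl a x) = -(ι Q₃ a * ι Q₃ x * ι Q₃ a) := by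
  rw [mul_assoc, ι_mul_swap, mul_sub, ← mul_assoc (ι Q₃ a), ι_mul_self, ha, refl, ha, map_sub,
    map_smul, real_inner_comm, mul_smul_comm, mul_one, one_smul, one_mul, div_one]
  module

/-! The coordinates of spinors with respect to the products `1`, `a₀a₁`, `a₁a₂`, `a₀a₂` of three unit
vectors, where `a₀` and `a₂` are orthogonal. -/

/-- The spinors `1`, `a₀a₁`, `a₁a₂` and `a₀a₂`. -/
def spinorFrame (a : Fin 3 → EuclideanSpace ℝ (Fin 3)) : Fin 4 → EuclideanSpace ℝ (Fin 4) :=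
  ![!₂[1, 0, 0, 0], vectorProduct (a 0) (a 1), vectorProduct (a 1) (a 2),
    vectorProduct (a 0) (a 2)]

variable {K : Type*} [CommRing K] {ev : K →+* ℝ}

/-- The matrix of the multiplication by `a₀a₁` from the left. -/
def leftMul₀₁ (S : K) : Matrix (Fin 4) (Fin 4) K :=
  !![0, -1, 0, 0; 1, S, 0, 0; 0, 0, 0, -1; 0, 0, 1, S]

/-- The matrix of the multiplication by `a₁a₂` from the left. -/
def leftMul₁₂ (S T : K) : Matrix (Fin 4) (Fin 4) K :=
  !![0, -S * T, -1, -S; 0, T, 0, 1; 1, S, T, 0; 0, -1, 0, 0]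

/-- The doubled Gram matrix of the spinors `1`, `a₀a₁`, `a₁a₂`, `a₀a₂`. -/
def gramFrame (S T : K) : Matrix (Fin 4) (Fin 4) K :=
  !![2, S, T, 0; S, 2, S * T, T; T, S * T, 2, S; 0, T, S, 2]

theorem spinorOf_comb (a : Fin 3 → EuclideanSpace ℝ (Fin 3)) (c : Fin 4 → K) :
    spinorOf (comb ev (spinorFrame a) c) = ev (c 0) • (1 : Cl₃) +
      ev (c 1) • (ι Q₃ (a 0) * ι Q₃ (a 1)) + ev (c 2) • (ι Q₃ (a 1) * ι Q₃ (a 2)) +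
      ev (c 3) • (ι Q₃ (a 0) * ι Q₃ (a 2)) := by
  simp only [comb, Fin.sum_univ_four, spinorFrame, Matrix.cons_val, map_add, map_smul,
    spinorOf_vectorProduct, spinorOf_one]

/-- Three unit vectors, the first and the last of which are orthogonal, with given inner products. -/
structure IsUnitPath (ev : K →+* ℝ) (a : Fin 3 → EuclideanSpace ℝ (Fin 3)) (S T : K) : Prop where
  unit : ∀ i, ⟪a i, a i⟫ = 1
  inner₀₁ : ev S = 2 * ⟪a 0, a 1⟫
  inner₁₂ : ev T = 2 * ⟪a 1, a 2⟫
  inner₀₂ : ⟪a 0, a 2⟫ = 0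

namespace IsUnitPath

variable {a : Fin 3 → EuclideanSpace ℝ (Fin 3)} {S T : K}

theorem sq (h : IsUnitPath ev a S T) (i : Fin 3) : ι Q₃ (a i) * ι Q₃ (a i) = 1 := by
  rw [ι_mul_self, h.unit, one_smul]

theorem sq_mul (h : IsUnitPath ev a S T) (i : Fin 3) (x : Cl₃) :
    ι Q₃ (a i) * (ι Q₃ (a i) * x) = x := by
  rw [← mul_assoc, h.sq, one_mul]

theorem swap₀₁ (h : IsUnitPath ev a S T) :
    ι Q₃ (a 1) * ι Q₃ (a 0) = ev S • (1 : Cl₃) - ι Q₃ (a 0) * ι Q₃ (a 1) := by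
  rw [ι_mul_swap, h.inner₀₁]

theorem swap₁₂ (h : IsUnitPath ev a S T) :
    ι Q₃ (a 2) * ι Q₃ (a 1) = ev T • (1 : Cl₃) - ι Q₃ (a 1) * ι Q₃ (a 2) := by
  rw [ι_mul_swap, h.inner₁₂]

theorem swap₀₂ (h : IsUnitPath ev a S T) :
    ι Q₃ (a 2) * ι Q₃ (a 0) = -(ι Q₃ (a 0) * ι Q₃ (a 2)) := by
  rw [ι_mul_swap, h.inner₀₂, mul_zero, zero_smul, zero_sub]

theorem swap₀₁_mul (h : IsUnitPath ev a S T) (x : Cl₃) :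
    ι Q₃ (a 1) * (ι Q₃ (a 0) * x) = ev S • x - ι Q₃ (a 0) * (ι Q₃ (a 1) * x) := by
  rw [← mul_assoc, h.swap₀₁, sub_mul, smul_mul_assoc, one_mul, mul_assoc]

theorem swap₁₂_mul (h : IsUnitPath ev a S T) (x : Cl₃) :
    ι Q₃ (a 2) * (ι Q₃ (a 1) * x) = ev T • x - ι Q₃ (a 1) * (ι Q₃ (a 2) * x) := by
  rw [← mul_assoc, h.swap₁₂, sub_mul, smul_mul_assoc, one_mul, mul_assoc]

theorem swap₀₂_mul (h : IsUnitPath ev a S T) (x : Cl₃) :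
    ι Q₃ (a 2) * (ι Q₃ (a 0) * x) = -(ι Q₃ (a 0) * (ι Q₃ (a 2) * x)) := by
  rw [← mul_assoc, h.swap₀₂, neg_mul, mul_assoc]

/-- The Clifford relations sort every product into the order a₀, a₁, a₂, so multiplication acts on
frame coordinates through a matrix over `K`. -/
theorem mul₀₁_comb (h : IsUnitPath ev a S T) (c : Fin 4 → K) :
    ι Q₃ (a 0) * ι Q₃ (a 1) * spinorOf (comb ev (spinorFrame a) c) =
      spinorOf (comb ev (spinorFrame a) ((leftMul₀₁ S).mulVec c)) := by
  simp only [spinorOf_comb, leftMul₀₁, Matrix.mulVec, dotProduct, Fin.sum_univ_four,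
    Matrix.of_apply, Matrix.cons_val, map_add, map_mul, map_zero, map_one, map_neg]
  simp only [mul_add, mul_smul_comm, mul_one, mul_assoc, h.sq, h.sq_mul, h.swap₀₁_mul, mul_sub]
  module

theorem mul₁₂_comb (h : IsUnitPath ev a S T) (c : Fin 4 → K) :
    ι Q₃ (a 1) * ι Q₃ (a 2) * spinorOf (comb ev (spinorFrame a) c) =
      spinorOf (comb ev (spinorFrame a) ((leftMul₁₂ S T).mulVec c)) := by
  simp only [spinorOf_comb, leftMul₁₂, Matrix.mulVec, dotProduct, Fin.sum_univ_four,
    Matrix.of_apply, Matrix.cons_val, map_add, map_mul, map_zero, map_one, map_neg]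
  simp only [mul_add, mul_smul_comm, mul_one, mul_assoc, h.sq, h.sq_mul, h.swap₀₁, h.swap₁₂,
    h.swap₀₁_mul, h.swap₁₂_mul, h.swap₀₂_mul, mul_sub, mul_neg]
  module

theorem gram (h : IsUnitPath ev a S T) (i j : Fin 4) :
    ev (gramFrame S T i j) = 2 * ⟪spinorFrame a i, spinorFrame a j⟫ := by
  apply algebraMap_Cl₃_injective
  rw [map_mul, algebraMap_inner, Algebra.algebraMap_eq_smul_one, Algebra.algebraMap_eq_smul_one]
  have hone : CliffordAlgebra.reverse (1 : Cl₃) = 1 := CliffordAlgebra.reverse.map_one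
  have hmul (v w : EuclideanSpace ℝ (Fin 3)) :
      CliffordAlgebra.reverse (ι Q₃ v * ι Q₃ w) = ι Q₃ w * ι Q₃ v := by
    rw [CliffordAlgebra.reverse.map_mul, CliffordAlgebra.reverse_ι, CliffordAlgebra.reverse_ι]
  fin_cases i <;> fin_cases j <;>
    simp only [spinorFrame, gramFrame, Matrix.of_apply, Matrix.cons_val, Fin.zero_eta, Fin.mk_one,
      Fin.reduceFinMk, spinorOf_vectorProduct, spinorOf_one, hone, hmul, map_ofNat, map_zero,
      map_mul] <;>
    simp only [mul_add, mul_smul_comm, smul_mul_assoc, one_mul, mul_one, mul_assoc, h.sq, h.sq_mul,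
      h.swap₀₁, h.swap₁₂, h.swap₀₂, h.swap₀₁_mul, h.swap₁₂_mul, h.swap₀₂_mul, mul_sub, mul_neg] <;>
    module

end IsUnitPath

end Spinors

/-! ### The spinor group as a root system. -/

section Induced

open CliffordAlgebra (ι)
open Matrix

variable {Φ : Set (EuclideanSpace ℝ (Fin 3))}

/-- If left multiplication by a unit preserves a finite set, then so does that by its inverse. -/
theorem inv_mul_mem_of_finite {A : Type*} [Monoid A] {X : Set A} (hX : X.Finite) (u : Aˣ)
    (h : ∀ x ∈ X, (u : A) * x ∈ X) : ∀ x ∈ X, ((u⁻¹ : Aˣ) : A) * x ∈ X := by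
  intro x hx
  have hinj : Set.InjOn (fun x => (u : A) * x) X := fun x _ y _ h => u.mul_right_inj.mp h
  obtain ⟨y, hy, rfl⟩ := ((hX.injOn_iff_bijOn_of_mapsTo h).mp hinj).surjOn hx
  rwa [Units.inv_mul_cancel_left]

/-- The spinor group preserves every finite symmetric set of spinors that is preserved by the products
of the simple unit vectors `a₀a₁` and `a₁a₂`. -/
theorem spinorGroup_mul_mem {Δ : Basis (Fin 3) ℝ (EuclideanSpace ℝ (Fin 3))}
    (hΦ : IsRootSystem Φ) (hΔ : IsSimpleSystem Φ Δ) {a : Fin 3 → EuclideanSpace ℝ (Fin 3)}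
    (ha : ∀ i, a i = ‖Δ i‖⁻¹ • Δ i) {X : Set Cl₃} (hX : X.Finite) (hneg : ∀ x ∈ X, -x ∈ X)
    (h₀₁ : ∀ x ∈ X, ι Q₃ (a 0) * ι Q₃ (a 1) * x ∈ X)
    (h₁₂ : ∀ x ∈ X, ι Q₃ (a 1) * ι Q₃ (a 2) * x ∈ X) {R : Cl₃ˣ} (hR : R ∈ spinorGroup Φ) :
    ∀ x ∈ X, (R : Cl₃) * x ∈ X := by
  have hunit (i : Fin 3) : ⟪a i, a i⟫ = 1 := by
    have : ‖Δ i‖ ≠ 0 := norm_ne_zero_iff.mpr (Δ.ne_zero i)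
    rw [ha, inner_smul_left, inner_smul_right, real_inner_self_eq_norm_sq, conj_trivial]
    field_simp
  have hsq (i : Fin 3) (x : Cl₃) : ι Q₃ (a i) * (ι Q₃ (a i) * x) = x := by
    rw [← mul_assoc, ι_mul_self, hunit, one_smul, one_mul]
  have hinv (i j : Fin 3) (h : ∀ x ∈ X, ι Q₃ (a i) * ι Q₃ (a j) * x ∈ X) :
      ∀ x ∈ X, ι Q₃ (a j) * ι Q₃ (a i) * x ∈ X := by
    let u : Cl₃ˣ := ⟨ι Q₃ (a i) * ι Q₃ (a j), ι Q₃ (a j) * ι Q₃ (a i),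
      by rw [mul_assoc, hsq, ι_mul_self, hunit, one_smul],
      by rw [mul_assoc, hsq, ι_mul_self, hunit, one_smul]⟩
    exact inv_mul_mem_of_finite hX u h
  -- `Y` is the odd counterpart of `X`. The property `N v` below says that multiplication by v
  -- exchanges the two sets, so products of two such vectors preserve `X`.
  let Y : Set Cl₃ := {y | ι Q₃ (a 1) * y ∈ X}
  have hXY : ∀ x ∈ X, ι Q₃ (a 1) * x ∈ Y := fun x hx => by
    simpa only [Y, Set.mem_ofPred_eq, hsq] using hx
  have hnegY : ∀ y ∈ Y, -y ∈ Y := fun y hy => by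
    simpa only [Y, Set.mem_ofPred_eq, mul_neg] using hneg _ hy
  let N : EuclideanSpace ℝ (Fin 3) → Prop := fun v =>
    (∀ x ∈ X, ι Q₃ v * x ∈ Y) ∧ ∀ y ∈ Y, ι Q₃ v * y ∈ X
  have hNa (i : Fin 3) : N (a i) := by
    have h1 : ∀ x ∈ X, ι Q₃ (a 1) * (ι Q₃ (a i) * x) ∈ X := by
      intro x hx
      rw [← mul_assoc]
      fin_cases i
      · exact hinv 0 1 h₀₁ x hx
      · simpa only [Fin.mk_one, ι_mul_self, hunit, one_smul, one_mul] using hx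
      · exact h₁₂ x hx
    have h2 : ∀ x ∈ X, ι Q₃ (a i) * ι Q₃ (a 1) * x ∈ X := by
      intro x hx
      fin_cases i
      · exact h₀₁ x hx
      · simpa only [Fin.mk_one, ι_mul_self, hunit, one_smul, one_mul] using hx
      · exact hinv 1 2 h₁₂ x hx
    refine ⟨h1, fun y hy => ?_⟩
    have := h2 _ hy
    rwa [mul_assoc, hsq] at this
  -- The normalized reflected root is -a v a up to the names of the unit vectors; three exchanges
  -- again amount to one, and signs are harmless.
  have hN : ∀ v ∈ Φ, N (‖v‖⁻¹ • v) := by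
    refine hΦ.orbit_induction hΔ (fun i => ha i ▸ hNa i) fun i v hv => ?_
    have hr : ‖refl (Δ i) v‖⁻¹ • refl (Δ i) v = refl (a i) (‖v‖⁻¹ • v) := by
      have : ‖Δ i‖ ≠ 0 := norm_ne_zero_iff.mpr (Δ.ne_zero i)
      rw [ha, refl_smul_left (inv_ne_zero this), norm_refl, refl_smul]
    rw [hr]
    refine ⟨fun x hx => ?_, fun y hy => ?_⟩
    · rw [ι_refl (hunit i), neg_mul, mul_assoc, mul_assoc]
      exact hnegY _ ((hNa i).1 _ (hv.2 _ ((hNa i).1 _ hx)))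
    · rw [ι_refl (hunit i), neg_mul, mul_assoc, mul_assoc]
      exact hneg _ ((hNa i).2 _ (hv.1 _ ((hNa i).2 _ hy)))
  induction hR using Subgroup.closure_induction with
  | mem R hR =>
    obtain ⟨_, ⟨α, hα, rfl⟩, _, ⟨β, hβ, rfl⟩, h⟩ := hR
    intro x hx
    rw [h, mul_assoc]
    exact (hN α hα).2 _ ((hN β hβ).1 _ hx)
  | one => simp
  | mul R R' _ _ h h' =>
    intro x hx
    rw [Units.val_mul, mul_assoc]
    exact h _ (h' _ hx)
  | inv R _ h => exact inv_mul_mem_of_finite hX R h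

theorem exists_mem_spinorGroup {α β : EuclideanSpace ℝ (Fin 3)} (hα : α ∈ Φ) (hβ : β ∈ Φ)
    (hα0 : α ≠ 0) (hβ0 : β ≠ 0) :
    ∃ R ∈ spinorGroup Φ, (R : Cl₃) = ι Q₃ (‖α‖⁻¹ • α) * ι Q₃ (‖β‖⁻¹ • β) := by
  have hu {v : EuclideanSpace ℝ (Fin 3)} (hv : v ≠ 0) :
      ι Q₃ (‖v‖⁻¹ • v) * ι Q₃ (‖v‖⁻¹ • v) = 1 := by
    have : ‖v‖ ≠ 0 := norm_ne_zero_iff.mpr hv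
    have h : ⟪‖v‖⁻¹ • v, ‖v‖⁻¹ • v⟫ = 1 := by
      rw [inner_smul_left, inner_smul_right, real_inner_self_eq_norm_sq, conj_trivial]
      field_simp
    rw [ι_mul_self, h, one_smul]
  refine ⟨⟨ι Q₃ (‖α‖⁻¹ • α) * ι Q₃ (‖β‖⁻¹ • β), ι Q₃ (‖β‖⁻¹ • β) * ι Q₃ (‖α‖⁻¹ • α), ?_, ?_⟩,
    Subgroup.subset_closure ⟨_, ⟨α, hα, rfl⟩, _, ⟨β, hβ, rfl⟩, rfl⟩, rfl⟩
  · rw [mul_assoc, ← mul_assoc (ι Q₃ (‖β‖⁻¹ • β)), hu hβ0, one_mul, hu hα0]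
  · rw [mul_assoc, ← mul_assoc (ι Q₃ (‖α‖⁻¹ • α)), hu hα0, one_mul, hu hβ0]

/-- -1 is the product of a unit root and its opposite. -/
theorem neg_one_mem_spinorGroup (hΦ : IsRootSystem Φ) (hne : Φ.Nonempty) :
    (-1 : Cl₃ˣ) ∈ spinorGroup Φ := by
  obtain ⟨α, hα⟩ := hne
  have h0 := hΦ.ne_zero hα
  obtain ⟨R, hR, h⟩ := exists_mem_spinorGroup hα (hΦ.neg_mem hα) h0 (neg_ne_zero.mpr h0)
  convert hR
  ext
  have : ‖α‖ ≠ 0 := norm_ne_zero_iff.mpr h0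
  have h1 : ⟪‖α‖⁻¹ • α, ‖α‖⁻¹ • α⟫ = 1 := by
    rw [inner_smul_left, inner_smul_right, real_inner_self_eq_norm_sq, conj_trivial]
    field_simp
  rw [h, norm_neg, smul_neg, map_neg, mul_neg, ι_mul_self, h1, one_smul]
  simp

/-- The reflection is -a x̃ a, and x̃ is the group inverse of the unit spinor x. -/
theorem refl_mem_induced (hΦ : IsRootSystem Φ) (hne : Φ.Nonempty)
    {a x : EuclideanSpace ℝ (Fin 4)} (ha : a ∈ induced Φ) (hx : x ∈ induced Φ) (ha1 : ‖a‖ = 1)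
    (hx1 : ‖x‖ = 1) : refl a x ∈ induced Φ := by
  obtain ⟨R, hR, hRa⟩ := ha
  obtain ⟨R', hR', hRx⟩ := hx
  refine ⟨-1 * (R * R'⁻¹ * R), mul_mem (neg_one_mem_spinorGroup hΦ hne)
    (mul_mem (mul_mem hR (inv_mem hR')) hR), ?_⟩
  have hinv : ((R'⁻¹ : Cl₃ˣ) : Cl₃) = CliffordAlgebra.reverse (spinorOf x) := by
    rw [Units.inv_eq_of_mul_eq_one_right (a := CliffordAlgebra.reverse (spinorOf x))]
    rw [hRx, spinorOf_mul_reverse hx1]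
  rw [spinorOf_refl ha1]
  simp [hinv, hRa]

variable {K : Type*} [CommRing K] {ev : K →+* ℝ}

/-- The coordinates of a word in the spinors `a₀a₁` and `a₁a₂`. -/
def wordCoords (S T : K) (w : List Bool) : Fin 4 → K :=
  w.foldr (fun b x => if b then leftMul₀₁ S *ᵥ x else leftMul₁₂ S T *ᵥ x) (Pi.single 0 1)

/-- The combinatorial data that identify the spinors generated by `a₀a₁` and `a₁a₂` as the root system
with the positive roots `L`: the simple roots are the words `w i`, with the coordinate
vectors `D i`, and `P` and `Q` are the matrices of the left multiplications by `a₀a₁` and `a₁a₂` with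
respect to the simple roots. -/
structure IsSpinorData (S T : K) (G : Matrix (Fin 4) (Fin 4) K) (L : List (Fin 4 → K))
    (w : Fin 4 → List Bool) (D P Q : Matrix (Fin 4) (Fin 4) K) : Prop where
  word : (of fun i => wordCoords S T (w i)) = D
  gram : D * gramFrame S T * Dᵀ = G
  mul₀₁ : leftMul₀₁ S * Dᵀ = Dᵀ * P
  mul₁₂ : leftMul₁₂ S T * Dᵀ = Dᵀ * Q
  mem₀₁ : ∀ c ∈ L, P *ᵥ c ∈ L ∨ -(P *ᵥ c) ∈ L
  mem₁₂ : ∀ c ∈ L, Q *ᵥ c ∈ L ∨ -(Q *ᵥ c) ∈ L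
  one : ∃ i, w i = []

/-- The tabulated root system contains 1 and is stable under the group, so it contains the group.
The group contains the simple roots and is closed under their reflections, so it contains the root
system. -/
theorem hasType_induced {N : CoxeterMatrix (Fin 3)} {M : CoxeterMatrix (Fin 4)}
    (hΦ : HasType Φ N) (hN : N 0 2 = 2) {S T : K} (hS : ev S = -2 * Real.cos (Real.pi / N 0 1))
    (hT : ev T = -2 * Real.cos (Real.pi / N 1 2)) {G : Matrix (Fin 4) (Fin 4) K}
    (hG : ∀ i j, ev (G i j) = -2 * Real.cos (Real.pi / M i j))
    {B : Matrix (Fin 4) (Fin 4) K} {d : K} (hB : B * G = diagonal fun _ => d) (hd : ev d ≠ 0)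
    {L : List (Fin 4 → K)} (hL : IsPositiveRootList ev G L) {w : Fin 4 → List Bool}
    {D P Q : Matrix (Fin 4) (Fin 4) K} (h : IsSpinorData S T G L w D P Q) :
    HasType (induced Φ) M := by
  have hw (i : Fin 4) : wordCoords S T (w i) = D i := congrFun h.word i
  have hDG (i j : Fin 4) : D i ⬝ᵥ gramFrame S T *ᵥ D j = G i j := by
    rw [← h.gram, Matrix.mul_assoc]
    rfl
  obtain ⟨hΦ, Δ, hΔ, hΔN⟩ := hΦ
  obtain ⟨a, ha⟩ : ∃ a : Fin 3 → EuclideanSpace ℝ (Fin 3), ∀ i, a i = ‖Δ i‖⁻¹ • Δ i :=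
    ⟨_, fun _ => rfl⟩
  have hainner (i j : Fin 3) : ⟪a i, a j⟫ = -Real.cos (Real.pi / N i j) := by
    have hi : ‖Δ i‖ ≠ 0 := norm_ne_zero_iff.mpr (Δ.ne_zero i)
    have hj : ‖Δ j‖ ≠ 0 := norm_ne_zero_iff.mpr (Δ.ne_zero j)
    rw [ha, ha, inner_smul_left, inner_smul_right, hΔN, conj_trivial]
    field_simp
  have hpath : IsUnitPath ev a S T := by
    refine ⟨fun i => ?_, ?_, ?_, ?_⟩
    · rw [hainner, N.diagonal, Nat.cast_one, div_one, Real.cos_pi, neg_neg]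
    · rw [hS, hainner]; ring
    · rw [hT, hainner]; ring
    · simp [hainner, hN]
  obtain ⟨b, hb⟩ : ∃ b : Fin 4 → EuclideanSpace ℝ (Fin 4),
      b = fun i => comb ev (spinorFrame a) (D i) := ⟨_, rfl⟩
  have hbinner (i j : Fin 4) : ⟪b i, b j⟫ = -Real.cos (Real.pi / M i j) := by
    have := two_mul_inner_comb hpath.gram (D i) (D j)
    rw [hDG, hG] at this
    rw [hb]
    dsimp only
    linarith
  obtain ⟨Δ', hΔ'b, hΔ', hU⟩ := hasType_rootsOf (by simp) hbinner hG hB hd hL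
  have hbcomb (c : Fin 4 → K) : comb ev b c = comb ev (spinorFrame a) (Dᵀ *ᵥ c) := by
    rw [hb, ← comb_comp]
    rfl
  have hbunit (i : Fin 4) : ‖b i‖ = 1 := by
    have := hbinner i i
    rw [M.diagonal, real_inner_self_eq_norm_sq, Nat.cast_one, div_one, Real.cos_pi, neg_neg] at this
    have h2 := norm_nonneg (b i)
    nlinarith
  have hone : comb ev (spinorFrame a) (wordCoords S T []) = !₂[1, 0, 0, 0] := by
    simp [wordCoords, comb_single, spinorFrame]
  -- the spinor group is contained in the root system
  have hsub : induced Φ ⊆ rootsOf ev b L := by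
    rintro x ⟨R, hR, hRx⟩
    -- `P` and `Q` describe the two left multiplications in the basis `b`; stability of the list up
    -- to sign becomes stability of the set of spinors.
    have hmul (p : Cl₃) (A : Matrix (Fin 4) (Fin 4) K)
        (hA : ∀ c ∈ L, p * spinorOf (comb ev b c) = spinorOf (comb ev b (A *ᵥ c)))
        (hAL : ∀ c ∈ L, A *ᵥ c ∈ L ∨ -(A *ᵥ c) ∈ L) :
        ∀ y ∈ spinorOf '' rootsOf ev b L, p * y ∈ spinorOf '' rootsOf ev b L := by
      have hmem (c : Fin 4 → K) (hc : c ∈ L) : comb ev b (A *ᵥ c) ∈ rootsOf ev b L := by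
        rcases hAL c hc with h | h
        · exact ⟨_, h, Or.inl rfl⟩
        · exact ⟨_, h, Or.inr (by rw [comb_neg, neg_neg])⟩
      rintro _ ⟨_, ⟨c, hc, rfl | rfl⟩, rfl⟩
      · exact ⟨_, hmem c hc, (hA c hc).symm⟩
      · exact ⟨_, neg_mem_rootsOf (hmem c hc), by rw [map_neg, map_neg, mul_neg, hA c hc]⟩
    have h1 : (1 : Cl₃) ∈ spinorOf '' rootsOf ev b L := by
      obtain ⟨i, hi⟩ := h.one
      refine ⟨b i, ⟨_, hL.simple i, Or.inl ?_⟩, ?_⟩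
      · rw [comb_single, map_one, one_smul]
      · rw [hb]
        dsimp only
        rw [← hw, hi, hone, spinorOf_one]
    have := spinorGroup_mul_mem hΦ hΔ ha ((rootsOf_finite b L).image spinorOf)
      (by
        rintro _ ⟨y, hy, rfl⟩
        exact ⟨-y, neg_mem_rootsOf hy, map_neg _ _⟩)
      (hmul _ P (fun c _ => by rw [hbcomb, hpath.mul₀₁_comb, mulVec_mulVec, h.mul₀₁, hbcomb,
        mulVec_mulVec]) h.mem₀₁)
      (hmul _ Q (fun c _ => by rw [hbcomb, hpath.mul₁₂_comb, mulVec_mulVec, h.mul₁₂, hbcomb,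
        mulVec_mulVec]) h.mem₁₂) hR 1 h1
    rw [mul_one, hRx] at this
    obtain ⟨y, hy, hyx⟩ := this
    exact spinorOf_injective hyx ▸ hy
  have hnorm : ∀ x ∈ rootsOf ev b L, ‖x‖ = 1 := by
    refine hU.1.orbit_induction hΔ' (fun i => ?_) fun i x hx => ?_
    · rw [hΔ'b, hbunit]
    · rw [norm_refl, hx]
  -- the simple roots belong to the spinor group
  have hword (u : List Bool) : comb ev (spinorFrame a) (wordCoords S T u) ∈ induced Φ := by
    induction u with
    | nil => exact ⟨1, one_mem _, by rw [hone, spinorOf_one, Units.val_one]⟩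
    | cons t u ih =>
      obtain ⟨R, hR, hRu⟩ := ih
      cases t with
      | true =>
        obtain ⟨R', hR', h'⟩ := exists_mem_spinorGroup (hΔ.1 0) (hΔ.1 1) (Δ.ne_zero 0) (Δ.ne_zero 1)
        refine ⟨R' * R, mul_mem hR' hR, ?_⟩
        rw [Units.val_mul, hRu, h', ← ha, ← ha, hpath.mul₀₁_comb]
        rfl
      | false =>
        obtain ⟨R', hR', h'⟩ := exists_mem_spinorGroup (hΔ.1 1) (hΔ.1 2) (Δ.ne_zero 1) (Δ.ne_zero 2)
        refine ⟨R' * R, mul_mem hR' hR, ?_⟩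
        rw [Units.val_mul, hRu, h', ← ha, ← ha, hpath.mul₁₂_comb]
        rfl
  have hbmem (i : Fin 4) : b i ∈ induced Φ := by
    rw [hb]
    dsimp only
    rw [← hw]
    exact hword _
  have hsup : rootsOf ev b L ⊆ induced Φ := by
    refine hU.1.orbit_induction hΔ' (fun i => hΔ'b ▸ hbmem i) fun i x hx => ?_
    rw [hΔ'b]
    -- The unit length of x comes from the first inclusion.
    exact refl_mem_induced hΦ ⟨_, hΔ.1 0⟩ (hbmem i) hx (hbunit i) (hnorm x (hsub hx))
  rw [hsub.antisymm hsup]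
  exact hU

end Induced

/-! ### Explicit roots and spinor data for each type. -/

section Tables

/-- The labels of a diagram as a plain function, for decision procedures. -/
def label {ι : Type*} (M : CoxeterMatrix ι) (i j : ι) : ℕ := M i j

/-- Two plane vectors at 120° are fixed and the third is solved for; its last coordinate is real
because of the bound 3/4. -/
theorem exists_vectors_of_path {N : CoxeterMatrix (Fin 3)} (h₀₁ : N 0 1 = 3) (h₀₂ : N 0 2 = 2)
    (h₁₂ : Real.cos (Real.pi / N 1 2) ^ 2 ≤ 3 / 4) :
    ∃ b : Fin 3 → EuclideanSpace ℝ (Fin 3), ∀ i j, ⟪b i, b j⟫ = -Real.cos (Real.pi / N i j) := by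
  obtain ⟨t, ht⟩ : ∃ t, t = Real.cos (Real.pi / N 1 2) := ⟨_, rfl⟩
  rw [← ht] at h₁₂
  have h3 : √3 ^ 2 = 3 := Real.sq_sqrt (by norm_num)
  have h33 : √3 * (√3)⁻¹ = 1 := mul_inv_cancel₀ (by positivity)
  have hs : √(1 - 4 / 3 * t ^ 2) ^ 2 = 1 - 4 / 3 * t ^ 2 := Real.sq_sqrt (by linarith)
  have hinv : (√3)⁻¹ ^ 2 = 1 / 3 := by rw [inv_pow, h3]; norm_num
  refine ⟨![!₂[√3 / 2, -1 / 2, 0], !₂[0, 1, 0], !₂[-t * (√3)⁻¹, -t, √(1 - 4 / 3 * t ^ 2)]],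
    fun i j => ?_⟩
  fin_cases i <;> fin_cases j <;>
    simp [-inner_self_eq_norm_sq_to_K, PiLp.inner_apply, Fin.sum_univ_three, h₀₁, h₀₂,
      N.symmetric 1 0, N.symmetric 2 0, N.symmetric 2 1, ← ht]
  · linear_combination h3 / 4
  all_goals first
    | linear_combination -t / 2 * h33
    | linear_combination
    | linear_combination hs + t ^ 2 * hinv

theorem cos_sq_three : Real.cos (Real.pi / (CoxeterMatrix.A 3) 1 2) ^ 2 ≤ 3 / 4 := by
  rw [show (CoxeterMatrix.A 3) 1 2 = 3 by decide]
  norm_num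

theorem cos_sq_four : Real.cos (Real.pi / (CoxeterMatrix.B 3) 1 2) ^ 2 ≤ 3 / 4 := by
  rw [show (CoxeterMatrix.B 3) 1 2 = 4 by decide, Nat.cast_ofNat, Real.cos_pi_div_four, div_pow,
    Real.sq_sqrt (by norm_num)]
  norm_num

theorem cos_sq_five : Real.cos (Real.pi / CoxeterMatrix.H₃ 1 2) ^ 2 ≤ 3 / 4 := by
  rw [show CoxeterMatrix.H₃ 1 2 = 5 by decide, Nat.cast_ofNat, Real.cos_pi_div_five]
  have h5 : √5 ^ 2 = 5 := Real.sq_sqrt (by norm_num)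
  have : √5 ≤ 3 := Real.sqrt_le_iff.mpr (by norm_num)
  nlinarith

/-- The positive roots of type `A₃` in terms of the simple roots. -/
def rootsA₃ : List (Fin 3 → ℤ) := [
  ![1, 0, 0], ![0, 1, 0], ![0, 0, 1], ![1, 1, 0], ![0, 1, 1], ![1, 1, 1]]

theorem isPositiveRootList_A₃ :
    IsPositiveRootList (Int.castRingHom ℝ) ((CoxeterMatrix.A 3).M.map gramInt) rootsA₃ := by
  have h : ∀ c ∈ rootsA₃, ∀ i, 0 ≤ c i := by decide +kernel
  exact ⟨by decide +kernel, fun c hc i => Int.cast_nonneg (h c hc i), by decide +kernel,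
    by decide +kernel⟩

theorem exists_hasType_A₃ :
    ∃ Φ : Set (EuclideanSpace ℝ (Fin 3)), HasType Φ (CoxeterMatrix.A 3) := by
  obtain ⟨b, hb⟩ :=
    exists_vectors_of_path (N := CoxeterMatrix.A 3) (by decide) (by decide) cos_sq_three
  obtain ⟨-, -, -, h⟩ := hasType_rootsOf (by simp) hb
    (fun i j => gramInt_eq
      ((by decide : ∀ i j, label (CoxeterMatrix.A 3) i j ∈ [1, 2, 3]) i j))
    (B := !![3, 2, 1;
    2, 4, 2;
    1, 2, 3])
    (d := 4) (by decide +kernel) (by rw [map_ofNat]; norm_num)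
    isPositiveRootList_A₃
  exact ⟨_, h⟩

/-- The positive roots of type `B₃` in terms of the simple roots. -/
def rootsB₃ : List (Fin 3 → QuadraticAlgebra ℤ 2 0) := [
  ![⟨1, 0⟩, ⟨0, 0⟩, ⟨0, 0⟩], ![⟨0, 0⟩, ⟨1, 0⟩, ⟨0, 0⟩], ![⟨0, 0⟩, ⟨0, 0⟩, ⟨1, 0⟩],
  ![⟨1, 0⟩, ⟨1, 0⟩, ⟨0, 0⟩], ![⟨0, 0⟩, ⟨1, 0⟩, ⟨0, 1⟩], ![⟨0, 0⟩, ⟨0, 1⟩, ⟨1, 0⟩],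
  ![⟨1, 0⟩, ⟨1, 0⟩, ⟨0, 1⟩], ![⟨0, 1⟩, ⟨0, 1⟩, ⟨1, 0⟩], ![⟨1, 0⟩, ⟨2, 0⟩, ⟨0, 1⟩]]

theorem isPositiveRootList_B₃ :
    IsPositiveRootList evSqrtTwo ((CoxeterMatrix.B 3).M.map gramSqrtTwo) rootsB₃ := by
  have h : ∀ c ∈ rootsB₃, ∀ i, 0 ≤ (c i).re ∧ 0 ≤ (c i).im := by decide +kernel
  exact ⟨by decide +kernel, fun c hc i => evSqrtTwo_nonneg (h c hc i), by decide +kernel,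
    by decide +kernel⟩

theorem exists_hasType_B₃ :
    ∃ Φ : Set (EuclideanSpace ℝ (Fin 3)), HasType Φ (CoxeterMatrix.B 3) := by
  obtain ⟨b, hb⟩ :=
    exists_vectors_of_path (N := CoxeterMatrix.B 3) (by decide) (by decide) cos_sq_four
  obtain ⟨-, -, -, h⟩ := hasType_rootsOf (by simp) hb
    (fun i j => gramSqrtTwo_eq
      ((by decide : ∀ i j, label (CoxeterMatrix.B 3) i j ∈ [1, 2, 3, 4]) i j))
    (B := !![⟨2, 0⟩, ⟨2, 0⟩, ⟨0, 1⟩;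
    ⟨2, 0⟩, ⟨4, 0⟩, ⟨0, 2⟩;
    ⟨0, 1⟩, ⟨0, 2⟩, ⟨3, 0⟩])
    (d := 2) (by decide +kernel) (by rw [map_ofNat]; norm_num)
    isPositiveRootList_B₃
  exact ⟨_, h⟩

/-- The positive roots of type `H₃` in terms of the simple roots. -/
def rootsH₃ : List (Fin 3 → QuadraticAlgebra ℤ 1 1) := [
  ![⟨1, 0⟩, ⟨0, 0⟩, ⟨0, 0⟩], ![⟨0, 0⟩, ⟨1, 0⟩, ⟨0, 0⟩], ![⟨0, 0⟩, ⟨0, 0⟩, ⟨1, 0⟩],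
  ![⟨1, 0⟩, ⟨1, 0⟩, ⟨0, 0⟩], ![⟨0, 0⟩, ⟨1, 0⟩, ⟨0, 1⟩], ![⟨0, 0⟩, ⟨0, 1⟩, ⟨1, 0⟩],
  ![⟨1, 0⟩, ⟨1, 0⟩, ⟨0, 1⟩], ![⟨0, 0⟩, ⟨0, 1⟩, ⟨0, 1⟩], ![⟨0, 1⟩, ⟨0, 1⟩, ⟨1, 0⟩],
  ![⟨1, 0⟩, ⟨1, 1⟩, ⟨0, 1⟩], ![⟨0, 1⟩, ⟨0, 1⟩, ⟨0, 1⟩], ![⟨0, 1⟩, ⟨1, 1⟩, ⟨0, 1⟩],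
  ![⟨1, 0⟩, ⟨1, 1⟩, ⟨1, 1⟩], ![⟨0, 1⟩, ⟨1, 1⟩, ⟨1, 1⟩], ![⟨0, 1⟩, ⟨0, 2⟩, ⟨1, 1⟩]]

theorem isPositiveRootList_H₃ :
    IsPositiveRootList evGolden (CoxeterMatrix.H₃.M.map gramGolden) rootsH₃ := by
  have h : ∀ c ∈ rootsH₃, ∀ i, 0 ≤ (c i).re ∧ 0 ≤ (c i).im := by decide +kernel
  exact ⟨by decide +kernel, fun c hc i => evGolden_nonneg (h c hc i), by decide +kernel,
    by decide +kernel⟩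

theorem exists_hasType_H₃ :
    ∃ Φ : Set (EuclideanSpace ℝ (Fin 3)), HasType Φ CoxeterMatrix.H₃ := by
  obtain ⟨b, hb⟩ :=
    exists_vectors_of_path (N := CoxeterMatrix.H₃) (by decide) (by decide) cos_sq_five
  obtain ⟨-, -, -, h⟩ := hasType_rootsOf (by simp) hb
    (fun i j => gramGolden_eq
      ((by decide : ∀ i j, label CoxeterMatrix.H₃ i j ∈ [1, 2, 3, 5]) i j))
    (B := !![⟨2, 1⟩, ⟨2, 2⟩, ⟨1, 2⟩;
    ⟨2, 2⟩, ⟨4, 4⟩, ⟨2, 4⟩;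
    ⟨1, 2⟩, ⟨2, 4⟩, ⟨3, 3⟩])
    (d := 2) (by decide +kernel) (by rw [map_ofNat]; norm_num)
    isPositiveRootList_H₃
  exact ⟨_, h⟩

/-- The positive roots of type `A₁pow` in terms of the simple roots. -/
def rootsA₁pow : List (Fin 4 → ℤ) := [
  ![1, 0, 0, 0], ![0, 1, 0, 0], ![0, 0, 1, 0], ![0, 0, 0, 1]]

theorem isPositiveRootList_A₁pow :
    IsPositiveRootList (Int.castRingHom ℝ) ((A₁pow 4).M.map gramInt) rootsA₁pow := by
  have h : ∀ c ∈ rootsA₁pow, ∀ i, 0 ≤ c i := by decide +kernel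
  exact ⟨by decide +kernel, fun c hc i => Int.cast_nonneg (h c hc i), by decide +kernel,
    by decide +kernel⟩

/-- The spinors a₀a₁ and a₁a₂ square to -1 and anticommute, giving the quaternion units. -/
theorem isSpinorData_A₁pow :
    IsSpinorData (gramInt 2) (gramInt 2) ((A₁pow 4).M.map gramInt) rootsA₁pow
      ![[], [true], [false], [false, true]]
      !![1, 0, 0, 0;
    0, 1, 0, 0;
    0, 0, 1, 0;
    0, 0, 0, -1]
      !![0, -1, 0, 0;
    1, 0, 0, 0;
    0, 0, 0, 1;
    0, 0, -1, 0]
      !![0, 0, -1, 0;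
    0, 0, 0, -1;
    1, 0, 0, 0;
    0, 1, 0, 0] := by
  constructor <;> decide +kernel

theorem hasType_induced_A₁pow {Φ : Set (EuclideanSpace ℝ (Fin 3))}
    (h : HasType Φ (A₁pow 3)) :
    HasType (induced Φ) (A₁pow 4) :=
  hasType_induced h (by decide) (gramInt_eq (m := (A₁pow 3) 0 1) (by decide))
    (gramInt_eq (m := (A₁pow 3) 1 2) (by decide))
    (fun i j => gramInt_eq
      ((by decide : ∀ i j, label (A₁pow 4) i j ∈ [1, 2, 3]) i j))
    (B := !![1, 0, 0, 0;
    0, 1, 0, 0;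
    0, 0, 1, 0;
    0, 0, 0, 1])
    (d := 2) (by decide +kernel) (by rw [map_ofNat]; norm_num)
    isPositiveRootList_A₁pow isSpinorData_A₁pow

/-- The positive roots of type `D₄` in terms of the simple roots. -/
def rootsD₄ : List (Fin 4 → ℤ) := [
  ![1, 0, 0, 0], ![0, 1, 0, 0], ![0, 0, 1, 0], ![0, 0, 0, 1], ![1, 1, 0, 0], ![0, 1, 1, 0],
  ![0, 1, 0, 1], ![1, 1, 1, 0], ![1, 1, 0, 1], ![0, 1, 1, 1], ![1, 1, 1, 1], ![1, 2, 1, 1]]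

theorem isPositiveRootList_D₄ :
    IsPositiveRootList (Int.castRingHom ℝ) (D₄.M.map gramInt) rootsD₄ := by
  have h : ∀ c ∈ rootsD₄, ∀ i, 0 ≤ c i := by decide +kernel
  exact ⟨by decide +kernel, fun c hc i => Int.cast_nonneg (h c hc i), by decide +kernel,
    by decide +kernel⟩

/-- The central node is a₀a₁; the leaves are 1 and the products of a₀a₁ and a₁a₂ in both orders. -/
theorem isSpinorData_D₄ :
    IsSpinorData (gramInt 3) (gramInt 3) (D₄.M.map gramInt) rootsD₄
      ![[], [true], [false, true], [true, false]]
      !![1, 0, 0, 0;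
    0, 1, 0, 0;
    -1, -1, -1, -1;
    0, 0, 0, 1]
      !![0, -1, 0, 1;
    1, -1, -1, 1;
    0, 0, -1, 1;
    0, 0, -1, 0]
      !![-1, 0, 0, 1;
    -1, 0, -1, 1;
    -1, 1, -1, 0;
    -1, 0, 0, 0] := by
  constructor <;> decide +kernel

theorem hasType_induced_D₄ {Φ : Set (EuclideanSpace ℝ (Fin 3))}
    (h : HasType Φ (CoxeterMatrix.A 3)) :
    HasType (induced Φ) D₄ :=
  hasType_induced h (by decide) (gramInt_eq (m := (CoxeterMatrix.A 3) 0 1) (by decide))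
    (gramInt_eq (m := (CoxeterMatrix.A 3) 1 2) (by decide))
    (fun i j => gramInt_eq
      ((by decide : ∀ i j, label D₄ i j ∈ [1, 2, 3]) i j))
    (B := !![2, 2, 1, 1;
    2, 4, 2, 2;
    1, 2, 2, 1;
    1, 2, 1, 2])
    (d := 2) (by decide +kernel) (by rw [map_ofNat]; norm_num)
    isPositiveRootList_D₄ isSpinorData_D₄

/-- The positive roots of type `F₄` in terms of the simple roots. -/
def rootsF₄ : List (Fin 4 → QuadraticAlgebra ℤ 2 0) := [
  ![⟨1, 0⟩, ⟨0, 0⟩, ⟨0, 0⟩, ⟨0, 0⟩], ![⟨0, 0⟩, ⟨1, 0⟩, ⟨0, 0⟩, ⟨0, 0⟩],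
  ![⟨0, 0⟩, ⟨0, 0⟩, ⟨1, 0⟩, ⟨0, 0⟩], ![⟨0, 0⟩, ⟨0, 0⟩, ⟨0, 0⟩, ⟨1, 0⟩],
  ![⟨1, 0⟩, ⟨1, 0⟩, ⟨0, 0⟩, ⟨0, 0⟩], ![⟨0, 0⟩, ⟨1, 0⟩, ⟨0, 1⟩, ⟨0, 0⟩],
  ![⟨0, 0⟩, ⟨0, 1⟩, ⟨1, 0⟩, ⟨0, 0⟩], ![⟨0, 0⟩, ⟨0, 0⟩, ⟨1, 0⟩, ⟨1, 0⟩],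
  ![⟨1, 0⟩, ⟨1, 0⟩, ⟨0, 1⟩, ⟨0, 0⟩], ![⟨0, 0⟩, ⟨1, 0⟩, ⟨0, 1⟩, ⟨0, 1⟩],
  ![⟨0, 1⟩, ⟨0, 1⟩, ⟨1, 0⟩, ⟨0, 0⟩], ![⟨0, 0⟩, ⟨0, 1⟩, ⟨1, 0⟩, ⟨1, 0⟩],
  ![⟨1, 0⟩, ⟨2, 0⟩, ⟨0, 1⟩, ⟨0, 0⟩], ![⟨1, 0⟩, ⟨1, 0⟩, ⟨0, 1⟩, ⟨0, 1⟩],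
  ![⟨0, 1⟩, ⟨0, 1⟩, ⟨1, 0⟩, ⟨1, 0⟩], ![⟨0, 0⟩, ⟨0, 1⟩, ⟨2, 0⟩, ⟨1, 0⟩],
  ![⟨1, 0⟩, ⟨2, 0⟩, ⟨0, 1⟩, ⟨0, 1⟩], ![⟨0, 1⟩, ⟨0, 1⟩, ⟨2, 0⟩, ⟨1, 0⟩],
  ![⟨1, 0⟩, ⟨2, 0⟩, ⟨0, 2⟩, ⟨0, 1⟩], ![⟨0, 1⟩, ⟨0, 2⟩, ⟨2, 0⟩, ⟨1, 0⟩],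
  ![⟨1, 0⟩, ⟨3, 0⟩, ⟨0, 2⟩, ⟨0, 1⟩], ![⟨0, 1⟩, ⟨0, 2⟩, ⟨3, 0⟩, ⟨1, 0⟩],
  ![⟨2, 0⟩, ⟨3, 0⟩, ⟨0, 2⟩, ⟨0, 1⟩], ![⟨0, 1⟩, ⟨0, 2⟩, ⟨3, 0⟩, ⟨2, 0⟩]]

theorem isPositiveRootList_F₄ :
    IsPositiveRootList evSqrtTwo (CoxeterMatrix.F₄.M.map gramSqrtTwo) rootsF₄ := by
  have h : ∀ c ∈ rootsF₄, ∀ i, 0 ≤ (c i).re ∧ 0 ≤ (c i).im := by decide +kernel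
  exact ⟨by decide +kernel, fun c hc i => evSqrtTwo_nonneg (h c hc i), by decide +kernel,
    by decide +kernel⟩

/-- The spinors a₁a₂ and 1 carry the fourfold link, since their doubled inner product is -√2. -/
theorem isSpinorData_F₄ :
    IsSpinorData (gramSqrtTwo 3) (gramSqrtTwo 4) (CoxeterMatrix.F₄.M.map gramSqrtTwo) rootsF₄
      ![[false, true], [false], [], [true, false, false, true]]
      !![⟨0, -1⟩, ⟨0, -1⟩, ⟨-1, 0⟩, ⟨-1, 0⟩;
    ⟨0, 0⟩, ⟨0, 0⟩, ⟨1, 0⟩, ⟨0, 0⟩;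
    ⟨1, 0⟩, ⟨0, 0⟩, ⟨0, 0⟩, ⟨0, 0⟩;
    ⟨-1, 0⟩, ⟨1, 0⟩, ⟨0, -1⟩, ⟨0, 0⟩]
      !![⟨0, 0⟩, ⟨-1, 0⟩, ⟨0, 0⟩, ⟨0, 1⟩;
    ⟨1, 0⟩, ⟨-3, 0⟩, ⟨0, 1⟩, ⟨0, 1⟩;
    ⟨0, 1⟩, ⟨0, -2⟩, ⟨1, 0⟩, ⟨1, 0⟩;
    ⟨0, 0⟩, ⟨0, -1⟩, ⟨1, 0⟩, ⟨0, 0⟩]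
      !![⟨0, -1⟩, ⟨0, 0⟩, ⟨0, 0⟩, ⟨1, 0⟩;
    ⟨0, -1⟩, ⟨0, -1⟩, ⟨1, 0⟩, ⟨1, 0⟩;
    ⟨-1, 0⟩, ⟨-1, 0⟩, ⟨0, 0⟩, ⟨0, 1⟩;
    ⟨-1, 0⟩, ⟨0, 0⟩, ⟨0, 0⟩, ⟨0, 0⟩] := by
  constructor <;> decide +kernel

theorem hasType_induced_F₄ {Φ : Set (EuclideanSpace ℝ (Fin 3))}
    (h : HasType Φ (CoxeterMatrix.B 3)) :
    HasType (induced Φ) CoxeterMatrix.F₄ :=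
  hasType_induced h (by decide) (gramSqrtTwo_eq (m := (CoxeterMatrix.B 3) 0 1) (by decide))
    (gramSqrtTwo_eq (m := (CoxeterMatrix.B 3) 1 2) (by decide))
    (fun i j => gramSqrtTwo_eq
      ((by decide : ∀ i j, label CoxeterMatrix.F₄ i j ∈ [1, 2, 3, 4]) i j))
    (B := !![⟨2, 0⟩, ⟨3, 0⟩, ⟨0, 2⟩, ⟨0, 1⟩;
    ⟨3, 0⟩, ⟨6, 0⟩, ⟨0, 4⟩, ⟨0, 2⟩;
    ⟨0, 2⟩, ⟨0, 4⟩, ⟨6, 0⟩, ⟨3, 0⟩;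
    ⟨0, 1⟩, ⟨0, 2⟩, ⟨3, 0⟩, ⟨2, 0⟩])
    (d := 1) (by decide +kernel) (by simp)
    isPositiveRootList_F₄ isSpinorData_F₄

/-- The positive roots of type `H₄` in terms of the simple roots. -/
def rootsH₄ : List (Fin 4 → QuadraticAlgebra ℤ 1 1) := [
  ![⟨1, 0⟩, ⟨0, 0⟩, ⟨0, 0⟩, ⟨0, 0⟩], ![⟨0, 0⟩, ⟨1, 0⟩, ⟨0, 0⟩, ⟨0, 0⟩],
  ![⟨0, 0⟩, ⟨0, 0⟩, ⟨1, 0⟩, ⟨0, 0⟩], ![⟨0, 0⟩, ⟨0, 0⟩, ⟨0, 0⟩, ⟨1, 0⟩],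
  ![⟨1, 0⟩, ⟨1, 0⟩, ⟨0, 0⟩, ⟨0, 0⟩], ![⟨0, 0⟩, ⟨1, 0⟩, ⟨1, 0⟩, ⟨0, 0⟩],
  ![⟨0, 0⟩, ⟨0, 0⟩, ⟨1, 0⟩, ⟨0, 1⟩], ![⟨0, 0⟩, ⟨0, 0⟩, ⟨0, 1⟩, ⟨1, 0⟩],
  ![⟨1, 0⟩, ⟨1, 0⟩, ⟨1, 0⟩, ⟨0, 0⟩], ![⟨0, 0⟩, ⟨1, 0⟩, ⟨1, 0⟩, ⟨0, 1⟩],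
  ![⟨0, 0⟩, ⟨0, 0⟩, ⟨0, 1⟩, ⟨0, 1⟩], ![⟨0, 0⟩, ⟨0, 1⟩, ⟨0, 1⟩, ⟨1, 0⟩],
  ![⟨1, 0⟩, ⟨1, 0⟩, ⟨1, 0⟩, ⟨0, 1⟩], ![⟨0, 0⟩, ⟨1, 0⟩, ⟨1, 1⟩, ⟨0, 1⟩],
  ![⟨0, 0⟩, ⟨0, 1⟩, ⟨0, 1⟩, ⟨0, 1⟩], ![⟨0, 1⟩, ⟨0, 1⟩, ⟨0, 1⟩, ⟨1, 0⟩],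
  ![⟨1, 0⟩, ⟨1, 0⟩, ⟨1, 1⟩, ⟨0, 1⟩], ![⟨0, 0⟩, ⟨0, 1⟩, ⟨1, 1⟩, ⟨0, 1⟩],
  ![⟨0, 0⟩, ⟨1, 0⟩, ⟨1, 1⟩, ⟨1, 1⟩], ![⟨0, 1⟩, ⟨0, 1⟩, ⟨0, 1⟩, ⟨0, 1⟩],
  ![⟨1, 0⟩, ⟨1, 1⟩, ⟨1, 1⟩, ⟨0, 1⟩], ![⟨1, 0⟩, ⟨1, 0⟩, ⟨1, 1⟩, ⟨1, 1⟩],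
  ![⟨0, 1⟩, ⟨0, 1⟩, ⟨1, 1⟩, ⟨0, 1⟩], ![⟨0, 0⟩, ⟨0, 1⟩, ⟨1, 1⟩, ⟨1, 1⟩],
  ![⟨0, 1⟩, ⟨1, 1⟩, ⟨1, 1⟩, ⟨0, 1⟩], ![⟨1, 0⟩, ⟨1, 1⟩, ⟨1, 1⟩, ⟨1, 1⟩],
  ![⟨0, 1⟩, ⟨0, 1⟩, ⟨1, 1⟩, ⟨1, 1⟩], ![⟨0, 0⟩, ⟨0, 1⟩, ⟨0, 2⟩, ⟨1, 1⟩],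
  ![⟨0, 1⟩, ⟨1, 1⟩, ⟨1, 1⟩, ⟨1, 1⟩], ![⟨1, 0⟩, ⟨1, 1⟩, ⟨1, 2⟩, ⟨1, 1⟩],
  ![⟨0, 1⟩, ⟨0, 1⟩, ⟨0, 2⟩, ⟨1, 1⟩], ![⟨0, 1⟩, ⟨1, 1⟩, ⟨1, 2⟩, ⟨1, 1⟩],
  ![⟨1, 0⟩, ⟨1, 1⟩, ⟨1, 2⟩, ⟨1, 2⟩], ![⟨0, 1⟩, ⟨0, 2⟩, ⟨0, 2⟩, ⟨1, 1⟩],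
  ![⟨0, 1⟩, ⟨0, 2⟩, ⟨1, 2⟩, ⟨1, 1⟩], ![⟨0, 1⟩, ⟨1, 1⟩, ⟨1, 2⟩, ⟨1, 2⟩],
  ![⟨1, 0⟩, ⟨1, 1⟩, ⟨2, 2⟩, ⟨1, 2⟩], ![⟨0, 1⟩, ⟨0, 2⟩, ⟨1, 2⟩, ⟨1, 2⟩],
  ![⟨0, 1⟩, ⟨1, 1⟩, ⟨2, 2⟩, ⟨1, 2⟩], ![⟨1, 0⟩, ⟨2, 1⟩, ⟨2, 2⟩, ⟨1, 2⟩],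
  ![⟨0, 1⟩, ⟨0, 2⟩, ⟨1, 3⟩, ⟨1, 2⟩], ![⟨0, 1⟩, ⟨1, 2⟩, ⟨2, 2⟩, ⟨1, 2⟩],
  ![⟨1, 1⟩, ⟨2, 1⟩, ⟨2, 2⟩, ⟨1, 2⟩], ![⟨0, 1⟩, ⟨1, 2⟩, ⟨1, 3⟩, ⟨1, 2⟩],
  ![⟨0, 1⟩, ⟨0, 2⟩, ⟨1, 3⟩, ⟨2, 2⟩], ![⟨1, 1⟩, ⟨1, 2⟩, ⟨2, 2⟩, ⟨1, 2⟩],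
  ![⟨1, 1⟩, ⟨1, 2⟩, ⟨1, 3⟩, ⟨1, 2⟩], ![⟨0, 1⟩, ⟨1, 2⟩, ⟨1, 3⟩, ⟨2, 2⟩],
  ![⟨1, 1⟩, ⟨1, 2⟩, ⟨1, 3⟩, ⟨2, 2⟩], ![⟨0, 1⟩, ⟨1, 2⟩, ⟨2, 3⟩, ⟨2, 2⟩],
  ![⟨1, 1⟩, ⟨1, 2⟩, ⟨2, 3⟩, ⟨2, 2⟩], ![⟨0, 1⟩, ⟨1, 2⟩, ⟨2, 3⟩, ⟨1, 3⟩],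
  ![⟨1, 1⟩, ⟨2, 2⟩, ⟨2, 3⟩, ⟨2, 2⟩], ![⟨1, 1⟩, ⟨1, 2⟩, ⟨2, 3⟩, ⟨1, 3⟩],
  ![⟨1, 1⟩, ⟨2, 2⟩, ⟨2, 3⟩, ⟨1, 3⟩], ![⟨1, 1⟩, ⟨2, 2⟩, ⟨3, 3⟩, ⟨1, 3⟩],
  ![⟨1, 1⟩, ⟨2, 2⟩, ⟨3, 3⟩, ⟨2, 3⟩], ![⟨1, 1⟩, ⟨2, 2⟩, ⟨2, 4⟩, ⟨2, 3⟩],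
  ![⟨1, 1⟩, ⟨1, 3⟩, ⟨2, 4⟩, ⟨2, 3⟩], ![⟨0, 2⟩, ⟨1, 3⟩, ⟨2, 4⟩, ⟨2, 3⟩]]

theorem isPositiveRootList_H₄ :
    IsPositiveRootList evGolden (CoxeterMatrix.H₄.M.map gramGolden) rootsH₄ := by
  have h : ∀ c ∈ rootsH₄, ∀ i, 0 ≤ (c i).re ∧ 0 ≤ (c i).im := by decide +kernel
  exact ⟨by decide +kernel, fun c hc i => evGolden_nonneg (h c hc i), by decide +kernel,
    by decide +kernel⟩

/-- The spinor 1 is the end node of the fivefold link; its neighbour a₀a₁(a₁a₂)³ has doubled inner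
product -φ with it. -/
theorem isSpinorData_H₄ :
    IsSpinorData (gramGolden 3) (gramGolden 5) (CoxeterMatrix.H₄.M.map gramGolden) rootsH₄
      ![[false, true], [false, false, false, true, true, false], [true, false, false, false], []]
      !![⟨0, -1⟩, ⟨0, -1⟩, ⟨-1, 0⟩, ⟨-1, 0⟩;
    ⟨0, 0⟩, ⟨0, -1⟩, ⟨1, 0⟩, ⟨0, -1⟩;
    ⟨0, 0⟩, ⟨0, 1⟩, ⟨0, 0⟩, ⟨0, 1⟩;
    ⟨1, 0⟩, ⟨0, 0⟩, ⟨0, 0⟩, ⟨0, 0⟩]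
      !![⟨0, 0⟩, ⟨0, 1⟩, ⟨0, 0⟩, ⟨0, -1⟩;
    ⟨1, 0⟩, ⟨0, 2⟩, ⟨0, -1⟩, ⟨0, -1⟩;
    ⟨1, 0⟩, ⟨1, 3⟩, ⟨-1, -1⟩, ⟨-1, -1⟩;
    ⟨0, 1⟩, ⟨1, 2⟩, ⟨0, -1⟩, ⟨-1, -1⟩]
      !![⟨0, 0⟩, ⟨1, 0⟩, ⟨-1, 0⟩, ⟨0, 0⟩;
    ⟨0, 1⟩, ⟨1, 0⟩, ⟨-1, -1⟩, ⟨1, 0⟩;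
    ⟨1, 1⟩, ⟨1, 1⟩, ⟨-1, -2⟩, ⟨1, 0⟩;
    ⟨1, 1⟩, ⟨0, 1⟩, ⟨-1, -1⟩, ⟨0, 0⟩] := by
  constructor <;> decide +kernel

theorem hasType_induced_H₄ {Φ : Set (EuclideanSpace ℝ (Fin 3))}
    (h : HasType Φ CoxeterMatrix.H₃) :
    HasType (induced Φ) CoxeterMatrix.H₄ :=
  hasType_induced h (by decide) (gramGolden_eq (m := CoxeterMatrix.H₃ 0 1) (by decide))
    (gramGolden_eq (m := CoxeterMatrix.H₃ 1 2) (by decide))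
    (fun i j => gramGolden_eq
      ((by decide : ∀ i j, label CoxeterMatrix.H₄ i j ∈ [1, 2, 3, 5]) i j))
    (B := !![⟨2, 2⟩, ⟨3, 4⟩, ⟨4, 6⟩, ⟨3, 5⟩;
    ⟨3, 4⟩, ⟨6, 8⟩, ⟨8, 12⟩, ⟨6, 10⟩;
    ⟨4, 6⟩, ⟨8, 12⟩, ⟨12, 18⟩, ⟨9, 15⟩;
    ⟨3, 5⟩, ⟨6, 10⟩, ⟨9, 15⟩, ⟨8, 12⟩])
    (d := 1) (by decide +kernel) (by simp)
    isPositiveRootList_H₄ isSpinorData_H₄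

end Tables

/-! ### Connectedness, isomorphism and triality of diagrams. -/

section Diagrams

variable {V : Type*} [NormedAddCommGroup V] [InnerProductSpace ℝ V] {Φ : Set V}

/-- Finite sets of nodes and plain labels make connectedness decidable. -/
theorem HasType.isIrreducible_of_connected {n : ℕ} {M : CoxeterMatrix (Fin (n + 1))}
    (hM : HasType Φ M)
    (h : ∀ S : Finset (Fin (n + 1)), (∀ i ∈ S, ∀ j ∉ S, label M i j = 2) →
      S = ∅ ∨ S = Finset.univ) :
    IsIrreducibleRootSystem Φ := by
  classical
  refine hM.isIrreducible_iff.mpr fun S hS => ?_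
  rw [← Set.coe_toFinset S]
  rw [Finset.coe_eq_empty, Finset.coe_eq_univ]
  exact h _ fun i hi j hj => hS i (Set.mem_toFinset.mp hi) j fun h => hj (Set.mem_toFinset.mpr h)

theorem HasType.isIrreducible_A₃ (h : HasType Φ (CoxeterMatrix.A 3)) : IsIrreducibleRootSystem Φ :=
  h.isIrreducible_of_connected (by decide +kernel)

theorem HasType.isIrreducible_B₃ (h : HasType Φ (CoxeterMatrix.B 3)) : IsIrreducibleRootSystem Φ :=
  h.isIrreducible_of_connected (by decide +kernel)

theorem HasType.isIrreducible_H₃ (h : HasType Φ CoxeterMatrix.H₃) : IsIrreducibleRootSystem Φ :=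
  h.isIrreducible_of_connected (by decide +kernel)

theorem HasType.isIrreducible_D₄ (h : HasType Φ D₄) : IsIrreducibleRootSystem Φ :=
  h.isIrreducible_of_connected (by decide +kernel)

theorem HasType.isIrreducible_F₄ (h : HasType Φ CoxeterMatrix.F₄) : IsIrreducibleRootSystem Φ :=
  h.isIrreducible_of_connected (by decide +kernel)

theorem HasType.isIrreducible_H₄ (h : HasType Φ CoxeterMatrix.H₄) : IsIrreducibleRootSystem Φ :=
  h.isIrreducible_of_connected (by decide +kernel)

/-- Two diagrams are isomorphic. -/
def Isomorphic {n : ℕ} (M N : CoxeterMatrix (Fin n)) : Prop :=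
  ∃ σ : Equiv.Perm (Fin n), ∀ i j, label M i j = label N (σ i) (σ j)

instance {n : ℕ} (M N : CoxeterMatrix (Fin n)) : Decidable (Isomorphic M N) := by
  unfold Isomorphic
  infer_instance

theorem HasType.isomorphic {n : ℕ} {M N : CoxeterMatrix (Fin n)} (hM : HasType Φ M)
    (hN : HasType Φ N) : Isomorphic M N :=
  hM.exists_equiv hN

theorem isIrreducible_iff_three {Φ : Set (EuclideanSpace ℝ (Fin 3))} :
    IsIrreducibleRootSystem Φ ↔ HasType Φ (CoxeterMatrix.A 3) ∨ HasType Φ (CoxeterMatrix.B 3) ∨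
      HasType Φ CoxeterMatrix.H₃ := by
  refine ⟨fun h => ?_, ?_⟩
  · obtain ⟨M, hM⟩ := h.1.exists_hasType (n := 3) (by simp)
    exact hM.classification_three h
  · rintro (h | h | h)
    · exact h.isIrreducible_A₃
    · exact h.isIrreducible_B₃
    · exact h.isIrreducible_H₃

/-- The automorphisms of a diagram have no element of order three. -/
def TrialityFree (M : CoxeterMatrix (Fin 4)) : Prop :=
  ∀ σ : Equiv.Perm (Fin 4), (∀ i j, label M (σ i) (σ j) = label M i j) → σ ^ 3 = 1 → σ = 1

instance (M : CoxeterMatrix (Fin 4)) : Decidable (TrialityFree M) := by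
  unfold TrialityFree
  infer_instance

/-- Triality may be witnessed by another labelling of the diagram; the isomorphism with `M`
conjugates that symmetry to one of `M`. -/
theorem HasType.not_hasTriality {M : CoxeterMatrix (Fin 4)} (hM : HasType Φ M)
    (hfree : TrialityFree M) : ¬ HasTriality Φ := by
  rintro ⟨N, hN, σ, hσ, h⟩
  obtain ⟨τ, hτ⟩ := hN.exists_equiv hM
  have hNσ (i j : Fin 4) : N (σ i) (σ j) = N i j := by
    conv_lhs => rw [← h]
    simp [CoxeterMatrix.reindex]
  have h1 := hfree (τ * σ * τ⁻¹) (fun i j => ?_) ?_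
  · have : σ = 1 := by simpa [mul_inv_eq_one] using h1
    rw [this, orderOf_one] at hσ
    norm_num at hσ
  · change M (τ (σ (τ⁻¹ i))) (τ (σ (τ⁻¹ j))) = M i j
    rw [← hτ, hNσ, hτ]
    simp
  · rw [conj_pow, ← hσ, pow_orderOf_eq_one, mul_one, mul_inv_cancel]

theorem HasType.hasTriality_D₄ (h : HasType Φ D₄) : HasTriality Φ := by
  -- The permutation is a 3-cycle of the leaves 0, 2, 3 that fixes the central node.
  refine ⟨D₄, h, Equiv.swap 0 2 * Equiv.swap 2 3, ?_, ?_⟩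
  · exact orderOf_eq_prime (by decide) (by decide)
  · ext i j
    revert i j
    exact (by decide : ∀ i j,
      label (D₄.reindex (Equiv.swap 0 2 * Equiv.swap 2 3)) i j = label D₄ i j)

theorem isExceptional_iff {Ψ : Set (EuclideanSpace ℝ (Fin 4))} :
    IsExceptional Ψ ↔
      HasType Ψ D₄ ∨ HasType Ψ CoxeterMatrix.F₄ ∨ HasType Ψ CoxeterMatrix.H₄ := by
  constructor
  · rintro ⟨hirr, h⟩
    obtain ⟨M, hM⟩ := hirr.1.exists_hasType (n := 4) (by simp)
    rcases hM.classification_four hirr with hT | hT | hT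
    · exact (h.elim (fun h => h (Or.inl hT)) (hT.not_hasTriality (by decide +kernel))).elim
    · exact (h.elim (fun h => h (Or.inr (Or.inl hT)))
        (hT.not_hasTriality (by decide +kernel))).elim
    · exact hT
  · rintro (h | h | h)
    · exact ⟨h.isIrreducible_D₄, Or.inr h.hasTriality_D₄⟩
    · refine ⟨h.isIrreducible_F₄, Or.inl ?_⟩
      rintro (h' | h' | h')
      all_goals exact absurd (h.isomorphic h') (by decide +kernel)
    · refine ⟨h.isIrreducible_H₄, Or.inl ?_⟩
      rintro (h' | h' | h')
      all_goals exact absurd (h.isomorphic h') (by decide +kernel)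

/-- Each exceptional type is induced by an existing rank-three type, and the type determines the
system up to equivalence. -/
theorem isExceptional_iff_induced {Ψ : Set (EuclideanSpace ℝ (Fin 4))} :
    IsExceptional Ψ ↔
      IsRootSystem Ψ ∧ ∃ Φ : Set (EuclideanSpace ℝ (Fin 3)),
        IsIrreducibleRootSystem Φ ∧ Equivalent (induced Φ) Ψ := by
  constructor
  · intro hΨ
    refine ⟨hΨ.1.1, ?_⟩
    rcases isExceptional_iff.mp hΨ with h | h | h
    · obtain ⟨Φ, hΦ⟩ := exists_hasType_A₃
      exact ⟨Φ, hΦ.isIrreducible_A₃, (hasType_induced_D₄ hΦ).equivalent h⟩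
    · obtain ⟨Φ, hΦ⟩ := exists_hasType_B₃
      exact ⟨Φ, hΦ.isIrreducible_B₃, (hasType_induced_F₄ hΦ).equivalent h⟩
    · obtain ⟨Φ, hΦ⟩ := exists_hasType_H₃
      exact ⟨Φ, hΦ.isIrreducible_H₃, (hasType_induced_H₄ hΦ).equivalent h⟩
  · rintro ⟨hΨ, Φ, hΦ, he⟩
    refine isExceptional_iff.mpr ?_
    rcases isIrreducible_iff_three.mp hΦ with h | h | h
    · exact Or.inl ((hasType_induced_D₄ h).of_equivalent he hΨ)
    · exact Or.inr (Or.inl ((hasType_induced_F₄ h).of_equivalent he hΨ))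
    · exact Or.inr (Or.inr ((hasType_induced_H₄ h).of_equivalent he hΨ))

end Diagrams

end SpinorInduction

end

/-! ### The main theorem. -/

open SpinorInduction in
theorem mainTheorem2 :
    -- the irreducible root systems in three dimensions are those of type A₃, B₃ and H₃
    (∀ Φ : Set (EuclideanSpace ℝ (Fin 3)), IsIrreducibleRootSystem Φ ↔
      HasType Φ (CoxeterMatrix.A 3) ∨ HasType Φ (CoxeterMatrix.B 3) ∨
        HasType Φ CoxeterMatrix.H₃) ∧
    -- each of the three types occurs, no root system has two of them, and the type determines the
    -- root system up to isometry and the lengths of the roots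
    (∀ M ∈ ({CoxeterMatrix.A 3, CoxeterMatrix.B 3, CoxeterMatrix.H₃} : Set (CoxeterMatrix (Fin 3))),
      (∃ Φ : Set (EuclideanSpace ℝ (Fin 3)), HasType Φ M) ∧
      (∀ Φ : Set (EuclideanSpace ℝ (Fin 3)), HasType Φ M →
        ∀ N ∈ ({CoxeterMatrix.A 3, CoxeterMatrix.B 3, CoxeterMatrix.H₃} :
          Set (CoxeterMatrix (Fin 3))), HasType Φ N → N = M) ∧
      (∀ Φ Φ' : Set (EuclideanSpace ℝ (Fin 3)), HasType Φ M → HasType Φ' M → Equivalent Φ Φ')) ∧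
    -- the induced root systems in four dimensions
    (∀ Φ : Set (EuclideanSpace ℝ (Fin 3)),
      (HasType Φ (A₁pow 3) → HasType (induced Φ) (A₁pow 4)) ∧
      (HasType Φ (CoxeterMatrix.A 3) → HasType (induced Φ) D₄) ∧
      (HasType Φ (CoxeterMatrix.B 3) → HasType (induced Φ) CoxeterMatrix.F₄) ∧
      (HasType Φ CoxeterMatrix.H₃ → HasType (induced Φ) CoxeterMatrix.H₄)) ∧
    -- D₄, F₄ and H₄ are exactly the exceptional root systems in four dimensions
    (∀ Ψ : Set (EuclideanSpace ℝ (Fin 4)), IsExceptional Ψ ↔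
      HasType Ψ D₄ ∨ HasType Ψ CoxeterMatrix.F₄ ∨ HasType Ψ CoxeterMatrix.H₄) ∧
    -- the exceptional root systems are exactly those induced by the irreducible root systems in
    -- three dimensions
    (∀ Ψ : Set (EuclideanSpace ℝ (Fin 4)), IsExceptional Ψ ↔
      IsRootSystem Ψ ∧ ∃ Φ : Set (EuclideanSpace ℝ (Fin 3)),
        IsIrreducibleRootSystem Φ ∧ Equivalent (induced Φ) Ψ) := by
  refine ⟨fun Φ => isIrreducible_iff_three, ?_, fun Φ => ⟨hasType_induced_A₁pow,
    hasType_induced_D₄, hasType_induced_F₄, hasType_induced_H₄⟩, fun Ψ => isExceptional_iff,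
    fun Ψ => isExceptional_iff_induced⟩
  intro M hM
  refine ⟨?_, ?_, fun Φ Φ' h h' => h.equivalent h'⟩
  · rcases hM with rfl | rfl | rfl
    · exact exists_hasType_A₃
    · exact exists_hasType_B₃
    · exact exists_hasType_H₃
  · intro Φ h N hN h'
    -- Two types of one root system have isomorphic diagrams, and the three diagrams are pairwise
    -- non-isomorphic.
    have hiso := h.isomorphic h'
    rcases hM with rfl | rfl | rfl <;> rcases hN with rfl | rfl | rfl <;>
      first
      | rfl
      | exact absurd hiso (by decide +kernel)
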